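/- **Proposition 3.4.** Let $(M,g(t))$, $t\in(0,T]$, be a smooth Ricci flow, $\partial_t g_{ij}=-2R_{ij}$, of Riemannian metrics on a smooth $d$-dimensional manifold $M$. Curvature conventions: $\mathrm{Rm}(X,Y)Z=\nabla_Y\nabla_XZ-\nabla_X\nabla_YZ+\nabla_{[X,Y]}Z$, $R_{ijkl}=\langle \mathrm{Rm}(\partial_i,\partial_j)\partial_k,\partial_l\rangle$, $R_{ij}=g^{kl}R_{ikjl}$, $\mathrm R=g^{ij}R_{ij}$. Put $$P_{ijk}=\nabla_iR_{jk}-\nabla_jR_{ik},\qquad M_{ij}=\Delta R_{ij}+2R_{ikjl}R^{kl}-R_i^kR_{kj}-\tfrac12\nabla_i\nabla_j\mathrm R+\tfrac1{2t}R_{ij}.$$ For $N\in\mathbb N$ let $\bar M=M\times(0,T]$ carry the (possibly indefinite or degenerate) symmetric 2-tensor $\bar g$ with $$\bar g_{ij}=g_{ij},\qquad \bar g_{0i}=0,\qquad \bar g_{00}=\mathrm R-\frac N{2t},$$ where $i,j,\dots$ are indices of local coordinates $x^1,\dots,x^d$ on $M$ and $0$ is the index of $x^0=t$. Where $\bar g$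 is nondegenerate let $\bar\nabla$, $\overline{\mathrm{Rm}}$ be its Levi-Civita connection and curvature tensor, $\bar\Delta=\bar g^{ab}\bar\nabla_a\bar\nabla_b$ (sum over all indices $a,b$, including $0$), and let $(\bar\nabla_0-\bar\Delta)\bar R_{abcd}$ denote the $abcd$-component of the tensor $\bar\nabla_{\partial/\partial t}\overline{\mathrm{Rm}}-\bar\Delta\overline{\mathrm{Rm}}$ (at $t=T$ time derivatives are one-sided). Write $A\underset{N}{=}B$ if $A$ equals $B$ up to errors of order $1/N$: for every compact set $K$ of coordinate points in (chart domain)$\,\times(0,T]$ there are constants $C,N_0$ with $|A-B|\le C/N$ on $K$ for all $N\ge N_0$ (on each $K$, $\bar g$ is nondegenerate for all large $N$). Then, in every smooth chart of $M$ and for all $i,j,k,l\in\{1,\dots,d\}$, $$\begin{aligned} (\bar\nabla_0-\bar\Delta)\bar R_{ijkl}&\underset{N}{=}2R_{imjn}R_k{}^m{}_l{}^n-2R_{imjn}R_l{}^m{}_k{}^n+2R_{imkn}R_j{}^m{}_l{}^n-2R_{imln}R_j{}^m{}_k{}^n,\\ (\bar\nabla_0-\bar\Delta)\bar R_{ij0k}&\underset{N}{=}2R_{imjn}P^{mn}{}_k+2R_{imkn}P^m{}_j{}^n+2R_{jmkn}P_i{}^{mn}+\frac1{2t}P_{ijk},\\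 (\bar\nabla_0-\bar\Delta)\bar R_{i0j0}&\underset{N}{=}2R_{imjn}M^{mn}+2P_{imn}P_j{}^{mn}-4P_{imn}P_j{}^{nm}-\frac1{2t^2}R_{ij}+\frac1tM_{ij}. \end{aligned}$$ (The repeated indices $m,n$ are summed over $1,\dots,d$ and are raised with $g$.) -/

import Mathlib

open scoped Manifold ContDiff
open Set Filter

noncomputable section

/-! Tensor calculus in coordinates. -/

/-- The coordinate space `ℝ^ι`. -/
abbrev Coords (ι : Type) : Type := EuclideanSpace ℝ ι

/-- The components `A_{s 0 … s (k-1)}` of a covariant `k`-tensor field, as functions of the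
coordinates. -/
abbrev CovTensor (ι : Type) (k : ℕ) : Type := (Fin k → ι) → Coords ι → ℝ

section Coordinates

variable {ι : Type} [Fintype ι] [DecidableEq ι]

/-- The partial derivative `∂f/∂x^a` on the domain `D`; it is one-sided at boundary points
of `D`. -/
def pderivOn (D : Set (Coords ι)) (a : ι) (f : Coords ι → ℝ) (z : Coords ι) : ℝ :=
  fderivWithin ℝ f D z (EuclideanSpace.single a 1)

/-- The Christoffel symbol `Γ^a_{bc}` of the metric with components `G`. -/
def christoffel (D : Set (Coords ι)) (G : Coords ι → Matrix ι ι ℝ) (a b c : ι)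
    (z : Coords ι) : ℝ :=
  (1 / 2) * ∑ d, (G z)⁻¹ a d *
    (pderivOn D b (fun y => G y c d) z + pderivOn D c (fun y => G y b d) z
      - pderivOn D d (fun y => G y b c) z)

/-- The curvature component `R_{abc}{}^f`, with the sign convention
`Rm(X,Y)Z = ∇_Y ∇_X Z - ∇_X ∇_Y Z + ∇_{[X,Y]} Z`. -/
def riemannUp (D : Set (Coords ι)) (G : Coords ι → Matrix ι ι ℝ) (a b c f : ι)
    (z : Coords ι) : ℝ :=
  pderivOn D b (christoffel D G f a c) z - pderivOn D a (christoffel D G f b c) z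
    + ∑ e, (christoffel D G e a c z * christoffel D G f b e z
      - christoffel D G e b c z * christoffel D G f a e z)

/-- The full curvature tensor `R_{abcd} = g_{df} R_{abc}{}^f`. -/
def riemann (D : Set (Coords ι)) (G : Coords ι → Matrix ι ι ℝ) : CovTensor ι 4 :=
  fun s z => ∑ f, G z (s 3) f * riemannUp D G (s 0) (s 1) (s 2) f z

/-- The Ricci tensor `R_{ij} = g^{kl} R_{ikjl}`. -/
def ricci (D : Set (Coords ι)) (G : Coords ι → Matrix ι ι ℝ) : CovTensor ι 2 :=
  fun s z => ∑ k, ∑ l, (G z)⁻¹ k l * riemann D G ![s 0, k, s 1, l] z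

/-- The scalar curvature `g^{ij} R_{ij}`. -/
def scalarCurv (D : Set (Coords ι)) (G : Coords ι → Matrix ι ι ℝ) (z : Coords ι) : ℝ :=
  ∑ i, ∑ j, (G z)⁻¹ i j * ricci D G ![i, j] z

/-- The Levi-Civita covariant derivative of a covariant tensor field; the first index of the
result is the direction of differentiation:
`(∇A)_{c s} = ∂_c A_s - ∑_r Γ^m_{c s_r} A_{s with s_r replaced by m}`. -/
def covDeriv (D : Set (Coords ι)) (G : Coords ι → Matrix ι ι ℝ) {k : ℕ} (A : CovTensor ι k) :
    CovTensor ι (k + 1) :=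
  fun s z => pderivOn D (s 0) (A (fun r => s r.succ)) z
    - ∑ r : Fin k, ∑ m, christoffel D G m (s 0) (s r.succ) z *
        A (Function.update (fun q => s q.succ) r m) z

/-- The Laplacian `g^{ab} ∇_a ∇_b` on covariant tensor fields. -/
def tensorLaplacian (D : Set (Coords ι)) (G : Coords ι → Matrix ι ι ℝ) {k : ℕ}
    (A : CovTensor ι k) : CovTensor ι k :=
  fun s z => ∑ a, ∑ b, (G z)⁻¹ a b *
    covDeriv D G (covDeriv D G A) (Matrix.vecCons a (Matrix.vecCons b s)) z

/-- `P_{ijk} = ∇_i R_{jk} - ∇_j R_{ik}`. -/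
def harnackP (D : Set (Coords ι)) (G : Coords ι → Matrix ι ι ℝ) (i j k : ι)
    (x : Coords ι) : ℝ :=
  covDeriv D G (ricci D G) ![i, j, k] x - covDeriv D G (ricci D G) ![j, i, k] x

/-- `M_{ij} = Δ R_{ij} + 2 R_{ikjl} R^{kl} - R_i^k R_{kj} - (1/2) ∇_i ∇_j R + (1/(2t)) R_{ij}`
at time `t`. -/
def harnackM (D : Set (Coords ι)) (G : Coords ι → Matrix ι ι ℝ) (t : ℝ) (i j : ι)
    (x : Coords ι) : ℝ :=
  tensorLaplacian D G (ricci D G) ![i, j] x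
    + 2 * ∑ k, ∑ l, ∑ p, ∑ q, riemann D G ![i, k, j, l] x * (G x)⁻¹ k p * (G x)⁻¹ l q *
        ricci D G ![p, q] x
    - ∑ k, ∑ l, ricci D G ![i, l] x * (G x)⁻¹ l k * ricci D G ![k, j] x
    - (1 / 2) * covDeriv D G (covDeriv D G (k := 0) (fun _ => scalarCurv D G)) ![i, j] x
    + 1 / (2 * t) * ricci D G ![i, j] x

end Coordinates

/-! Riemannian metrics and Ricci flows on manifolds. -/

/-- Smooth Riemannian metrics on the `n`-dimensional smooth manifold `M`. -/
abbrev RiemMetric (n : ℕ) (M : Type*) [TopologicalSpace M]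
    [ChartedSpace (EuclideanSpace ℝ (Fin n)) M] [IsManifold (𝓡 n) ∞ M] :=
  Bundle.ContMDiffRiemannianMetric (𝓡 n) ∞ (EuclideanSpace ℝ (Fin n))
    (fun p : M => TangentSpace (𝓡 n) p)

/-- The spatial part `(x^1, …, x^n)` of the space-time coordinates `(x^0, x^1, …, x^n)`,
where `x^0 = t`. -/
def spacePart {n : ℕ} (z : Coords (Fin (n + 1))) : Coords (Fin n) :=
  WithLp.toLp 2 (fun i : Fin n => z i.succ)

/-- The set `U × (0, T]` in space-time coordinates. -/
def spacetimeDomain {n : ℕ} (U : Set (Coords (Fin n))) (T : ℝ) : Set (Coords (Fin (n + 1))) :=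
  {z | z 0 ∈ Ioc 0 T ∧ spacePart z ∈ U}

section Manifold

variable {n : ℕ} {M : Type*} [TopologicalSpace M] [ChartedSpace (EuclideanSpace ℝ (Fin n)) M]
  [IsManifold (𝓡 n) ∞ M]

/-- The coordinate vector field `∂/∂x^i` of the chart `e` at the point with coordinates `x`. -/
def coordVec (e : OpenPartialHomeomorph M (EuclideanSpace ℝ (Fin n))) (x : Coords (Fin n))
    (i : Fin n) : TangentSpace (𝓡 n) (e.symm x) :=
  mfderiv (𝓡 n) (𝓡 n) e.symm x (EuclideanSpace.single i (1 : ℝ) : EuclideanSpace ℝ (Fin n))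

/-- The components `g_{ij} = g(∂/∂x^i, ∂/∂x^j)` of a metric in the chart `e`. -/
def metricInChart (e : OpenPartialHomeomorph M (EuclideanSpace ℝ (Fin n)))
    (g : RiemMetric n M) (x : Coords (Fin n)) : Matrix (Fin n) (Fin n) ℝ :=
  Matrix.of fun i j => g.inner (e.symm x) (coordVec e x i) (coordVec e x j)

/-- `g(t)`, `t ∈ (0, T]`, is a smooth solution of the Ricci flow `∂g_{ij}/∂t = -2 R_{ij}` on `M`:
in every smooth chart the components are jointly smooth in space and time and satisfy the
equation (with a one-sided derivative at `t = T`). -/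
structure IsRicciFlow (T : ℝ) (g : ℝ → RiemMetric n M) : Prop where
  smooth : ∀ e ∈ IsManifold.maximalAtlas (𝓡 n) ∞ M, ∀ i j : Fin n,
    ContDiffOn ℝ ∞ (fun z : Coords (Fin (n + 1)) => metricInChart e (g (z 0)) (spacePart z) i j)
      (spacetimeDomain e.target T)
  flow : ∀ e ∈ IsManifold.maximalAtlas (𝓡 n) ∞ M, ∀ t ∈ Ioc 0 T, ∀ x ∈ e.target,
    ∀ i j : Fin n, HasDerivWithinAt (fun s => metricInChart e (g s) x i j)
      (-2 * ricci e.target (metricInChart e (g t)) ![i, j] x) (Ioc 0 T) t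

/-- The family of components of the metrics `g t` in the chart `e`. -/
def flowInChart (e : OpenPartialHomeomorph M (EuclideanSpace ℝ (Fin n))) (g : ℝ → RiemMetric n M)
    (t : ℝ) : Coords (Fin n) → Matrix (Fin n) (Fin n) ℝ :=
  metricInChart e (g t)

end Manifold

/-! The restricted thermostat. -/

section Thermostat

variable {n : ℕ}

/-- The components of the metric `ḡ` of the restricted thermostat in the space-time coordinates
`(x^0, x^1, …, x^n)`, `x^0 = t`, for a family `γ t` of metrics on `U`:
`ḡ_{00} = R - N/(2t)`, `ḡ_{0i} = 0`, `ḡ_{ij} = g_{ij}`. -/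
def barMetric (U : Set (Coords (Fin n))) (γ : ℝ → Coords (Fin n) → Matrix (Fin n) (Fin n) ℝ)
    (N : ℕ) (z : Coords (Fin (n + 1))) : Matrix (Fin (n + 1)) (Fin (n + 1)) ℝ :=
  Matrix.of fun a b =>
    Fin.cases
      (Fin.cases (scalarCurv U (γ (z 0)) (spacePart z) - (N : ℝ) / (2 * z 0)) (fun _ => 0) b)
      (fun i => Fin.cases 0 (fun j => γ (z 0) (spacePart z) i j) b) a

/-- The components `(∇̄_0 - Δ̄) R̄_{abcd}`, i.e. the components of `∇̄_{∂/∂t} Rm̄ - Δ̄ Rm̄`, of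
the restricted thermostat over `U × (0, T]`. -/
def barHeatRm (U : Set (Coords (Fin n))) (T : ℝ)
    (γ : ℝ → Coords (Fin n) → Matrix (Fin n) (Fin n) ℝ) (N : ℕ) : CovTensor (Fin (n + 1)) 4 :=
  fun s z =>
    let D := spacetimeDomain U T
    let G := barMetric U γ N
    covDeriv D G (riemann D G) (Matrix.vecCons 0 s) z - tensorLaplacian D G (riemann D G) s z

/-- `A_N = B` up to errors of order `1/N`, locally uniformly on `D`. -/
def EqUpToInvN {ι : Type} (D : Set (Coords ι)) (A : ℕ → Coords ι → ℝ) (B : Coords ι → ℝ) :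
    Prop :=
  ∀ K ⊆ D, IsCompact K → ∃ C : ℝ, ∃ N₀ : ℕ, ∀ N : ℕ, 1 ≤ N → N₀ ≤ N → ∀ z ∈ K,
    |A N z - B z| ≤ C / N

end Thermostat

section SpaceTimeFunctions

variable {n : ℕ} (U : Set (Coords (Fin n))) (γ : ℝ → Coords (Fin n) → Matrix (Fin n) (Fin n) ℝ)
  (z : Coords (Fin (n + 1)))

/-! The tensors of `(U, γ t)` as functions of the space-time point `z = (t, x)`. Suffixes `u` and
`d` name the upper and lower positions of the indices, from left to right. -/

/-- `g^{ij}` -/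
def stInv (i j : Fin n) : ℝ := (γ (z 0) (spacePart z))⁻¹ i j

/-- `R_{ijkl}` -/
def stRm (i j k l : Fin n) : ℝ := riemann U (γ (z 0)) ![i, j, k, l] (spacePart z)

/-- `R_{ij}` -/
def stRic (i j : Fin n) : ℝ := ricci U (γ (z 0)) ![i, j] (spacePart z)

/-- `P_{ijk}` -/
def stP (i j k : Fin n) : ℝ := harnackP U (γ (z 0)) i j k (spacePart z)

/-- `M_{ij}` -/
def stMdd (i j : Fin n) : ℝ := harnackM U (γ (z 0)) (z 0) i j (spacePart z)

/-- `R_k{}^p{}_l{}^q` -/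
def stRmdudu (k p l q : Fin n) : ℝ :=
  ∑ a, ∑ b, stInv γ z p a * stInv γ z q b * stRm U γ z k a l b

/-- `P^{pq}{}_k` -/
def stPuud (p q k : Fin n) : ℝ := ∑ a, ∑ b, stInv γ z p a * stInv γ z q b * stP U γ z a b k

/-- `P^p{}_j{}^q` -/
def stPudu (p j q : Fin n) : ℝ := ∑ a, ∑ b, stInv γ z p a * stInv γ z q b * stP U γ z a j b

/-- `P_i{}^{pq}` -/
def stPduu (i p q : Fin n) : ℝ := ∑ a, ∑ b, stInv γ z p a * stInv γ z q b * stP U γ z i a b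

/-- `M^{pq}` -/
def stMuu (p q : Fin n) : ℝ := ∑ a, ∑ b, stInv γ z p a * stInv γ z q b * stMdd U γ z a b

end SpaceTimeFunctions

end

set_option linter.unusedSectionVars false

/-! Write `v` for the coefficient `ḡ_{00} = R - N/(2t)` and `s = 1/v`. The parameter `N` can be
eliminated: since `N/(2t²) = (R - v)/t`, the partial derivatives of `s` are smooth functions of `s`
and the space-time coordinates, and they vanish at `s = 0`. Hence the quantities of the form `F(s,
z)` with `F` smooth (`HasExp`) are stable under sums, products and derivatives, and taking the
leading term `F(0, z)` commutes with all of these. As `s = O(1/N)` uniformly on compact sets, such a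
quantity equals its leading term up to `O(1/N)` (`HasExp.eqUpToInvN`). The inverse metric, the
Christoffel symbols and the curvature have this form. For the curvature the growing factor `v`,
which appears on lowering an index to `0`, is avoided by the antisymmetry in the last two slots. It
remains to compute the heat operator at `s = 0`.

The limit is a torsion-free connection with a parallel symmetric bivector `h`, the inverse metric of
the time slices, degenerate in the direction `dt`. It carries a tensor `R_{abcd}` which inherits the
symmetries and both Bianchi identities of the curvatures at finite `N`, and whose last index is
raised by `h` to the curvature of the connection (`CurvatureGeometry`, `exists_limit_riemann`).
Indices can be contracted with `h` but not freely lowered. The Ricci flow equation becomes a soliton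
equation: with `X = ∂_t`, `θ = dt` and `τ = 1/(2t)`, one has `∇_c X = - Ric_c - τ θ_c X`, the index
of `Ric_c` being raised by `h` (`SolitonGeometry`).

Differentiating the soliton equation and antisymmetrising gives the curvature in the direction `X`:
`R(X, b, c, d)` is the divergence of the curvature plus `τ (θ_c Ric_{bd} - θ_d Ric_{bc})`
(`curvature_time`). The second Bianchi identity turns `∇_X Rm` into an antisymmetrised derivative of
`R(X, ·, ·, ·)`. The Bianchi and Ricci identities express the Laplacian of `Rm` by the
antisymmetrised derivative of its divergence, Ricci terms and quadratic terms (`lapOf_curvature`).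
In the difference the divergences and the Ricci terms cancel, leaving the quadratic terms and
corrections in `τ` (`heat_curvature`).

Restriction to spatial components identifies `R_{ijkl}` with the curvature of the slice, `R_{ij0k}`
with `P_{ijk}` and `R_{i0j0}` with `M_{ij}` (`stP_eq`, `stMdd_eq`), and the three formulas result.
-/

noncomputable section

/-! ### One-sided partial derivatives on regular domains. -/

section PartialDerivatives

variable {ι : Type} [Fintype ι] [DecidableEq ι]

/-- Domains with enough interior for one-sided partial derivatives to be unique and to
commute. -/
structure RegularDomain (D : Set (Coords ι)) : Prop where
  uniqueDiffOn : UniqueDiffOn ℝ D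
  subset_closure : D ⊆ closure (interior D)

/-- Real functions smooth on `D`. -/
abbrev SmoothFn (D : Set (Coords ι)) (f : Coords ι → ℝ) : Prop := ContDiffOn ℝ ∞ f D

variable {D : Set (Coords ι)} {f g : Coords ι → ℝ} {z : Coords ι}

theorem SmoothFn.differentiableWithinAt (hf : SmoothFn D f) (hz : z ∈ D) :
    DifferentiableWithinAt ℝ f D z :=
  (hf z hz).differentiableWithinAt (by simp)

theorem SmoothFn.sum {κ : Type*} {s : Finset κ} {F : κ → Coords ι → ℝ}
    (h : ∀ k ∈ s, SmoothFn D (F k)) : SmoothFn D (fun y => ∑ k ∈ s, F k y) :=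
  ContDiffOn.sum h

theorem SmoothFn.pderivOn (hD : RegularDomain D) (hf : SmoothFn D f) (a : ι) :
    SmoothFn D (pderivOn D a f) := by
  have h : ContDiffOn ℝ ∞ (fderivWithin ℝ f D) D :=
    ContDiffOn.fderivWithin hf hD.uniqueDiffOn (by simp)
  exact h.clm_apply contDiffOn_const

theorem pderivOn_congr (h : ∀ y ∈ D, f y = g y) (hz : z ∈ D) (a : ι) :
    pderivOn D a f z = pderivOn D a g z := by
  unfold pderivOn
  rw [fderivWithin_congr' h hz]

theorem pderivOn_const (a : ι) (c : ℝ) : pderivOn D a (fun _ => c) z = 0 := by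
  simp [pderivOn]

theorem pderivOn_zero_of_forall (h : ∀ y ∈ D, f y = 0) (hz : z ∈ D) (a : ι) :
    pderivOn D a f z = 0 := by
  rw [pderivOn_congr h hz, pderivOn_const]

theorem pderivOn_inter {O : Set (Coords ι)} (hO : O ∈ nhds z) (a : ι) :
    pderivOn (D ∩ O) a f z = pderivOn D a f z := by
  unfold pderivOn
  rw [fderivWithin_inter hO]

variable (hD : RegularDomain D) (hz : z ∈ D)
include hD hz

theorem pderivOn_add (hf : SmoothFn D f) (hg : SmoothFn D g) (a : ι) :
    pderivOn D a (fun y => f y + g y) z = pderivOn D a f z + pderivOn D a g z := by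
  unfold pderivOn
  rw [fderivWithin_fun_add (hD.uniqueDiffOn z hz) (hf.differentiableWithinAt hz)
    (hg.differentiableWithinAt hz)]
  rfl

theorem pderivOn_sub (hf : SmoothFn D f) (hg : SmoothFn D g) (a : ι) :
    pderivOn D a (fun y => f y - g y) z = pderivOn D a f z - pderivOn D a g z := by
  unfold pderivOn
  rw [fderivWithin_fun_sub (hD.uniqueDiffOn z hz) (hf.differentiableWithinAt hz)
    (hg.differentiableWithinAt hz)]
  rfl

theorem pderivOn_neg (a : ι) :
    pderivOn D a (fun y => - f y) z = - pderivOn D a f z := by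
  unfold pderivOn
  rw [fderivWithin_fun_neg (hD.uniqueDiffOn z hz)]
  rfl

theorem pderivOn_mul (hf : SmoothFn D f) (hg : SmoothFn D g) (a : ι) :
    pderivOn D a (fun y => f y * g y) z
      = pderivOn D a f z * g z + f z * pderivOn D a g z := by
  unfold pderivOn
  rw [fderivWithin_fun_mul (hD.uniqueDiffOn z hz) (hf.differentiableWithinAt hz)
    (hg.differentiableWithinAt hz)]
  simp only [add_apply, smul_apply, smul_eq_mul]
  ring

theorem pderivOn_const_mul (c : ℝ) (hf : SmoothFn D f) (a : ι) :
    pderivOn D a (fun y => c * f y) z = c * pderivOn D a f z := by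
  rw [pderivOn_mul hD hz contDiffOn_const hf, pderivOn_const]
  ring

theorem pderivOn_sum {κ : Type*} {s : Finset κ} {F : κ → Coords ι → ℝ}
    (h : ∀ k ∈ s, SmoothFn D (F k)) (a : ι) :
    pderivOn D a (fun y => ∑ k ∈ s, F k y) z = ∑ k ∈ s, pderivOn D a (F k) z := by
  unfold pderivOn
  rw [fderivWithin_fun_sum (hD.uniqueDiffOn z hz)
    (fun k hk => (h k hk).differentiableWithinAt hz)]
  simp

/-- At boundary points, such as the final time, the symmetry of second derivatives is inherited from
the interior; this is what `subset_closure` in `RegularDomain` is for. -/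
theorem pderivOn_comm (hf : SmoothFn D f) (a b : ι) :
    pderivOn D a (pderivOn D b f) z = pderivOn D b (pderivOn D a f) z := by
  have h : ContDiffOn ℝ ∞ (fderivWithin ℝ f D) D :=
    ContDiffOn.fderivWithin hf hD.uniqueDiffOn (by simp)
  have key : ∀ u w : Coords ι, fderivWithin ℝ (fun y => fderivWithin ℝ f D y u) D z w
      = fderivWithin ℝ (fderivWithin ℝ f D) D z w u := by
    intro u w
    rw [fderivWithin_clm_apply (hD.uniqueDiffOn z hz)
      ((h z hz).differentiableWithinAt (by simp)) (differentiableWithinAt_const _)]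
    simp
  have hs : IsSymmSndFDerivWithinAt ℝ f D z :=
    ContDiffWithinAt.isSymmSndFDerivWithinAt (n := ∞) (hf z hz)
      (by rw [minSmoothness_of_isRCLikeNormedField]; exact WithTop.coe_le_coe.2 (le_top : (2 : ℕ∞) ≤ ⊤)) hD.uniqueDiffOn (hD.subset_closure hz) hz
  unfold pderivOn
  rw [key, key]
  exact hs _ _

end PartialDerivatives

/-! ### Covariant derivatives and the Ricci identity for a general connection. -/

section Connections

open Matrix (vecCons)

variable {ι : Type} [Fintype ι] [DecidableEq ι]

/-- The covariant derivative of covariant tensor fields for the connection with Christoffel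
symbols `Γ a b c = Γ^a_{bc}`. -/
def covD (D : Set (Coords ι)) (Γ : ι → ι → ι → Coords ι → ℝ) {k : ℕ} (A : CovTensor ι k) :
    CovTensor ι (k + 1) :=
  fun s z => pderivOn D (s 0) (A (fun r => s r.succ)) z
    - ∑ r : Fin k, ∑ m, Γ m (s 0) (s r.succ) z *
        A (Function.update (fun q => s q.succ) r m) z

/-- The curvature `R_{abc}{}^f` of a connection. -/
def connCurv (D : Set (Coords ι)) (Γ : ι → ι → ι → Coords ι → ℝ) (a b c f : ι)
    (z : Coords ι) : ℝ :=
  pderivOn D b (Γ f a c) z - pderivOn D a (Γ f b c) z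
    + ∑ e, (Γ e a c z * Γ f b e z - Γ e b c z * Γ f a e z)

/-- All components of the tensor field are smooth on `D`. -/
abbrev SmoothTensor (D : Set (Coords ι)) {k : ℕ} (A : CovTensor ι k) : Prop :=
  ∀ s, SmoothFn D (A s)

/-- The bivector field `h` is parallel. -/
def ParallelBivector (D : Set (Coords ι)) (Γ : ι → ι → ι → Coords ι → ℝ)
    (h : ι → ι → Coords ι → ℝ) : Prop :=
  ∀ c a b, ∀ y ∈ D, pderivOn D c (h a b) y
    = - ∑ m, Γ a c m y * h m b y - ∑ m, Γ b c m y * h a m y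

variable {D : Set (Coords ι)} {Γ : ι → ι → ι → Coords ι → ℝ} {k : ℕ} {A B : CovTensor ι k}
  {z : Coords ι}

theorem covDeriv_eq_covD (G : Coords ι → Matrix ι ι ℝ) (A : CovTensor ι k) :
    covDeriv D G A = covD D (christoffel D G) A := rfl

theorem covD_cons (A : CovTensor ι k) (c : ι) (s : Fin k → ι) (z : Coords ι) :
    covD D Γ A (vecCons c s) z = pderivOn D c (A s) z
      - ∑ r : Fin k, ∑ m, Γ m c (s r) z * A (Function.update s r m) z := rfl

theorem update_vecCons_zero (a m : ι) (s : Fin k → ι) :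
    Function.update (vecCons a s) 0 m = vecCons m s :=
  Fin.update_cons_zero (α := fun _ => ι) a s m

theorem update_vecCons_succ (a m : ι) (s : Fin k → ι) (r : Fin k) :
    Function.update (vecCons a s) r.succ m = vecCons a (Function.update s r m) :=
  (Fin.cons_update (α := fun _ => ι) a s r m).symm

theorem covD_two (A : CovTensor ι 2) (c a b : ι) (z : Coords ι) :
    covD D Γ A ![c, a, b] z = pderivOn D c (A ![a, b]) z - ∑ m, Γ m c a z * A ![m, b] z
      - ∑ m, Γ m c b z * A ![a, m] z := by
  rw [covD_cons]
  simp only [Fin.sum_univ_succ, Fin.sum_univ_zero, update_vecCons_zero, update_vecCons_succ,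
    add_zero]
  simp only [Matrix.cons_val_zero, Matrix.cons_val_succ]
  ring

theorem covD_three (A : CovTensor ι 3) (c a b d : ι) (z : Coords ι) :
    covD D Γ A ![c, a, b, d] z = pderivOn D c (A ![a, b, d]) z
      - ∑ m, Γ m c a z * A ![m, b, d] z - ∑ m, Γ m c b z * A ![a, m, d] z
      - ∑ m, Γ m c d z * A ![a, b, m] z := by
  rw [covD_cons]
  simp only [Fin.sum_univ_succ, Fin.sum_univ_zero, update_vecCons_zero, update_vecCons_succ,
    add_zero]
  simp only [Matrix.cons_val_zero, Matrix.cons_val_succ]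
  ring

theorem covD_four (A : CovTensor ι 4) (c a b d e : ι) (z : Coords ι) :
    covD D Γ A ![c, a, b, d, e] z = pderivOn D c (A ![a, b, d, e]) z
      - ∑ m, Γ m c a z * A ![m, b, d, e] z - ∑ m, Γ m c b z * A ![a, m, d, e] z
      - ∑ m, Γ m c d z * A ![a, b, m, e] z - ∑ m, Γ m c e z * A ![a, b, d, m] z := by
  rw [covD_cons]
  simp only [Fin.sum_univ_succ, Fin.sum_univ_zero, update_vecCons_zero, update_vecCons_succ,
    add_zero]
  simp only [Matrix.cons_val_zero, Matrix.cons_val_succ]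
  ring

theorem covD_congr (h : ∀ s, ∀ y ∈ D, A s y = B s y) (hz : z ∈ D) (s : Fin (k + 1) → ι) :
    covD D Γ A s z = covD D Γ B s z := by
  unfold covD
  rw [pderivOn_congr (h _) hz]
  simp only [h _ z hz]

theorem covD_zero_of_forall (h : ∀ s, ∀ y ∈ D, A s y = 0) (hz : z ∈ D) (s : Fin (k + 1) → ι) :
    covD D Γ A s z = 0 := by
  unfold covD
  rw [pderivOn_zero_of_forall (h _) hz]
  simp [h _ z hz]

theorem SmoothTensor.covD (hD : RegularDomain D) (hΓ : ∀ a b c, SmoothFn D (Γ a b c))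
    (hA : SmoothTensor D A) : SmoothTensor D (covD D Γ A) := fun s =>
  ((hA _).pderivOn hD _).sub
    (SmoothFn.sum fun _ _ => SmoothFn.sum fun _ _ => (hΓ _ _ _).mul (hA _))

/-- The connection acts in the same way on every slot, so permuting slots only reindexes the sum of
connection terms. Symmetries and identities of a tensor are transferred to its derivative through
this. -/
theorem covD_perm (σ : Equiv.Perm (Fin k)) (A : CovTensor ι k) (c : ι) (s : Fin k → ι)
    (z : Coords ι) :
    covD D Γ (fun s => A (s ∘ σ)) (vecCons c s) z = covD D Γ A (vecCons c (s ∘ σ)) z := by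
  rw [covD_cons, covD_cons]
  congr 1
  rw [← Equiv.sum_comp σ]
  simp only [Function.update_comp_equiv, Equiv.symm_apply_apply, Function.comp_apply]

theorem covD_const_mul (hD : RegularDomain D) (hz : z ∈ D) (hA : SmoothTensor D A) (ε : ℝ)
    (s : Fin (k + 1) → ι) :
    covD D Γ (fun s y => ε * A s y) s z = ε * covD D Γ A s z := by
  unfold covD
  rw [pderivOn_const_mul hD hz ε (hA _), mul_sub, Finset.mul_sum]
  simp only [Finset.mul_sum]
  congr 1
  refine Finset.sum_congr rfl fun _ _ => Finset.sum_congr rfl fun _ _ => ?_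
  ring

theorem covD_add (hD : RegularDomain D) (hz : z ∈ D) (hA : SmoothTensor D A)
    (hB : SmoothTensor D B) (s : Fin (k + 1) → ι) :
    covD D Γ (fun s y => A s y + B s y) s z = covD D Γ A s z + covD D Γ B s z := by
  unfold covD
  rw [pderivOn_add hD hz (hA _) (hB _)]
  simp only [mul_add, Finset.sum_add_distrib]
  ring

theorem covD_sub (hD : RegularDomain D) (hz : z ∈ D) (hA : SmoothTensor D A)
    (hB : SmoothTensor D B) (s : Fin (k + 1) → ι) :
    covD D Γ (fun s y => A s y - B s y) s z = covD D Γ A s z - covD D Γ B s z := by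
  unfold covD
  rw [pderivOn_sub hD hz (hA _) (hB _)]
  simp only [mul_sub, Finset.sum_sub_distrib]
  ring

/-- A symmetry of a tensor field passes to its covariant derivative. -/
theorem covD_symm (hD : RegularDomain D) (hz : z ∈ D) (hA : SmoothTensor D A)
    (σ : Equiv.Perm (Fin k)) (ε : ℝ) (h : ∀ s, ∀ y ∈ D, A (s ∘ σ) y = ε * A s y)
    (c : ι)
    (s : Fin k → ι) :
    covD D Γ A (vecCons c (s ∘ σ)) z = ε * covD D Γ A (vecCons c s) z := by
  rw [← covD_perm, covD_congr h hz, covD_const_mul hD hz hA]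

theorem sum_pair_comm {α β : Type*} [Fintype α] [Fintype β]
    (F : α → ι → β → ι → ℝ) :
    ∑ a, ∑ b, ∑ c, ∑ d, F a b c d = ∑ c, ∑ d, ∑ a, ∑ b, F a b c d := by
  calc _ = ∑ a, ∑ c, ∑ b, ∑ d, F a b c d := Finset.sum_congr rfl fun _ _ => Finset.sum_comm
    _ = ∑ c, ∑ a, ∑ d, ∑ b, F a b c d := by
        rw [Finset.sum_comm]
        exact Finset.sum_congr rfl fun _ _ => Finset.sum_congr rfl fun _ _ => Finset.sum_comm
    _ = _ := Finset.sum_congr rfl fun _ _ => Finset.sum_comm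

/-- Contraction with a parallel bivector commutes with the covariant derivative. -/
theorem covD_contract (hD : RegularDomain D) (hz : z ∈ D) {h : ι → ι → Coords ι → ℝ}
    (hh : ∀ a b, SmoothFn D (h a b)) (hp : ParallelBivector D Γ h) {A : CovTensor ι (k + 2)}
    (hA : SmoothTensor D A) (c : ι) (s : Fin k → ι) :
    covD D Γ (fun s y => ∑ m, ∑ n, h m n y * A (vecCons m (vecCons n s)) y) (vecCons c s) z
      = ∑ m, ∑ n, h m n z * covD D Γ A (vecCons c (vecCons m (vecCons n s))) z := by
  have e1 : ∀ m n, covD D Γ A (vecCons c (vecCons m (vecCons n s))) z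
      = pderivOn D c (A (vecCons m (vecCons n s))) z
        - ∑ p, Γ p c m z * A (vecCons p (vecCons n s)) z
        - ∑ p, Γ p c n z * A (vecCons m (vecCons p s)) z
        - ∑ r, ∑ p, Γ p c (s r) z * A (vecCons m (vecCons n (Function.update s r p))) z := by
    intro m n
    rw [covD_cons, Fin.sum_univ_succ, Fin.sum_univ_succ]
    simp only [update_vecCons_zero, update_vecCons_succ]
    simp only [Matrix.cons_val_zero, Matrix.cons_val_succ]
    ring
  have e2 : pderivOn D c (fun y => ∑ m, ∑ n, h m n y * A (vecCons m (vecCons n s)) y) z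
      = ∑ m, ∑ n, (h m n z * pderivOn D c (A (vecCons m (vecCons n s))) z
        + (- ∑ p, Γ m c p z * h p n z - ∑ p, Γ n c p z * h m p z)
          * A (vecCons m (vecCons n s)) z) := by
    rw [pderivOn_sum hD hz fun _ _ => SmoothFn.sum fun _ _ => (hh _ _).mul (hA _)]
    refine Finset.sum_congr rfl fun m _ => ?_
    rw [pderivOn_sum hD hz fun _ _ => (hh _ _).mul (hA _)]
    refine Finset.sum_congr rfl fun n _ => ?_
    rw [pderivOn_mul hD hz (hh _ _) (hA _), hp c m n z hz]
    ring
  rw [covD_cons, e2]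
  simp only [e1]
  -- By parallelism the derivative of `h` produces connection terms, which `t1` and `t2` match with
  -- the ones acting on the two contracted slots; `t3` handles the free slots.
  have t1 : ∑ m, ∑ n, (∑ p, Γ m c p z * h p n z) * A (vecCons m (vecCons n s)) z
      = ∑ m, ∑ n, h m n z * ∑ p, Γ p c m z * A (vecCons p (vecCons n s)) z := by
    simp only [Finset.sum_mul, Finset.mul_sum]
    rw [Finset.sum_comm]
    conv_rhs => rw [Finset.sum_comm]
    refine Finset.sum_congr rfl fun n _ => ?_
    rw [Finset.sum_comm]
    refine Finset.sum_congr rfl fun m _ => Finset.sum_congr rfl fun p _ => ?_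
    ring
  have t2 : ∑ m, ∑ n, (∑ p, Γ n c p z * h m p z) * A (vecCons m (vecCons n s)) z
      = ∑ m, ∑ n, h m n z * ∑ p, Γ p c n z * A (vecCons m (vecCons p s)) z := by
    simp only [Finset.sum_mul, Finset.mul_sum]
    refine Finset.sum_congr rfl fun m _ => ?_
    rw [Finset.sum_comm]
    refine Finset.sum_congr rfl fun n _ => Finset.sum_congr rfl fun p _ => ?_
    ring
  have t3 : ∑ r, ∑ p, Γ p c (s r) z * (∑ m, ∑ n, h m n z *
        A (vecCons m (vecCons n (Function.update s r p))) z)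
      = ∑ m, ∑ n, h m n z * ∑ r, ∑ p, Γ p c (s r) z *
        A (vecCons m (vecCons n (Function.update s r p))) z := by
    simp only [Finset.mul_sum]
    rw [sum_pair_comm]
    refine Finset.sum_congr rfl fun _ _ => Finset.sum_congr rfl fun _ _ =>
      Finset.sum_congr rfl fun _ _ => Finset.sum_congr rfl fun _ _ => ?_
    ring
  simp only [mul_sub, sub_mul, neg_mul, Finset.sum_add_distrib,
    Finset.sum_sub_distrib,
    Finset.sum_neg_distrib, t1, t2, t3]
  ring

/-- Inserting the coordinate field `∂/∂x^o` into the first slot. -/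
theorem covD_insert (A : CovTensor ι (k + 1)) (c o : ι) (s : Fin k → ι) (z : Coords ι) :
    covD D Γ (fun s => A (vecCons o s)) (vecCons c s) z
      = covD D Γ A (vecCons c (vecCons o s)) z + ∑ p, Γ p c o z * A (vecCons p s) z := by
  rw [covD_cons, covD_cons, Fin.sum_univ_succ]
  simp only [update_vecCons_zero, update_vecCons_succ]
  simp only [Matrix.cons_val_zero, Matrix.cons_val_succ]
  ring

/-- In a second covariant derivative two connection terms may act on the same slot, where they
compose to a matrix product, or on different slots. Only the first kind contributes to the
curvature. -/
theorem sum_update_update (f g : ι → ι → ℝ) (A : (Fin k → ι) → ℝ) (s : Fin k → ι) :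
    ∑ r, ∑ m, f m (s r) * ∑ q, ∑ p, g p (Function.update s r m q) *
        A (Function.update (Function.update s r m) q p)
      = ∑ r, ∑ p, (∑ m, f m (s r) * g p m) * A (Function.update s r p)
        + ∑ r, ∑ q, if q = r then 0 else ∑ m, ∑ p, f m (s r) * g p (s q) *
          A (Function.update (Function.update s r m) q p) := by
  rw [← Finset.sum_add_distrib]
  refine Finset.sum_congr rfl fun r _ => ?_
  have h1 : ∀ m q, ∑ p, g p (Function.update s r m q) *
        A (Function.update (Function.update s r m) q p)
      = (if q = r then ∑ p, g p m * A (Function.update s r p) else 0)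
        + if q = r then 0 else ∑ p, g p (s q) *
          A (Function.update (Function.update s r m) q p) := by
    intro m q
    split_ifs with h
    · subst h
      simp
    · simp [Function.update_of_ne h]
  simp only [h1, Finset.sum_add_distrib, mul_add, Finset.sum_ite_eq', Finset.mem_univ, if_true]
  congr 1
  · simp only [Finset.mul_sum, Finset.sum_mul]
    rw [Finset.sum_comm]
    refine Finset.sum_congr rfl fun _ _ => Finset.sum_congr rfl fun _ _ => ?_
    ring
  · simp only [Finset.mul_sum]
    rw [Finset.sum_comm]
    refine Finset.sum_congr rfl fun q _ => ?_
    split_ifs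
    · simp
    · simp only [Finset.mul_sum, mul_assoc]

/-- Actions on different slots commute, so these terms drop out of the commutator of two covariant
derivatives. -/
theorem sum_update_update_comm (f g : ι → ι → ℝ) (A : (Fin k → ι) → ℝ) (s : Fin k → ι) :
    (∑ r, ∑ q, if q = r then 0 else ∑ m, ∑ p, f m (s r) * g p (s q) *
          A (Function.update (Function.update s r m) q p))
      = ∑ r, ∑ q, if q = r then 0 else ∑ m, ∑ p, g m (s r) * f p (s q) *
          A (Function.update (Function.update s r m) q p) := by
  rw [Finset.sum_comm]
  refine Finset.sum_congr rfl fun q _ => Finset.sum_congr rfl fun r _ => ?_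
  by_cases h : q = r
  · simp [h]
  · rw [if_neg h, if_neg (Ne.symm h), Finset.sum_comm]
    refine Finset.sum_congr rfl fun m _ => Finset.sum_congr rfl fun p _ => ?_
    rw [Function.update_comm h]
    ring

theorem covD_covD_cons (hD : RegularDomain D) (hz : z ∈ D)
    (hΓ : ∀ a b c, SmoothFn D (Γ a b c)) (hA : SmoothTensor D A) (a b : ι) (s : Fin k → ι) :
    covD D Γ (covD D Γ A) (vecCons a (vecCons b s)) z
      = pderivOn D a (pderivOn D b (A s)) z
        - ∑ r, ∑ m, (pderivOn D a (Γ m b (s r)) z * A (Function.update s r m) z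
          + Γ m b (s r) z * pderivOn D a (A (Function.update s r m)) z)
        - ∑ m, Γ m a b z * covD D Γ A (vecCons m s) z
        - ∑ r, ∑ m, Γ m a (s r) z * pderivOn D b (A (Function.update s r m)) z
        + ∑ r, ∑ m, Γ m a (s r) z * ∑ q, ∑ p, Γ p b (Function.update s r m q) z *
            A (Function.update (Function.update s r m) q p) z := by
  rw [covD_cons, Fin.sum_univ_succ]
  simp only [update_vecCons_zero, update_vecCons_succ]
  simp only [Matrix.cons_val_zero, Matrix.cons_val_succ]
  have e : pderivOn D a (covD D Γ A (vecCons b s)) z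
      = pderivOn D a (pderivOn D b (A s)) z
        - ∑ r, ∑ m, (pderivOn D a (Γ m b (s r)) z * A (Function.update s r m) z
          + Γ m b (s r) z * pderivOn D a (A (Function.update s r m)) z) := by
    change pderivOn D a (fun y => pderivOn D b (A s) y
      - ∑ r : Fin k, ∑ m, Γ m b (s r) y * A (Function.update s r m) y) z = _
    rw [pderivOn_sub hD hz ((hA _).pderivOn hD _)
      (SmoothFn.sum fun _ _ => SmoothFn.sum fun _ _ => (hΓ _ _ _).mul (hA _)),
      pderivOn_sum hD hz fun _ _ => SmoothFn.sum fun _ _ => (hΓ _ _ _).mul (hA _)]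
    congr 1
    refine Finset.sum_congr rfl fun r _ => ?_
    rw [pderivOn_sum hD hz fun _ _ => (hΓ _ _ _).mul (hA _)]
    refine Finset.sum_congr rfl fun m _ => ?_
    rw [pderivOn_mul hD hz (hΓ _ _ _) (hA _)]
  rw [e]
  have e3 : ∀ r m, covD D Γ A (vecCons b (Function.update s r m)) z
    = pderivOn D b (A (Function.update s r m)) z - ∑ q, ∑ p,
      Γ p b (Function.update s r m q) z *
        A (Function.update (Function.update s r m) q p) z := fun r m => covD_cons _ _ _ _
  simp only [e3, mul_sub, Finset.sum_sub_distrib]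
  ring

/-- The Ricci identity for a torsion-free connection. -/
theorem covD_covD_comm (hD : RegularDomain D) (hz : z ∈ D)
    (hΓ : ∀ a b c, SmoothFn D (Γ a b c)) (hsymm : ∀ a b c, Γ a b c z = Γ a c b z)
    (hA : SmoothTensor D A) (a b : ι) (s : Fin k → ι) :
    covD D Γ (covD D Γ A) (vecCons a (vecCons b s)) z
      = covD D Γ (covD D Γ A) (vecCons b (vecCons a s)) z
        + ∑ r, ∑ p, connCurv D Γ a b (s r) p z * A (Function.update s r p) z := by
  rw [covD_covD_cons hD hz hΓ hA, covD_covD_cons hD hz hΓ hA]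
  have h1 := sum_update_update (fun p c => Γ p a c z) (fun p c => Γ p b c z) (fun s => A s z) s
  have h2 := sum_update_update (fun p c => Γ p b c z) (fun p c => Γ p a c z) (fun s => A s z) s
  have h3 := sum_update_update_comm (fun p c => Γ p a c z) (fun p c => Γ p b c z)
    (fun s => A s z) s
  have h4 : ∑ r, ∑ p, connCurv D Γ a b (s r) p z * A (Function.update s r p) z
      = ∑ r, ∑ p, pderivOn D b (Γ p a (s r)) z * A (Function.update s r p) z
      - ∑ r, ∑ p, pderivOn D a (Γ p b (s r)) z * A (Function.update s r p) z
      + ∑ r, ∑ p, (∑ m, Γ m a (s r) z * Γ p b m z) * A (Function.update s r p) z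
      - ∑ r, ∑ p, (∑ m, Γ m b (s r) z * Γ p a m z) * A (Function.update s r p) z := by
    simp only [connCurv, add_mul, sub_mul, Finset.sum_add_distrib, Finset.sum_sub_distrib]
    ring
  rw [h4, h1, h2, h3, pderivOn_comm hD hz (hA s) a b]
  simp only [hsymm _ b a, Finset.sum_add_distrib]
  ring

end Connections

/-! ### Bianchi identities for the curvature of a connection. -/

section Curvature

open Matrix (vecCons)

variable {ι : Type} [Fintype ι] [DecidableEq ι]
  {D : Set (Coords ι)} {Γ : ι → ι → ι → Coords ι → ℝ} {z : Coords ι}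

theorem connCurv_antisymm (a b c f : ι) :
    connCurv D Γ b a c f z = - connCurv D Γ a b c f z := by
  simp only [connCurv, Finset.sum_sub_distrib]
  ring

theorem SmoothFn.connCurv (hD : RegularDomain D) (hΓ : ∀ a b c, SmoothFn D (Γ a b c))
    (a b c f : ι) : SmoothFn D (connCurv D Γ a b c f) :=
  (((hΓ _ _ _).pderivOn hD _).sub ((hΓ _ _ _).pderivOn hD _)).add
    (SmoothFn.sum fun _ _ => ((hΓ _ _ _).mul (hΓ _ _ _)).sub ((hΓ _ _ _).mul (hΓ _ _ _)))

/-- The first Bianchi identity. -/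
theorem connCurv_bianchi_first (hz : z ∈ D)
    (hsymm : ∀ a b c, ∀ y ∈ D, Γ a b c y = Γ a c b y) (a b c f : ι) :
    connCurv D Γ a b c f z + connCurv D Γ b c a f z + connCurv D Γ c a b f z = 0 := by
  simp only [connCurv, Finset.sum_sub_distrib]
  rw [pderivOn_congr (hsymm f a c) hz b, pderivOn_congr (hsymm f b a) hz c,
    pderivOn_congr (hsymm f c b) hz a]
  simp only [fun e => hsymm e a c z hz, fun e => hsymm e b a z hz, fun e => hsymm e c b z hz]
  ring

/-- The matrix `(Γ^f_{ac})_{fc}`. -/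
def connMatrix (Γ : ι → ι → ι → Coords ι → ℝ) (z : Coords ι) (a : ι) : Matrix ι ι ℝ :=
  Matrix.of fun f c => Γ f a c z

/-- The matrix `(∂_b Γ^f_{ac})_{fc}`. -/
def connMatrixDeriv (D : Set (Coords ι)) (Γ : ι → ι → ι → Coords ι → ℝ) (z : Coords ι)
    (b a : ι) : Matrix ι ι ℝ :=
  Matrix.of fun f c => pderivOn D b (Γ f a c) z

/-- The matrix `(R_{abc}{}^f)_{fc}`. -/
def curvMatrix (D : Set (Coords ι)) (Γ : ι → ι → ι → Coords ι → ℝ) (z : Coords ι)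
    (a b : ι) : Matrix ι ι ℝ :=
  Matrix.of fun f c => connCurv D Γ a b c f z

/-- The structure equation `F = dA + A ∧ A`. In matrix form the second Bianchi identity becomes an
identity in a noncommutative ring. -/
theorem curvMatrix_eq (a b : ι) : curvMatrix D Γ z a b
    = connMatrixDeriv D Γ z b a - connMatrixDeriv D Γ z a b
      + (connMatrix Γ z b * connMatrix Γ z a - connMatrix Γ z a * connMatrix Γ z b) := by
  ext f c
  simp only [curvMatrix, connCurv, connMatrixDeriv, connMatrix, Matrix.of_apply,
    Matrix.add_apply, Matrix.sub_apply, Matrix.mul_apply, Finset.sum_sub_distrib]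
  congr 2 <;> exact Finset.sum_congr rfl fun _ _ => mul_comm _ _

/-- The second Bianchi identity. -/
theorem connCurv_bianchi_second (hD : RegularDomain D) (hz : z ∈ D)
    (hΓ : ∀ a b c, SmoothFn D (Γ a b c)) (e a b c f : ι) :
    (pderivOn D e (connCurv D Γ a b c f) z + ∑ p, Γ f e p z * connCurv D Γ a b c p z
        - ∑ p, connCurv D Γ a b p f z * Γ p e c z)
      + (pderivOn D a (connCurv D Γ b e c f) z + ∑ p, Γ f a p z * connCurv D Γ b e c p z
        - ∑ p, connCurv D Γ b e p f z * Γ p a c z)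
      + (pderivOn D b (connCurv D Γ e a c f) z + ∑ p, Γ f b p z * connCurv D Γ e a c p z
        - ∑ p, connCurv D Γ e a p f z * Γ p b c z) = 0 := by
  -- The second derivatives of the connection are symmetric in the two directions and cancel in the
  -- cyclic sum; the remaining terms are matrix products.
  let Q : ι → ι → ι → Matrix ι ι ℝ := fun e b a =>
    Matrix.of fun f c => pderivOn D e (pderivOn D b (Γ f a c)) z
  have hQ : ∀ e b a, Q e b a = Q b e a := by
    intro e b a
    ext f c
    exact pderivOn_comm hD hz (hΓ f a c) e b
  have hd : ∀ e a b, (Matrix.of fun f c => pderivOn D e (connCurv D Γ a b c f) z)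
      = Q e b a - Q e a b
        + (connMatrixDeriv D Γ z e b * connMatrix Γ z a
          + connMatrix Γ z b * connMatrixDeriv D Γ z e a
          - (connMatrixDeriv D Γ z e a * connMatrix Γ z b
          + connMatrix Γ z a * connMatrixDeriv D Γ z e b)) := by
    intro e a b
    ext f c
    have h1 : pderivOn D e (connCurv D Γ a b c f) z
        = pderivOn D e (pderivOn D b (Γ f a c)) z - pderivOn D e (pderivOn D a (Γ f b c)) z
          + ∑ p, ((pderivOn D e (Γ p a c) z * Γ f b p z + Γ p a c z * pderivOn D e (Γ f b p) z)
            - (pderivOn D e (Γ p b c) z * Γ f a p z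
              + Γ p b c z * pderivOn D e (Γ f a p) z)) := by
      change pderivOn D e (fun y => (pderivOn D b (Γ f a c) y - pderivOn D a (Γ f b c) y)
        + ∑ p, (Γ p a c y * Γ f b p y - Γ p b c y * Γ f a p y)) z = _
      rw [pderivOn_add hD hz (((hΓ _ _ _).pderivOn hD _).sub ((hΓ _ _ _).pderivOn hD _))
        (SmoothFn.sum fun _ _ => ((hΓ _ _ _).mul (hΓ _ _ _)).sub ((hΓ _ _ _).mul (hΓ _ _ _))),
        pderivOn_sub hD hz ((hΓ _ _ _).pderivOn hD _) ((hΓ _ _ _).pderivOn hD _),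
        pderivOn_sum hD hz
          fun _ _ => ((hΓ _ _ _).mul (hΓ _ _ _)).sub ((hΓ _ _ _).mul (hΓ _ _ _))]
      congr 1
      refine Finset.sum_congr rfl fun p _ => ?_
      rw [pderivOn_sub hD hz ((hΓ _ _ _).mul (hΓ _ _ _)) ((hΓ _ _ _).mul (hΓ _ _ _)),
        pderivOn_mul hD hz (hΓ _ _ _) (hΓ _ _ _), pderivOn_mul hD hz (hΓ _ _ _) (hΓ _ _ _)]
    simp only [Matrix.of_apply, h1, Q, connMatrixDeriv, connMatrix, Matrix.add_apply,
      Matrix.sub_apply, Matrix.mul_apply, ← Finset.sum_add_distrib, ← Finset.sum_sub_distrib]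
    congr 1
    refine Finset.sum_congr rfl fun p _ => ?_
    ring
  have key : ∀ e a b, (Matrix.of fun f c => (pderivOn D e (connCurv D Γ a b c f) z
        + ∑ p, Γ f e p z * connCurv D Γ a b c p z - ∑ p, connCurv D Γ a b p f z * Γ p e c z))
      = (Matrix.of fun f c => pderivOn D e (connCurv D Γ a b c f) z)
        + connMatrix Γ z e * curvMatrix D Γ z a b
        - curvMatrix D Γ z a b * connMatrix Γ z e := by
    intro e a b
    ext f c
    simp [Matrix.mul_apply, connMatrix, curvMatrix]
  have main := congrFun (congrFun (show
    (Matrix.of fun f c => (pderivOn D e (connCurv D Γ a b c f) z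
        + ∑ p, Γ f e p z * connCurv D Γ a b c p z - ∑ p, connCurv D Γ a b p f z * Γ p e c z))
    + (Matrix.of fun f c => (pderivOn D a (connCurv D Γ b e c f) z
        + ∑ p, Γ f a p z * connCurv D Γ b e c p z - ∑ p, connCurv D Γ b e p f z * Γ p a c z))
    + (Matrix.of fun f c => (pderivOn D b (connCurv D Γ e a c f) z
        + ∑ p, Γ f b p z * connCurv D Γ e a c p z - ∑ p, connCurv D Γ e a p f z * Γ p b c z))
    = 0 by
      rw [key, key, key, hd, hd, hd, curvMatrix_eq, curvMatrix_eq, curvMatrix_eq, hQ a e b,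
        hQ b e a, hQ b a e]
      noncomm_ring) f) c
  exact main

end Curvature

/-! ### The Levi-Civita connection and its curvature tensor. -/

section LeviCivita

open Matrix (vecCons)

variable {ι : Type} [Fintype ι] [DecidableEq ι]

/-- `G` consists of the components of a smooth nondegenerate symmetric 2-tensor on `D`. -/
structure MetricOn (D : Set (Coords ι)) (G : Coords ι → Matrix ι ι ℝ) : Prop where
  smooth : ∀ i j, SmoothFn D (fun y => G y i j)
  symm : ∀ y ∈ D, ∀ i j, G y i j = G y j i
  det : ∀ y ∈ D, IsUnit (G y).det

variable {D : Set (Coords ι)} {G : Coords ι → Matrix ι ι ℝ} {z : Coords ι}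

theorem SmoothFn.det {κ : Type*} [Fintype κ] [DecidableEq κ] {G : Coords ι → Matrix κ κ ℝ}
    (h : ∀ i j, SmoothFn D (fun y => G y i j)) : SmoothFn D (fun y => (G y).det) := by
  simp only [Matrix.det_apply']
  exact SmoothFn.sum fun σ _ => contDiffOn_const.mul (contDiffOn_prod fun i _ => h _ _)

/-- By Cramer's rule the entries of the inverse are quotients of determinants. -/
theorem SmoothFn.matrix_inv {κ : Type*} [Fintype κ] [DecidableEq κ]
    {G : Coords ι → Matrix κ κ ℝ} (h : ∀ i j, SmoothFn D (fun y => G y i j))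
    (hdet : ∀ y ∈ D, IsUnit (G y).det) (i j : κ) : SmoothFn D (fun y => (G y)⁻¹ i j) := by
  have h1 : ∀ y, (G y)⁻¹ i j = ((G y).det)⁻¹ * ((G y).updateRow j (Pi.single i 1)).det := by
    intro y
    rw [Matrix.inv_def, Matrix.smul_apply, Matrix.adjugate_apply, Ring.inverse_eq_inv', smul_eq_mul]
  simp only [h1]
  refine ((SmoothFn.det h).inv fun y hy => (hdet y hy).ne_zero).mul (SmoothFn.det ?_)
  intro k l
  simp only [Matrix.updateRow_apply]
  split_ifs
  · exact contDiffOn_const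
  · exact h k l

theorem MetricOn.inv_smooth (hG : MetricOn D G) (i j : ι) :
    SmoothFn D (fun y => (G y)⁻¹ i j) := SmoothFn.matrix_inv hG.smooth hG.det i j

theorem MetricOn.inv_symm (hG : MetricOn D G) (hz : z ∈ D) (i j : ι) :
    (G z)⁻¹ i j = (G z)⁻¹ j i := by
  have h : (G z).transpose = G z := by
    ext i j
    exact hG.symm z hz j i
  have h2 := Matrix.transpose_nonsing_inv (G z)
  rw [h] at h2
  exact congrFun (congrFun h2.symm i) j

theorem MetricOn.mul_inv (hG : MetricOn D G) (hz : z ∈ D) (i j : ι) :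
    ∑ p, G z i p * (G z)⁻¹ p j = if i = j then 1 else 0 := by
  rw [← Matrix.mul_apply, Matrix.mul_nonsing_inv _ (hG.det z hz), Matrix.one_apply]

theorem MetricOn.inv_mul (hG : MetricOn D G) (hz : z ∈ D) (i j : ι) :
    ∑ p, (G z)⁻¹ i p * G z p j = if i = j then 1 else 0 := by
  rw [← Matrix.mul_apply, Matrix.nonsing_inv_mul _ (hG.det z hz), Matrix.one_apply]

theorem MetricOn.christoffel_smooth (hD : RegularDomain D) (hG : MetricOn D G) (a b c : ι) :
    SmoothFn D (christoffel D G a b c) :=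
  contDiffOn_const.mul (SmoothFn.sum fun _ _ => (hG.inv_smooth _ _).mul
    ((((hG.smooth _ _).pderivOn hD _).add ((hG.smooth _ _).pderivOn hD _)).sub
      ((hG.smooth _ _).pderivOn hD _)))

theorem MetricOn.christoffel_symm (hG : MetricOn D G) (hz : z ∈ D) (a b c : ι) :
    christoffel D G a b c z = christoffel D G a c b z := by
  unfold christoffel
  congr 1
  refine Finset.sum_congr rfl fun d _ => ?_
  rw [pderivOn_congr (fun y hy => hG.symm y hy b c) hz d]
  ring

theorem MetricOn.christoffel_lower (hG : MetricOn D G) (hz : z ∈ D) (a b c : ι) :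
    ∑ p, G z a p * christoffel D G p b c z
      = (1 / 2) * (pderivOn D b (fun y => G y c a) z + pderivOn D c (fun y => G y b a) z
        - pderivOn D a (fun y => G y b c) z) := by
  simp only [christoffel, Finset.mul_sum]
  rw [Finset.sum_comm]
  have : ∀ d, ∑ p, G z a p * (1 / 2 * ((G z)⁻¹ p d *
      (pderivOn D b (fun y => G y c d) z + pderivOn D c (fun y => G y b d) z
        - pderivOn D d (fun y => G y b c) z)))
      = (if a = d then 1 else 0) * ((1 / 2) * (pderivOn D b (fun y => G y c d) z
        + pderivOn D c (fun y => G y b d) z - pderivOn D d (fun y => G y b c) z)) := by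
    intro d
    rw [← hG.mul_inv hz a d, Finset.sum_mul]
    exact Finset.sum_congr rfl fun _ _ => by ring
  simp only [this, ite_mul, one_mul, zero_mul, Finset.sum_ite_eq, Finset.mem_univ, if_true]

/-- Metric compatibility: in the sum of the two lowered Christoffel symbols all derivatives of the
metric cancel except the one in direction `c`. -/
theorem MetricOn.pderivOn_metric (hG : MetricOn D G) (hz : z ∈ D) (c a b : ι) :
    pderivOn D c (fun y => G y a b) z
      = ∑ p, G z a p * christoffel D G p c b z + ∑ p, christoffel D G p c a z * G z p b := by
  have h : ∑ p, christoffel D G p c a z * G z p b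
      = ∑ p, G z b p * christoffel D G p c a z :=
    Finset.sum_congr rfl fun p _ => by rw [hG.symm z hz p b, mul_comm]
  rw [h, hG.christoffel_lower hz, hG.christoffel_lower hz,
    pderivOn_congr (fun y hy => hG.symm y hy b a) hz c,
    pderivOn_congr (fun y hy => hG.symm y hy c b) hz a,
    pderivOn_congr (fun y hy => hG.symm y hy c a) hz b]
  ring

/-- Differentiate `G⁻¹ G = 1`, insert metric compatibility for the derivative of `G`, and multiply
by `G⁻¹` from the right. -/
theorem MetricOn.parallelBivector_inv (hD : RegularDomain D) (hG : MetricOn D G) :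
    ParallelBivector D (christoffel D G) (fun a b y => (G y)⁻¹ a b) := by
  intro c a b z hz
  have h0 : ∀ q, ∑ p, (pderivOn D c (fun y => (G y)⁻¹ a p) z * G z p q
      + (G z)⁻¹ a p * pderivOn D c (fun y => G y p q) z) = 0 := by
    intro q
    have h1 := pderivOn_congr (fun y hy => hG.inv_mul (z := y) hy a q) hz c
    rw [pderivOn_const, pderivOn_sum hD hz
      fun _ _ => (hG.inv_smooth _ _).mul (hG.smooth _ _)] at h1
    rw [← h1]
    exact Finset.sum_congr rfl fun p _ =>
      (pderivOn_mul hD hz (hG.inv_smooth _ _) (hG.smooth _ _) c).symm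
  let H : Matrix ι ι ℝ := (G z)⁻¹
  let dH : Matrix ι ι ℝ := Matrix.of fun a b => pderivOn D c (fun y => (G y)⁻¹ a b) z
  let dG : Matrix ι ι ℝ := Matrix.of fun a b => pderivOn D c (fun y => G y a b) z
  let M : Matrix ι ι ℝ := connMatrix (christoffel D G) z c
  have e1 : (dH * G z + H * dG) a = 0 := by
    ext q
    simpa [Matrix.mul_apply, dH, dG, H, Finset.sum_add_distrib] using h0 q
  have e2 : dG = G z * M + M.transpose * G z := by
    ext p q
    simpa [Matrix.mul_apply, dG, M, connMatrix] using hG.pderivOn_metric hz c p q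
  have hGH : G z * H = 1 := Matrix.mul_nonsing_inv _ (hG.det z hz)
  have hHG : H * G z = 1 := Matrix.nonsing_inv_mul _ (hG.det z hz)
  have e3 : (dH * G z + H * dG) * H = dH + M * H + H * M.transpose := by
    rw [e2]
    calc _ = dH * (G z * H) + (H * G z) * M * H + H * M.transpose * (G z * H) := by
          noncomm_ring
      _ = _ := by rw [hGH, hHG]; simp
  have e4 : ((dH * G z + H * dG) * H) a b = 0 := by
    rw [Matrix.mul_apply]
    exact Finset.sum_eq_zero fun j _ => by rw [congrFun e1 j, Pi.zero_apply, zero_mul]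
  rw [e3] at e4
  simp only [Matrix.add_apply, Matrix.mul_apply, Matrix.transpose_apply, dH, M, H, connMatrix,
    Matrix.of_apply] at e4
  have e5 : ∑ m, christoffel D G b c m z * (G z)⁻¹ a m
      = ∑ m, (G z)⁻¹ a m * christoffel D G b c m z :=
    Finset.sum_congr rfl fun _ _ => mul_comm _ _
  rw [e5]
  linarith

theorem riemann_apply (a b c d : ι) : riemann D G ![a, b, c, d] z
    = ∑ f, G z d f * connCurv D (christoffel D G) a b c f z := rfl

theorem riemann_antisymm_left (a b c d : ι) :
    riemann D G ![b, a, c, d] z = - riemann D G ![a, b, c, d] z := by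
  simp only [riemann_apply, ← Finset.sum_neg_distrib]
  refine Finset.sum_congr rfl fun f _ => ?_
  rw [connCurv_antisymm]
  ring

theorem MetricOn.riemann_bianchi_first (hG : MetricOn D G) (hz : z ∈ D) (a b c d : ι) :
    riemann D G ![a, b, c, d] z + riemann D G ![b, c, a, d] z
      + riemann D G ![c, a, b, d] z = 0 := by
  simp only [riemann_apply, ← Finset.sum_add_distrib]
  refine Finset.sum_eq_zero fun f _ => ?_
  rw [← mul_add, ← mul_add, connCurv_bianchi_first hz
    fun a b c y hy => hG.christoffel_symm hy a b c, mul_zero]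

/-- Differentiating metric compatibility once more and using that second derivatives of `G` commute
shows that the curvature matrix `C` satisfies `G C + Cᵀ G = 0`. -/
theorem MetricOn.riemann_antisymm_right (hD : RegularDomain D) (hG : MetricOn D G) (hz : z ∈ D)
    (a b c d : ι) : riemann D G ![a, b, d, c] z = - riemann D G ![a, b, c, d] z := by
  let Γ := christoffel D G
  have hΓ := hG.christoffel_smooth hD
  let g : Matrix ι ι ℝ := G z
  let dg : ι → Matrix ι ι ℝ := fun a => Matrix.of fun i j => pderivOn D a (fun y => G y i j) z
  let M := connMatrix Γ z
  let P := connMatrixDeriv D Γ z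
  have e1 : ∀ a, dg a = g * M a + (M a).transpose * g := by
    intro a
    ext p q
    simpa [Matrix.mul_apply, dg, M, g, Γ, connMatrix] using hG.pderivOn_metric hz a p q
  have e2 : ∀ a b, (Matrix.of fun i j => pderivOn D a (pderivOn D b (fun y => G y i j)) z)
      = dg a * M b + g * P a b + ((P a b).transpose * g + (M b).transpose * dg a) := by
    intro a b
    ext i j
    have h1 : pderivOn D a (pderivOn D b (fun y => G y i j)) z
        = pderivOn D a (fun y => ∑ p, G y i p * Γ p b j y + ∑ p, Γ p b i y * G y p j) z :=
      pderivOn_congr (fun y hy => hG.pderivOn_metric hy b i j) hz a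
    rw [pderivOn_add hD hz (SmoothFn.sum fun _ _ => (hG.smooth _ _).mul (hΓ _ _ _))
      (SmoothFn.sum fun _ _ => (hΓ _ _ _).mul (hG.smooth _ _)),
      pderivOn_sum hD hz fun _ _ => (hG.smooth _ _).mul (hΓ _ _ _),
      pderivOn_sum hD hz fun _ _ => (hΓ _ _ _).mul (hG.smooth _ _)] at h1
    simp only [Matrix.of_apply, h1, Matrix.add_apply, Matrix.mul_apply, Matrix.transpose_apply,
      dg, M, P, g, connMatrix, connMatrixDeriv, ← Finset.sum_add_distrib]
    refine Finset.sum_congr rfl fun p _ => ?_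
    rw [pderivOn_mul hD hz (hG.smooth _ _) (hΓ _ _ _),
      pderivOn_mul hD hz (hΓ _ _ _) (hG.smooth _ _)]
  have e3 : dg a * M b + g * P a b + ((P a b).transpose * g + (M b).transpose * dg a)
      = dg b * M a + g * P b a + ((P b a).transpose * g + (M a).transpose * dg b) := by
    rw [← e2, ← e2]
    ext i j
    exact pderivOn_comm hD hz (hG.smooth i j) a b
  rw [e1, e1] at e3
  let C := curvMatrix D Γ z a b
  have hC : C = P b a - P a b + (M b * M a - M a * M b) := curvMatrix_eq a b
  have e4 : g * C + C.transpose * g = 0 := by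
    rw [hC]
    simp only [Matrix.transpose_add, Matrix.transpose_sub, Matrix.transpose_mul]
    rw [← sub_eq_zero] at e3
    rw [← neg_eq_zero, ← e3]
    noncomm_ring
  have e5 := congrFun (congrFun e4 c) d
  simp only [Matrix.add_apply, Matrix.mul_apply, Matrix.transpose_apply, Matrix.zero_apply, C,
    curvMatrix, Matrix.of_apply, g] at e5
  simp only [riemann_apply]
  have e6 : ∑ f, G z d f * connCurv D (christoffel D G) a b c f z
      = ∑ f, connCurv D Γ a b c f z * G z f d :=
    Finset.sum_congr rfl fun f _ => by rw [hG.symm z hz f d, mul_comm]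
  rw [e6]
  linarith

/-- The classical octahedron argument: combine the four cyclic identities obtained by rotating `a b
c d`. -/
theorem pair_symm_of_bianchi {R : ι → ι → ι → ι → ℝ} (h1 : ∀ a b c d, R b a c d = - R a b c d)
    (h2 : ∀ a b c d, R a b d c = - R a b c d)
    (h3 : ∀ a b c d, R a b c d + R b c a d + R c a b d = 0) (a b c d : ι) :
    R a b c d = R c d a b := by
  have q1 := h3 a b c d
  have q2 := h3 b c d a
  have q3 := h3 c d a b
  have q4 := h3 d a b c
  have s1 := h1 b d c a
  have s2 := h1 c a d b
  have s3 := h1 a b d c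
  have t1 := h2 b c a d
  have t2 := h2 c d b a
  have t3 := h2 d a c b
  have t4 := h2 a b c d
  have t5 := h2 c a d b
  have t6 := h2 b d a c
  have u1 := h2 d b c a
  have u2 := h1 a c d b
  have u3 := h2 a c b d
  have u4 := h1 a c b d
  have u5 := h1 b d a c
  linarith

/-- The derivative of the lowering metric absorbs the connection term of the last slot. What `G`
multiplies is then the expression in `connCurv_bianchi_second`, and the connection terms in the
first two slots cancel in the cyclic sum because the torsion vanishes. -/
theorem MetricOn.covDeriv_riemann (hD : RegularDomain D) (hG : MetricOn D G) (hz : z ∈ D)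
    (e a b c d : ι) : covDeriv D G (riemann D G) ![e, a, b, c, d] z
      = ∑ f, G z d f * (pderivOn D e (connCurv D (christoffel D G) a b c f) z
          + ∑ p, christoffel D G f e p z * connCurv D (christoffel D G) a b c p z
          - ∑ p, connCurv D (christoffel D G) a b p f z * christoffel D G p e c z)
        - ∑ p, christoffel D G p e a z * riemann D G ![p, b, c, d] z
        - ∑ p, christoffel D G p e b z * riemann D G ![a, p, c, d] z := by
  have hΓ := hG.christoffel_smooth hD
  rw [covDeriv_eq_covD, covD_four]
  have h1 : pderivOn D e (riemann D G ![a, b, c, d]) z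
      = ∑ f, (pderivOn D e (fun y => G y d f) z * connCurv D (christoffel D G) a b c f z
        + G z d f * pderivOn D e (connCurv D (christoffel D G) a b c f) z) := by
    change pderivOn D e (fun y => ∑ f, G y d f * connCurv D (christoffel D G) a b c f y) z = _
    rw [pderivOn_sum hD hz fun _ _ => (hG.smooth _ _).mul (SmoothFn.connCurv hD hΓ _ _ _ _)]
    exact Finset.sum_congr rfl fun f _ =>
      pderivOn_mul hD hz (hG.smooth _ _) (SmoothFn.connCurv hD hΓ _ _ _ _) e
  have h2 : ∑ p, christoffel D G p e c z * riemann D G ![a, b, p, d] z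
      = ∑ f, G z d f * ∑ p, connCurv D (christoffel D G) a b p f z
        * christoffel D G p e c z := by
    simp only [riemann_apply, Finset.mul_sum]
    rw [Finset.sum_comm]
    exact Finset.sum_congr rfl fun _ _ => Finset.sum_congr rfl fun _ _ => by ring
  have h3 : ∑ f, pderivOn D e (fun y => G y d f) z * connCurv D (christoffel D G) a b c f z
      = ∑ f, G z d f * ∑ p, christoffel D G f e p z * connCurv D (christoffel D G) a b c p z
        + ∑ p, christoffel D G p e d z * riemann D G ![a, b, c, p] z := by
    simp only [hG.pderivOn_metric hz, riemann_apply, Finset.mul_sum, add_mul, Finset.sum_mul,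
      Finset.sum_add_distrib]
    congr 1
    · rw [Finset.sum_comm]
      exact Finset.sum_congr rfl fun _ _ => Finset.sum_congr rfl fun _ _ => by ring
    · rw [Finset.sum_comm]
      exact Finset.sum_congr rfl fun _ _ => Finset.sum_congr rfl fun _ _ => by ring
  rw [h1, h2, Finset.sum_add_distrib, h3]
  simp only [mul_add, mul_sub, Finset.sum_add_distrib, Finset.sum_sub_distrib]
  ring

/-- The second Bianchi identity for the Riemann tensor of a metric. -/
theorem MetricOn.riemann_bianchi_second (hD : RegularDomain D) (hG : MetricOn D G) (hz : z ∈ D)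
    (e a b c d : ι) :
    covDeriv D G (riemann D G) ![e, a, b, c, d] z + covDeriv D G (riemann D G) ![a, b, e, c, d] z
      + covDeriv D G (riemann D G) ![b, e, a, c, d] z = 0 := by
  have hb := Finset.sum_congr (rfl : (Finset.univ : Finset ι) = Finset.univ) fun f _ =>
    congrArg (fun x => G z d f * x)
      (connCurv_bianchi_second hD hz (hG.christoffel_smooth hD) e a b c f)
  simp only [mul_zero, Finset.sum_const_zero] at hb
  have hs : ∀ p q x y, ∑ m, christoffel D G m p q z * riemann D G ![m, x, y, d] z
      = ∑ m, christoffel D G m q p z * riemann D G ![m, x, y, d] z := fun p q x y =>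
    Finset.sum_congr rfl fun m _ => by rw [hG.christoffel_symm hz]
  have ha : ∀ p q x y, ∑ m, christoffel D G m p q z * riemann D G ![x, m, y, d] z
      = - ∑ m, christoffel D G m p q z * riemann D G ![m, x, y, d] z := fun p q x y => by
    rw [← Finset.sum_neg_distrib]
    exact Finset.sum_congr rfl fun m _ => by rw [riemann_antisymm_left]; ring
  rw [hG.covDeriv_riemann hD hz, hG.covDeriv_riemann hD hz, hG.covDeriv_riemann hD hz,
    ha, ha, ha, hs a e, hs b a, hs e b]
  simp only [mul_add, Finset.sum_add_distrib] at hb ⊢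
  linarith

/-! Restriction of the domain. -/

theorem RegularDomain.inter_isOpen (hD : RegularDomain D) {O : Set (Coords ι)} (hO : IsOpen O) :
    RegularDomain (D ∩ O) := by
  refine ⟨hD.uniqueDiffOn.inter hO, fun z hz => ?_⟩
  rw [interior_inter, hO.interior_eq]
  exact hO.closure_inter ⟨hD.subset_closure hz.1, hz.2⟩

variable {O : Set (Coords ι)}

/-- Locality is needed because, for a fixed `N`, the thermostat metric may degenerate somewhere in
space-time; metric identities are available only on the relatively open set where it does not. -/
theorem christoffel_inter (hO : IsOpen O) (hz : z ∈ O) (a b c : ι) :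
    christoffel (D ∩ O) G a b c z = christoffel D G a b c z := by
  simp only [christoffel, pderivOn_inter (hO.mem_nhds hz)]

theorem connCurv_inter (hO : IsOpen O) (hz : z ∈ D ∩ O) (a b c f : ι) :
    connCurv (D ∩ O) (christoffel (D ∩ O) G) a b c f z
      = connCurv D (christoffel D G) a b c f z := by
  have h : ∀ e a b c, pderivOn (D ∩ O) e (christoffel (D ∩ O) G a b c) z
      = pderivOn D e (christoffel D G a b c) z := fun e a b c =>
    (pderivOn_congr (fun y hy => christoffel_inter hO hy.2 a b c) hz e).trans
      (pderivOn_inter (hO.mem_nhds hz.2) e)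
  simp only [connCurv, h, christoffel_inter hO hz.2]

theorem riemann_inter (hO : IsOpen O) (hz : z ∈ D ∩ O) (s : Fin 4 → ι) :
    riemann (D ∩ O) G s z = riemann D G s z :=
  Finset.sum_congr rfl fun f _ =>
    congrArg (fun x => G z (s 3) f * x) (connCurv_inter hO hz (s 0) (s 1) (s 2) f)

theorem covDeriv_riemann_inter (hO : IsOpen O) (hz : z ∈ D ∩ O) (s : Fin 5 → ι) :
    covDeriv (D ∩ O) G (riemann (D ∩ O) G) s z = covDeriv D G (riemann D G) s z := by
  unfold covDeriv
  rw [pderivOn_congr (fun y hy => riemann_inter hO hy _) hz,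
    pderivOn_inter (hO.mem_nhds hz.2)]
  simp only [riemann_inter hO hz, christoffel_inter hO hz.2]

end LeviCivita

/-! ### Expansions in a small parameter depending on `N`. -/

section Expansions

variable {ι : Type} [Fintype ι] [DecidableEq ι]

/-- A sequence of functions `v N` growing like `N` whose inverses have partial derivatives which
are smooth functions of the inverse and the coordinates. -/
structure ExpansionScale (D : Set (Coords ι)) (v : ℕ → Coords ι → ℝ) : Prop where
  smooth : ∀ N, SmoothFn D (v N)
  pderiv_inv : ∀ a, ∃ w : ℝ × Coords ι → ℝ, ContDiffOn ℝ ∞ w (univ ×ˢ D) ∧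
    (∀ y ∈ D, w (0, y) = 0) ∧ ∀ N, ∀ y ∈ D, v N y ≠ 0 →
      pderivOn D a (fun y => (v N y)⁻¹) y = w ((v N y)⁻¹, y)
  bound : ∀ K ⊆ D, IsCompact K → ∃ C : ℝ, ∃ N₀ : ℕ, 0 ≤ C ∧ ∀ N : ℕ, 1 ≤ N → N₀ ≤ N → ∀ z ∈ K,
    v N z ≠ 0 ∧ |(v N z)⁻¹| ≤ C / N

/-- `A N` is a smooth function of `(v N)⁻¹` and the coordinates where `v N ≠ 0`, with leading
term `a`. -/
def HasExp (D : Set (Coords ι)) (v : ℕ → Coords ι → ℝ) (A : ℕ → Coords ι → ℝ)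
    (a : Coords ι → ℝ) : Prop :=
  ∃ F : ℝ × Coords ι → ℝ, ContDiffOn ℝ ∞ F (univ ×ˢ D) ∧ (∀ y ∈ D, F (0, y) = a y) ∧
    ∀ N, ∀ y ∈ D, v N y ≠ 0 → A N y = F ((v N y)⁻¹, y)

variable {D : Set (Coords ι)} {v : ℕ → Coords ι → ℝ} {A B : ℕ → Coords ι → ℝ}
  {a b : Coords ι → ℝ}

theorem HasExp.of_smooth (ha : SmoothFn D a) : HasExp D v (fun _ => a) a :=
  ⟨fun p => a p.2, ha.comp contDiffOn_snd fun _ hp => hp.2, fun _ _ => rfl,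
    fun _ _ _ _ => rfl⟩

theorem HasExp.inv : HasExp D v (fun N y => (v N y)⁻¹) (fun _ => 0) :=
  ⟨Prod.fst, contDiffOn_fst, fun _ _ => rfl, fun _ _ _ _ => rfl⟩

theorem HasExp.congr (h : HasExp D v A a) (hA : ∀ N, ∀ y ∈ D, v N y ≠ 0 → B N y = A N y)
    (ha : ∀ y ∈ D, b y = a y) : HasExp D v B b := by
  obtain ⟨F, hF, h0, h1⟩ := h
  exact ⟨F, hF, fun y hy => (h0 y hy).trans (ha y hy).symm,
    fun N y hy hv => (hA N y hy hv).trans (h1 N y hy hv)⟩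

theorem HasExp.add (hA : HasExp D v A a) (hB : HasExp D v B b) :
    HasExp D v (fun N y => A N y + B N y) (fun y => a y + b y) := by
  obtain ⟨F, hF, h0, h1⟩ := hA
  obtain ⟨F', hF', h0', h1'⟩ := hB
  exact ⟨fun p => F p + F' p, hF.add hF', fun y hy => congrArg₂ (· + ·) (h0 y hy) (h0' y hy),
    fun N y hy hv => congrArg₂ (· + ·) (h1 N y hy hv) (h1' N y hy hv)⟩

theorem HasExp.sub (hA : HasExp D v A a) (hB : HasExp D v B b) :
    HasExp D v (fun N y => A N y - B N y) (fun y => a y - b y) := by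
  obtain ⟨F, hF, h0, h1⟩ := hA
  obtain ⟨F', hF', h0', h1'⟩ := hB
  exact ⟨fun p => F p - F' p, hF.sub hF', fun y hy => congrArg₂ (· - ·) (h0 y hy) (h0' y hy),
    fun N y hy hv => congrArg₂ (· - ·) (h1 N y hy hv) (h1' N y hy hv)⟩

theorem HasExp.neg (hA : HasExp D v A a) : HasExp D v (fun N y => - A N y) (fun y => - a y) := by
  obtain ⟨F, hF, h0, h1⟩ := hA
  exact ⟨fun p => - F p, hF.neg, fun y hy => congrArg (- ·) (h0 y hy),
    fun N y hy hv => congrArg (- ·) (h1 N y hy hv)⟩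

theorem HasExp.mul (hA : HasExp D v A a) (hB : HasExp D v B b) :
    HasExp D v (fun N y => A N y * B N y) (fun y => a y * b y) := by
  obtain ⟨F, hF, h0, h1⟩ := hA
  obtain ⟨F', hF', h0', h1'⟩ := hB
  exact ⟨fun p => F p * F' p, hF.mul hF', fun y hy => congrArg₂ (· * ·) (h0 y hy) (h0' y hy),
    fun N y hy hv => congrArg₂ (· * ·) (h1 N y hy hv) (h1' N y hy hv)⟩

theorem HasExp.sum {κ : Type*} {s : Finset κ} {A : κ → ℕ → Coords ι → ℝ}
    {a : κ → Coords ι → ℝ} (h : ∀ k, HasExp D v (A k) (a k)) :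
    HasExp D v (fun N y => ∑ k ∈ s, A k N y) (fun y => ∑ k ∈ s, a k y) := by
  choose F hF h0 h1 using h
  exact ⟨fun p => ∑ k ∈ s, F k p, ContDiffOn.sum fun k _ => hF k,
    fun y hy => Finset.sum_congr rfl fun k _ => h0 k y hy,
    fun N y hy hv => Finset.sum_congr rfl fun k _ => h1 k N y hy hv⟩

theorem HasExp.smooth (h : HasExp D v A a) : SmoothFn D a := by
  obtain ⟨F, hF, h0, -⟩ := h
  have h1 : ContDiffOn ℝ ∞ (fun y => F ((0 : ℝ), y)) D :=
    hF.comp (contDiffOn_const.prodMk contDiffOn_id) fun y hy => ⟨mem_univ _, hy⟩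
  exact h1.congr fun y hy => (h0 y hy).symm

/-- By the chain rule the derivative of `F(1/v, y)` is `DF` applied to `(∂_c (1/v), e_c)`, and `∂_c
(1/v)` is again a smooth function `w` of `1/v` and `y`. Since `w` vanishes at `1/v = 0`, the leading
term is the derivative of the leading term. -/
theorem HasExp.pderivOn (hD : RegularDomain D) (hv : ExpansionScale D v) (h : HasExp D v A a)
    (c : ι) : HasExp D v (fun N => pderivOn D c (A N)) (pderivOn D c a) := by
  obtain ⟨F, hF, h0, h1⟩ := h
  obtain ⟨w, hw, hw0, hw1⟩ := hv.pderiv_inv c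
  have hud : UniqueDiffOn ℝ ((univ : Set ℝ) ×ˢ D) := uniqueDiffOn_univ.prod hD.uniqueDiffOn
  have hchain : ∀ (φ : Coords ι → ℝ), ∀ y ∈ D, DifferentiableWithinAt ℝ φ D y →
      _root_.pderivOn D c (fun y => F (φ y, y)) y
        = fderivWithin ℝ F (univ ×ˢ D) (φ y, y)
          (_root_.pderivOn D c φ y, EuclideanSpace.single c 1) := by
    intro φ y hy hφ
    have hd : HasFDerivWithinAt F (fderivWithin ℝ F (univ ×ˢ D) (φ y, y)) (univ ×ˢ D) (φ y, y) :=
      ((hF (φ y, y) ⟨mem_univ _, hy⟩).differentiableWithinAt (by simp)).hasFDerivWithinAt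
    have hp : HasFDerivWithinAt (fun y => (φ y, y))
      ((fderivWithin ℝ φ D y).prod (ContinuousLinearMap.id ℝ (Coords ι))) D y :=
      hφ.hasFDerivWithinAt.prodMk (hasFDerivWithinAt_id y D)
    have hc := HasFDerivWithinAt.comp (f := fun y => (φ y, y)) y hd hp fun x hx => ⟨mem_univ _, hx⟩
    have hc' := hc.fderivWithin (hD.uniqueDiffOn y hy)
    unfold _root_.pderivOn
    change fderivWithin ℝ (F ∘ fun y => (φ y, y)) D y _ = _
    rw [hc']
    rfl
  refine ⟨fun p => fderivWithin ℝ F (univ ×ˢ D) p (w p, EuclideanSpace.single c 1),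
    (ContDiffOn.fderivWithin hF hud (by simp)).clm_apply (hw.prodMk contDiffOn_const), ?_, ?_⟩
  · intro y hy
    have e := hchain (fun _ => 0) y hy (differentiableWithinAt_const _)
    rw [pderivOn_const] at e
    simp only [hw0 y hy]
    rw [← e]
    exact pderivOn_congr h0 hy c
  · intro N y hy hvy
    have hdv : DifferentiableWithinAt ℝ (fun y => (v N y)⁻¹) D y :=
      ((hv.smooth N).differentiableWithinAt hy).inv hvy
    have e := hchain (fun y => (v N y)⁻¹) y hy hdv
    simp only
    rw [← hw1 N y hy hvy, ← e]
    unfold _root_.pderivOn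
    -- The expansion holds only where `v N ≠ 0`, which by continuity includes a neighbourhood of `y`
    -- in `D`.
    have hev : A N =ᶠ[nhdsWithin y D] fun y => F ((v N y)⁻¹, y) := by
      have hne : ∀ᶠ x in nhdsWithin y D, v N x ≠ 0 :=
        ((hv.smooth N).continuousOn y hy).eventually_ne hvy
      filter_upwards [hne, self_mem_nhdsWithin] with x hx hxD
      exact h1 N x hxD hx
    rw [hev.fderivWithin_eq (h1 N y hy hvy)]

theorem ExpansionScale.tendsto_inv (hv : ExpansionScale D v) {z : Coords ι} (hz : z ∈ D) :
    (∀ᶠ N in atTop, v N z ≠ 0) ∧ Tendsto (fun N => (v N z)⁻¹) atTop (nhds 0) := by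
  obtain ⟨C, N₀, hC, h⟩ := hv.bound {z} (singleton_subset_iff.2 hz) isCompact_singleton
  refine ⟨?_, ?_⟩
  · filter_upwards [eventually_ge_atTop 1, eventually_ge_atTop N₀] with N h1 h2
    exact (h N h1 h2 z rfl).1
  · refine squeeze_zero_norm' (a := fun N : ℕ => C / (N : ℝ)) ?_
      (tendsto_const_div_atTop_nhds_zero_nat C)
    filter_upwards [eventually_ge_atTop 1, eventually_ge_atTop N₀] with N h1 h2
    exact (h N h1 h2 z rfl).2

theorem HasExp.tendsto (hv : ExpansionScale D v) (h : HasExp D v A a) {z : Coords ι}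
    (hz : z ∈ D) : Tendsto (fun N => A N z) atTop (nhds (a z)) := by
  obtain ⟨F, hF, h0, h1⟩ := h
  obtain ⟨hne, ht⟩ := hv.tendsto_inv hz
  have hc : Continuous fun s : ℝ => F (s, z) :=
    (hF.continuousOn.comp_continuous (continuous_id.prodMk continuous_const)
      fun s => ⟨mem_univ _, hz⟩)
  have ht2 := (hc.tendsto 0).comp ht
  rw [h0 z hz] at ht2
  refine ht2.congr' ?_
  filter_upwards [hne] with N hN
  exact (h1 N z hz hN).symm

/-- Identities between expansions pass to the leading terms. -/
theorem HasExp.leading_eq (hv : ExpansionScale D v) (hA : HasExp D v A a) (hB : HasExp D v B b)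
    (h : ∀ N, ∀ y ∈ D, v N y ≠ 0 → A N y = B N y) {z : Coords ι} (hz : z ∈ D) : a z = b z := by
  refine tendsto_nhds_unique (hA.tendsto hv hz) ((hB.tendsto hv hz).congr' ?_)
  filter_upwards [(hv.tendsto_inv hz).1] with N hN
  exact (h N z hz hN).symm

/-- The mean value inequality in the small parameter: `F(s, z) - F(0, z)` is bounded by `|s|` times
a bound for `∂F/∂s` on the compact set `[-1, 1] × K`, and `s = O(1/N)` on `K`. -/
theorem HasExp.eqUpToInvN (hD : RegularDomain D) (hv : ExpansionScale D v)
    (h : HasExp D v A a) : EqUpToInvN D A a := by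
  intro K hKD hK
  obtain ⟨F, hF, h0, h1⟩ := h
  obtain ⟨C, N₀, hC, hb⟩ := hv.bound K hKD hK
  have hud : UniqueDiffOn ℝ ((univ : Set ℝ) ×ˢ D) := uniqueDiffOn_univ.prod hD.uniqueDiffOn
  have hcont : ContinuousOn (fun p => fderivWithin ℝ F (univ ×ˢ D) p ((1 : ℝ), (0 : Coords ι)))
      (univ ×ˢ D) :=
    ((ContDiffOn.fderivWithin (m := ∞) hF hud (by simp)).clm_apply
      contDiffOn_const).continuousOn
  obtain ⟨B, hB⟩ := ((isCompact_Icc (a := (-1 : ℝ)) (b := 1)).prod hK).exists_bound_of_continuousOn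
    (hcont.mono (prod_mono (subset_univ _) hKD))
  have hmv : ∀ z ∈ K, ∀ s ∈ Icc (-1 : ℝ) 1, |F (s, z) - F (0, z)| ≤ B * |s| := by
    intro z hz s hs
    have hder : ∀ r ∈ Icc (-1 : ℝ) 1, HasDerivWithinAt (fun r => F (r, z))
        (fderivWithin ℝ F (univ ×ˢ D) (r, z) ((1 : ℝ), (0 : Coords ι))) (Icc (-1) 1) r := by
      intro r hr
      have hd : HasFDerivWithinAt F (fderivWithin ℝ F (univ ×ˢ D) (r, z)) (univ ×ˢ D) (r, z) :=
        ((hF (r, z) ⟨mem_univ _, hKD hz⟩).differentiableWithinAt (by simp)).hasFDerivWithinAt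
      have hp : HasDerivWithinAt (fun r : ℝ => (r, z)) ((1 : ℝ), (0 : Coords ι)) (Icc (-1) 1) r :=
        (hasDerivWithinAt_id r _).prodMk (hasDerivWithinAt_const r _ z)
      exact hd.comp_hasDerivWithinAt (f := fun r : ℝ => (r, z)) r hp fun x hx => ⟨mem_univ _, hKD hz⟩
    have := (convex_Icc (-1 : ℝ) 1).norm_image_sub_le_of_norm_hasDerivWithin_le hder
      (fun r hr => hB (r, z) ⟨hr, hz⟩) (by simp : (0 : ℝ) ∈ Icc (-1 : ℝ) 1) hs
    simpa using this
  -- The condition `N ≥ C` forces `|1/v| ≤ C/N ≤ 1`, so that the parameter stays in the interval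
  -- where `B` is a bound.
  refine ⟨|B| * C, max N₀ (Nat.ceil C), fun N hN1 hN z hz => ?_⟩
  obtain ⟨hne, hle⟩ := hb N hN1 (le_trans (le_max_left _ _) hN) z hz
  have hNpos : (0 : ℝ) < N := by exact_mod_cast hN1
  have hCN : C / N ≤ 1 := by
    rw [div_le_one hNpos]
    exact (Nat.le_ceil C).trans (by exact_mod_cast le_trans (le_max_right _ _) hN)
  rw [h1 N z (hKD hz) hne, ← h0 z (hKD hz)]
  calc _ ≤ B * |(v N z)⁻¹| := hmv z hz _ (abs_le.1 (hle.trans hCN))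
    _ ≤ |B| * (C / N) := by gcongr; exact le_abs_self B
    _ = _ := by ring

theorem HasExp.covD (hD : RegularDomain D) (hv : ExpansionScale D v)
    {Γ : ℕ → ι → ι → ι → Coords ι → ℝ} {Γ' : ι → ι → ι → Coords ι → ℝ}
    (hΓ : ∀ a b c, HasExp D v (fun N => Γ N a b c) (Γ' a b c)) {k : ℕ}
    {A : ℕ → CovTensor ι k} {a : CovTensor ι k} (hA : ∀ s, HasExp D v (fun N => A N s) (a s))
    (s : Fin (k + 1) → ι) :
    HasExp D v (fun N => covD D (Γ N) (A N) s) (covD D Γ' a s) :=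
  ((hA _).pderivOn hD hv _).sub
    (HasExp.sum fun _ => HasExp.sum fun _ => (hΓ _ _ _).mul (hA _))

theorem HasExp.connCurv (hD : RegularDomain D) (hv : ExpansionScale D v)
    {Γ : ℕ → ι → ι → ι → Coords ι → ℝ} {Γ' : ι → ι → ι → Coords ι → ℝ}
    (hΓ : ∀ a b c, HasExp D v (fun N => Γ N a b c) (Γ' a b c)) (a b c f : ι) :
    HasExp D v (fun N => connCurv D (Γ N) a b c f) (connCurv D Γ' a b c f) :=
  (((hΓ _ _ _).pderivOn hD hv _).sub ((hΓ _ _ _).pderivOn hD hv _)).add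
    (HasExp.sum fun _ => ((hΓ _ _ _).mul (hΓ _ _ _)).sub ((hΓ _ _ _).mul (hΓ _ _ _)))

end Expansions

/-! ### Space-time domains, time slices and Ricci flows in coordinates. -/

section SpaceTime

theorem RegularDomain.of_convex_inter {ι : Type} [Fintype ι] [DecidableEq ι]
    {H O : Set (Coords ι)} (hH : Convex ℝ H) (hne : (interior H).Nonempty) (hO : IsOpen O) :
    RegularDomain (H ∩ O) := by
  refine ⟨(uniqueDiffOn_convex hH hne).inter hO, fun z hz => ?_⟩
  have h1 : z ∈ closure (interior H) := by
    rw [hH.closure_interior_eq_closure_of_nonempty_interior hne]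
    exact _root_.subset_closure hz.1
  rw [interior_inter, hO.interior_eq]
  exact hO.closure_inter ⟨h1, hz.2⟩

variable {n : ℕ}

/-- The space-time point with coordinates `(t, x)`. -/
def stJoin (t : ℝ) (x : Coords (Fin n)) : Coords (Fin (n + 1)) :=
  WithLp.toLp 2 (Fin.cons t x)

@[simp] theorem stJoin_zero (t : ℝ) (x : Coords (Fin n)) : stJoin t x 0 = t := rfl

@[simp] theorem spacePart_stJoin (t : ℝ) (x : Coords (Fin n)) : spacePart (stJoin t x) = x := rfl

@[simp] theorem stJoin_spacePart (z : Coords (Fin (n + 1))) : stJoin (z 0) (spacePart z) = z := by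
  ext i
  refine Fin.cases rfl (fun i => rfl) i

theorem continuous_spacePart : Continuous (spacePart : Coords (Fin (n + 1)) → Coords (Fin n)) := by
  unfold spacePart
  fun_prop

/-- The inclusion of space in space-time. -/
def spaceInclusion (n : ℕ) : Coords (Fin n) →L[ℝ] Coords (Fin (n + 1)) :=
  LinearMap.toContinuousLinearMap
    { toFun := fun x => stJoin 0 x
      map_add' := fun x y => by
        ext i
        refine Fin.cases ?_ (fun i => ?_) i <;> simp [stJoin]
      map_smul' := fun c x => by
        ext i
        refine Fin.cases ?_ (fun i => ?_) i <;> simp [stJoin] }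

theorem spaceInclusion_single (i : Fin n) :
    spaceInclusion n (EuclideanSpace.single i 1) = EuclideanSpace.single i.succ 1 := by
  ext j
  refine Fin.cases ?_ (fun j => ?_) j
  · simp [spaceInclusion, stJoin, (Fin.succ_ne_zero i).symm]
  · simp [spaceInclusion, stJoin, Pi.single_apply]

theorem stJoin_eq (t : ℝ) (x : Coords (Fin n)) :
    stJoin t x = spaceInclusion n x + t • EuclideanSpace.single 0 1 := by
  ext j
  refine Fin.cases ?_ (fun j => ?_) j <;> simp [spaceInclusion, stJoin]

variable {U : Set (Coords (Fin n))} {T : ℝ}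

/-- `U` need not be convex, but the domain is the intersection of the convex half-space `t ≤ T` with
an open set. -/
theorem regularDomain_spacetimeDomain (hU : IsOpen U) (hT : 0 < T) :
    RegularDomain (spacetimeDomain U T) := by
  have hc : Continuous fun z : Coords (Fin (n + 1)) => z 0 := by fun_prop
  have e : spacetimeDomain U T = {z : Coords (Fin (n + 1)) | z 0 ≤ T} ∩
      {z | 0 < z 0 ∧ spacePart z ∈ U} := by
    ext z
    simp only [spacetimeDomain, mem_ofPred_eq, mem_Ioc, mem_inter_iff]
    tauto
  rw [e]
  refine RegularDomain.of_convex_inter ?_ ?_ ?_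
  · intro x hx y hy a b ha hb hab
    simp only [mem_ofPred_eq, PiLp.add_apply, PiLp.smul_apply, smul_eq_mul] at *
    calc a * x 0 + b * y 0 ≤ a * T + b * T := by gcongr
      _ = T := by rw [← add_mul, hab, one_mul]
  · refine ⟨0, ?_⟩
    have ho : IsOpen {z : Coords (Fin (n + 1)) | z 0 < T} := isOpen_lt hc continuous_const
    have hsub : {z : Coords (Fin (n + 1)) | z 0 < T} ⊆ {z | z 0 ≤ T} := by
      intro z hz
      exact le_of_lt (show z 0 < T from hz)
    exact interior_maximal hsub ho hT
  · exact (isOpen_lt continuous_const hc).inter (hU.preimage continuous_spacePart)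

theorem stJoin_mem {t : ℝ} (ht : t ∈ Ioc 0 T) {x : Coords (Fin n)} (hx : x ∈ U) :
    stJoin t x ∈ spacetimeDomain U T := ⟨ht, hx⟩

/-- The chain rule for the affine inclusion of a time slice. Through it the tensors of the slices
become expressions in space-time derivatives, hence jointly smooth in space and time. -/
theorem pderivOn_slice (hU : IsOpen U) {F : Coords (Fin (n + 1)) → ℝ}
    (hF : SmoothFn (spacetimeDomain U T) F) {t : ℝ} (ht : t ∈ Ioc 0 T) {x : Coords (Fin n)}
    (hx : x ∈ U) (i : Fin n) :
    pderivOn U i (fun x => F (stJoin t x)) x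
      = pderivOn (spacetimeDomain U T) i.succ F (stJoin t x) := by
  have hd := (hF.differentiableWithinAt (stJoin_mem ht hx)).hasFDerivWithinAt
  have hj : HasFDerivWithinAt (fun x => stJoin t x) (spaceInclusion n) U x := by
    simp only [stJoin_eq]
    exact (spaceInclusion n).hasFDerivWithinAt.add_const _
  have hc := HasFDerivWithinAt.comp (f := fun x => stJoin t x) x hd hj
    fun y hy => stJoin_mem ht hy
  unfold pderivOn
  change fderivWithin ℝ (F ∘ fun x => stJoin t x) U x _ = _
  rw [hc.fderivWithin (hU.uniqueDiffOn x hx), ContinuousLinearMap.comp_apply,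
    spaceInclusion_single]

theorem hasDerivWithinAt_time {F : Coords (Fin (n + 1)) → ℝ}
    (hF : SmoothFn (spacetimeDomain U T) F) {t : ℝ} (ht : t ∈ Ioc 0 T) {x : Coords (Fin n)}
    (hx : x ∈ U) : HasDerivWithinAt (fun s => F (stJoin s x))
      (pderivOn (spacetimeDomain U T) 0 F (stJoin t x)) (Ioc 0 T) t := by
  have hd := (hF.differentiableWithinAt (stJoin_mem ht hx)).hasFDerivWithinAt
  have hj : HasDerivWithinAt (fun s => stJoin s x) (EuclideanSpace.single 0 1) (Ioc 0 T) t := by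
    simp only [stJoin_eq]
    have := ((hasDerivWithinAt_id t (Ioc 0 T)).smul_const
      (EuclideanSpace.single 0 1 : Coords (Fin (n + 1)))).const_add (spaceInclusion n x)
    simpa using this
  exact hd.comp_hasDerivWithinAt (f := fun s => stJoin s x) t hj fun s hs => stJoin_mem hs hx

/-- A smooth Ricci flow of Riemannian metrics, in coordinates. -/
structure CoordRicciFlow (U : Set (Coords (Fin n))) (T : ℝ)
    (γ : ℝ → Coords (Fin n) → Matrix (Fin n) (Fin n) ℝ) : Prop where
  isOpen : IsOpen U
  pos : 0 < T
  smooth : ∀ i j, SmoothFn (spacetimeDomain U T) (fun z => γ (z 0) (spacePart z) i j)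
  symm : ∀ t ∈ Ioc 0 T, ∀ x ∈ U, ∀ i j, γ t x i j = γ t x j i
  det : ∀ t ∈ Ioc 0 T, ∀ x ∈ U, IsUnit (γ t x).det
  flow : ∀ t ∈ Ioc 0 T, ∀ x ∈ U, ∀ i j, HasDerivWithinAt (fun s => γ s x i j)
    (-2 * ricci U (γ t) ![i, j] x) (Ioc 0 T) t

end SpaceTime

/-! ### From the flow on the manifold to a flow in a chart. -/

section Charts

variable {n : ℕ} {M : Type*} [TopologicalSpace M] [ChartedSpace (EuclideanSpace ℝ (Fin n)) M]
  [IsManifold (𝓡 n) ∞ M]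

/-- A kernel vector of the Gram matrix would be the coordinate vector of some `w ≠ 0` with `B (φ w)
(φ w) = 0`, against positivity, as `φ` is injective. -/
theorem gramMatrix_det {E : Type*} [NormedAddCommGroup E] [NormedSpace ℝ E]
    (φ : Coords (Fin n) →L[ℝ] E) (hφ : Function.Injective φ) (B : E →L[ℝ] E →L[ℝ] ℝ)
    (hB : ∀ w, w ≠ 0 → 0 < B w w) :
    IsUnit (Matrix.of fun i j => B (φ (EuclideanSpace.single i 1))
      (φ (EuclideanSpace.single j 1))).det := by
  rw [isUnit_iff_ne_zero]
  intro h0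
  obtain ⟨c, hc, hc0⟩ := Matrix.exists_mulVec_eq_zero_iff.2 h0
  let w : Coords (Fin n) := WithLp.toLp 2 c
  have hw : w = ∑ i, c i • (EuclideanSpace.single i (1 : ℝ) : Coords (Fin n)) := by
    ext j
    simp [w, Pi.single_apply]
  have h1 : ∀ i, B (φ (EuclideanSpace.single i 1)) (φ w) = 0 := by
    intro i
    have := congrFun hc0 i
    simp only [Matrix.mulVec, dotProduct, Matrix.of_apply, Pi.zero_apply] at this
    rw [hw]
    simp only [map_sum, map_smul, smul_eq_mul]
    rw [← this]
    exact Finset.sum_congr rfl fun _ _ => mul_comm _ _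
  have h2 : B (φ w) (φ w) = 0 := by
    nth_rewrite 1 [hw]
    simp only [map_sum, map_smul, sum_apply, smul_apply, h1, smul_zero,
      Finset.sum_const_zero]
  have h3 : φ w ≠ 0 := by
    intro h
    apply hc
    have h4 : w = 0 := hφ (h.trans (map_zero φ).symm)
    funext i
    exact congrArg (fun y : Coords (Fin n) => y i) h4
  exact (hB _ h3).ne' h2

theorem metricInChart_det {e : OpenPartialHomeomorph M (EuclideanSpace ℝ (Fin n))}
    (he : e ∈ IsManifold.maximalAtlas (𝓡 n) ∞ M) (g : RiemMetric n M) {x : Coords (Fin n)}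
    (hx : x ∈ e.target) : IsUnit (metricInChart e g x).det := by
  have h : e.MDifferentiable (𝓡 n) (𝓡 n) :=
    ⟨(contMDiffOn_of_mem_maximalAtlas he).mdifferentiableOn (by simp),
      (contMDiffOn_symm_of_mem_maximalAtlas he).mdifferentiableOn (by simp)⟩
  exact gramMatrix_det (E := EuclideanSpace ℝ (Fin n)) (mfderiv (𝓡 n) (𝓡 n) e.symm x)
    (h.symm.mfderiv_injective hx) (g.inner (e.symm x)) (g.pos (e.symm x))

theorem IsRicciFlow.coordRicciFlow {T : ℝ} (hT : 0 < T) {g : ℝ → RiemMetric n M}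
    (hg : IsRicciFlow T g) {e : OpenPartialHomeomorph M (EuclideanSpace ℝ (Fin n))}
    (he : e ∈ IsManifold.maximalAtlas (𝓡 n) ∞ M) :
    CoordRicciFlow e.target T (flowInChart e g) where
  isOpen := e.open_target
  pos := hT
  smooth := hg.smooth e he
  symm := fun t _ x _ i j => (g t).symm (e.symm x) (coordVec e x i) (coordVec e x j)
  det := fun t _ x hx => metricInChart_det he (g t) hx
  flow := hg.flow e he

end Charts

/-! ### Joint smoothness of the slice tensors in space and time. -/

section FlowFunctions

variable {n : ℕ}

/-- `g_{ij}` as a function of the space-time point. -/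
def stG (γ : ℝ → Coords (Fin n) → Matrix (Fin n) (Fin n) ℝ) (i j : Fin n)
    (z : Coords (Fin (n + 1))) : ℝ := γ (z 0) (spacePart z) i j

/-- The spatial Christoffel symbols as functions of the space-time point. -/
def stChr (U : Set (Coords (Fin n))) (γ : ℝ → Coords (Fin n) → Matrix (Fin n) (Fin n) ℝ)
    (a b c : Fin n) (z : Coords (Fin (n + 1))) : ℝ :=
  christoffel U (γ (z 0)) a b c (spacePart z)

/-- The scalar curvature as a function of the space-time point. -/
def stScal (U : Set (Coords (Fin n))) (γ : ℝ → Coords (Fin n) → Matrix (Fin n) (Fin n) ℝ)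
    (z : Coords (Fin (n + 1))) : ℝ := scalarCurv U (γ (z 0)) (spacePart z)

variable {U : Set (Coords (Fin n))} {T : ℝ}
  {γ : ℝ → Coords (Fin n) → Matrix (Fin n) (Fin n) ℝ} {z : Coords (Fin (n + 1))}

theorem pderivOn_slice' (hU : IsOpen U) {F : Coords (Fin (n + 1)) → ℝ}
    (hF : SmoothFn (spacetimeDomain U T) F) (hz : z ∈ spacetimeDomain U T) (i : Fin n) :
    pderivOn U i (fun x => F (stJoin (z 0) x)) (spacePart z)
      = pderivOn (spacetimeDomain U T) i.succ F z := by
  rw [pderivOn_slice hU hF hz.1 hz.2, stJoin_spacePart]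

namespace CoordRicciFlow

variable (hγ : CoordRicciFlow U T γ)
include hγ

theorem regularDomain : RegularDomain (spacetimeDomain U T) :=
  regularDomain_spacetimeDomain hγ.isOpen hγ.pos

theorem stG_smooth (i j : Fin n) : SmoothFn (spacetimeDomain U T) (stG γ i j) := hγ.smooth i j

theorem stG_symm (hz : z ∈ spacetimeDomain U T) (i j : Fin n) : stG γ i j z = stG γ j i z :=
  hγ.symm _ hz.1 _ hz.2 i j

theorem stInv_smooth (i j : Fin n) :
    SmoothFn (spacetimeDomain U T) (fun z => stInv γ z i j) :=
  SmoothFn.matrix_inv (G := fun z : Coords (Fin (n + 1)) => γ (z 0) (spacePart z)) hγ.smooth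
    (fun z hz => hγ.det _ hz.1 _ hz.2) i j

theorem metricOn {t : ℝ} (ht : t ∈ Ioc 0 T) : MetricOn U (γ t) where
  smooth i j := by
    have hj : ContDiff ℝ ∞ fun x : Coords (Fin n) => stJoin t x := by
      simp only [stJoin_eq]
      exact (spaceInclusion n).contDiff.add contDiff_const
    exact (hγ.smooth i j).comp hj.contDiffOn fun x hx => stJoin_mem ht hx
  symm := hγ.symm t ht
  det := hγ.det t ht

theorem stInv_symm (hz : z ∈ spacetimeDomain U T) (i j : Fin n) :
    stInv γ z i j = stInv γ z j i :=
  (hγ.metricOn hz.1).inv_symm hz.2 i j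

theorem stG_mul_stInv (hz : z ∈ spacetimeDomain U T) (i j : Fin n) :
    ∑ p, stG γ i p z * stInv γ z p j = if i = j then 1 else 0 :=
  (hγ.metricOn hz.1).mul_inv hz.2 i j

theorem stChr_eq (hz : z ∈ spacetimeDomain U T) (a b c : Fin n) :
    stChr U γ a b c z = (1 / 2) * ∑ d, stInv γ z a d *
      (pderivOn (spacetimeDomain U T) b.succ (stG γ c d) z
        + pderivOn (spacetimeDomain U T) c.succ (stG γ b d) z
        - pderivOn (spacetimeDomain U T) d.succ (stG γ b c) z) := by
  simp only [← pderivOn_slice' hγ.isOpen (hγ.stG_smooth _ _) hz]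
  rfl

theorem stChr_smooth (a b c : Fin n) : SmoothFn (spacetimeDomain U T) (stChr U γ a b c) := by
  have hD := hγ.regularDomain
  have h : SmoothFn (spacetimeDomain U T) (fun z => (1 / 2) * ∑ d, stInv γ z a d *
      (pderivOn (spacetimeDomain U T) b.succ (stG γ c d) z
        + pderivOn (spacetimeDomain U T) c.succ (stG γ b d) z
        - pderivOn (spacetimeDomain U T) d.succ (stG γ b c) z)) :=
    contDiffOn_const.mul (SmoothFn.sum fun _ _ => (hγ.stInv_smooth _ _).mul
      ((((hγ.stG_smooth _ _).pderivOn hD _).add ((hγ.stG_smooth _ _).pderivOn hD _)).sub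
        ((hγ.stG_smooth _ _).pderivOn hD _)))
  exact h.congr fun z hz => hγ.stChr_eq hz a b c

theorem stRm_eq (hz : z ∈ spacetimeDomain U T) (a b c d : Fin n) :
    stRm U γ z a b c d = ∑ f, stG γ d f z *
      (pderivOn (spacetimeDomain U T) b.succ (stChr U γ f a c) z
        - pderivOn (spacetimeDomain U T) a.succ (stChr U γ f b c) z
        + ∑ e, (stChr U γ e a c z * stChr U γ f b e z
          - stChr U γ e b c z * stChr U γ f a e z)) := by
  simp only [← pderivOn_slice' hγ.isOpen (hγ.stChr_smooth _ _ _) hz]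
  rfl

theorem stRm_smooth (a b c d : Fin n) :
    SmoothFn (spacetimeDomain U T) (fun z => stRm U γ z a b c d) := by
  have hD := hγ.regularDomain
  have h : SmoothFn (spacetimeDomain U T) (fun z => ∑ f, stG γ d f z *
      (pderivOn (spacetimeDomain U T) b.succ (stChr U γ f a c) z
        - pderivOn (spacetimeDomain U T) a.succ (stChr U γ f b c) z
        + ∑ e, (stChr U γ e a c z * stChr U γ f b e z
          - stChr U γ e b c z * stChr U γ f a e z))) :=
    SmoothFn.sum fun _ _ => (hγ.stG_smooth _ _).mul
      ((((hγ.stChr_smooth _ _ _).pderivOn hD _).sub ((hγ.stChr_smooth _ _ _).pderivOn hD _)).add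
      (SmoothFn.sum fun _ _ => ((hγ.stChr_smooth _ _ _).mul (hγ.stChr_smooth _ _ _)).sub
        ((hγ.stChr_smooth _ _ _).mul (hγ.stChr_smooth _ _ _))))
  exact h.congr fun z hz => hγ.stRm_eq hz a b c d

omit hγ in
theorem stRic_eq (i j : Fin n) :
    stRic U γ z i j = ∑ k, ∑ l, stInv γ z k l * stRm U γ z i k j l := rfl

omit hγ in
theorem stScal_eq : stScal U γ z = ∑ i, ∑ j, stInv γ z i j * stRic U γ z i j := rfl

theorem stRic_smooth (i j : Fin n) :
    SmoothFn (spacetimeDomain U T) (fun z => stRic U γ z i j) := by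
  simp only [stRic_eq]
  exact SmoothFn.sum fun _ _ => SmoothFn.sum fun _ _ =>
    (hγ.stInv_smooth _ _).mul (hγ.stRm_smooth _ _ _ _)

theorem stScal_smooth : SmoothFn (spacetimeDomain U T) (stScal U γ) := by
  change SmoothFn (spacetimeDomain U T) (fun z => ∑ i, ∑ j, stInv γ z i j * stRic U γ z i j)
  exact SmoothFn.sum fun _ _ => SmoothFn.sum fun _ _ =>
    (hγ.stInv_smooth _ _).mul (hγ.stRic_smooth _ _)

/-- The flow equation is a derivative along time lines. It agrees with the space-time partial
derivative because derivatives within `(0, T]` are unique, also at the end point. -/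
theorem pderivOn_zero_stG (hz : z ∈ spacetimeDomain U T) (i j : Fin n) :
    pderivOn (spacetimeDomain U T) 0 (stG γ i j) z = -2 * stRic U γ z i j := by
  have h1 := hasDerivWithinAt_time (hγ.stG_smooth i j) hz.1 hz.2
  rw [stJoin_spacePart] at h1
  have hu : UniqueDiffWithinAt ℝ (Ioc 0 T) (z 0) :=
    (uniqueDiffOn_convex (convex_Ioc 0 T) (by simpa using hγ.pos)) _ hz.1
  exact (h1.derivWithin hu).symm.trans ((hγ.flow _ hz.1 _ hz.2 i j).derivWithin hu)

end CoordRicciFlow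

end FlowFunctions

/-! ### The thermostat metric and the expansion parameter `1/ḡ_{00}`. -/

section Thermostat

variable {n : ℕ} {U : Set (Coords (Fin n))} {T : ℝ}
  {γ : ℝ → Coords (Fin n) → Matrix (Fin n) (Fin n) ℝ} {z : Coords (Fin (n + 1))} {N : ℕ}

/-- The coefficient `ḡ_{00} = R - N/(2t)`. -/
def lapse (U : Set (Coords (Fin n))) (γ : ℝ → Coords (Fin n) → Matrix (Fin n) (Fin n) ℝ)
    (N : ℕ) (z : Coords (Fin (n + 1))) : ℝ := stScal U γ z - (N : ℝ) / (2 * z 0)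

@[simp] theorem barMetric_zero_zero : barMetric U γ N z 0 0 = lapse U γ N z := rfl
@[simp] theorem barMetric_zero_succ (i : Fin n) : barMetric U γ N z 0 i.succ = 0 := rfl
@[simp] theorem barMetric_succ_zero (i : Fin n) : barMetric U γ N z i.succ 0 = 0 := rfl
@[simp] theorem barMetric_succ_succ (i j : Fin n) :
    barMetric U γ N z i.succ j.succ = stG γ i j z := rfl

/-- The inverse of the metric of the thermostat with `s` in place of `1 / ḡ_{00}`. -/
def barInv (γ : ℝ → Coords (Fin n) → Matrix (Fin n) (Fin n) ℝ) (s : ℝ)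
    (z : Coords (Fin (n + 1))) : Matrix (Fin (n + 1)) (Fin (n + 1)) ℝ :=
  Matrix.of fun a b => Fin.cases (Fin.cases s (fun _ => 0) b)
    (fun i => Fin.cases 0 (fun j => stInv γ z i j) b) a

@[simp] theorem barInv_zero_zero (s : ℝ) : barInv γ s z 0 0 = s := rfl
@[simp] theorem barInv_zero_succ (s : ℝ) (i : Fin n) : barInv γ s z 0 i.succ = 0 := rfl
@[simp] theorem barInv_succ_zero (s : ℝ) (i : Fin n) : barInv γ s z i.succ 0 = 0 := rfl
@[simp] theorem barInv_succ_succ (s : ℝ) (i j : Fin n) :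
    barInv γ s z i.succ j.succ = stInv γ z i j := rfl

namespace CoordRicciFlow

theorem time_pos (hz : z ∈ spacetimeDomain U T) : 0 < z 0 := hz.1.1

variable (hγ : CoordRicciFlow U T γ)
include hγ

theorem barMetric_mul_barInv (hz : z ∈ spacetimeDomain U T) (hv : lapse U γ N z ≠ 0) :
    barMetric U γ N z * barInv γ (lapse U γ N z)⁻¹ z = 1 := by
  ext a b
  rw [Matrix.mul_apply, Fin.sum_univ_succ, Matrix.one_apply]
  refine Fin.cases ?_ (fun i => ?_) a <;> refine Fin.cases ?_ (fun j => ?_) b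
  · simp [hv]
  · simp [(Fin.succ_ne_zero j).symm]
  · simp [Fin.succ_ne_zero i]
  · simp [hγ.stG_mul_stInv hz]

theorem barMetric_inv (hz : z ∈ spacetimeDomain U T) (hv : lapse U γ N z ≠ 0) :
    (barMetric U γ N z)⁻¹ = barInv γ (lapse U γ N z)⁻¹ z :=
  Matrix.inv_eq_right_inv (hγ.barMetric_mul_barInv hz hv)

theorem lapse_smooth (N : ℕ) : SmoothFn (spacetimeDomain U T) (lapse U γ N) := by
  have h0 : SmoothFn (spacetimeDomain U T) (fun z => z 0) := by
    have : ContDiff ℝ ∞ (fun z : Coords (Fin (n + 1)) => z 0) := by fun_prop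
    exact this.contDiffOn
  exact hγ.stScal_smooth.sub (contDiffOn_const.div (contDiffOn_const.mul h0)
    fun z hz => mul_ne_zero two_ne_zero (time_pos hz).ne')

omit hγ in
theorem time_smooth : SmoothFn (spacetimeDomain U T) (fun z => z 0) := by
  have : ContDiff ℝ ∞ (fun z : Coords (Fin (n + 1)) => z 0) := by fun_prop
  exact this.contDiffOn

theorem pderivOn_time (hz : z ∈ spacetimeDomain U T) (a : Fin (n + 1)) :
    pderivOn (spacetimeDomain U T) a (fun z => z 0) z = if a = 0 then 1 else 0 := by
  have hL : HasFDerivWithinAt (fun z : Coords (Fin (n + 1)) => z 0)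
      (EuclideanSpace.proj 0 : Coords (Fin (n + 1)) →L[ℝ] ℝ) (spacetimeDomain U T) z :=
    (EuclideanSpace.proj 0 : Coords (Fin (n + 1)) →L[ℝ] ℝ).hasFDerivWithinAt
  unfold pderivOn
  rw [hL.fderivWithin (hγ.regularDomain.uniqueDiffOn z hz)]
  simp [eq_comm]

omit hγ in
theorem inv_time_smooth (c : ℝ) : SmoothFn (spacetimeDomain U T) (fun z => c / z 0) :=
  contDiffOn_const.div time_smooth fun _ hz => (time_pos hz).ne'

theorem pderivOn_inv_time (hz : z ∈ spacetimeDomain U T) (c : ℝ) (a : Fin (n + 1)) :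
    pderivOn (spacetimeDomain U T) a (fun z => c / z 0) z
      = if a = 0 then - c / (z 0) ^ 2 else 0 := by
  have hD := hγ.regularDomain
  -- The product `(c/t) · t` is constant, so the Leibniz rule determines the derivative of `c/t`.
  have h1 : pderivOn (spacetimeDomain U T) a (fun z => c / z 0 * z 0) z = 0 := by
    rw [pderivOn_congr (g := fun _ => c) (fun y hy => by
      have := (time_pos hy).ne'
      field_simp) hz, pderivOn_const]
  rw [pderivOn_mul hD hz (inv_time_smooth c) time_smooth, hγ.pderivOn_time hz] at h1
  have h0 := (time_pos hz).ne'
  split_ifs with ha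
  · rw [if_pos ha] at h1
    field_simp at h1 ⊢
    linarith
  · rw [if_neg ha, mul_zero, add_zero] at h1
    exact (mul_eq_zero.1 h1).resolve_right h0

/-- The time derivative of `-N/(2t)` is `N/(2t²)`, which is rewritten as `(R - v)/t` with `v` the
lapse. No explicit `N` is left, and this closes the class of expansions under differentiation. -/
theorem pderivOn_lapse (hz : z ∈ spacetimeDomain U T) (a : Fin (n + 1)) :
    pderivOn (spacetimeDomain U T) a (lapse U γ N) z
      = pderivOn (spacetimeDomain U T) a (stScal U γ) z
        + if a = 0 then (stScal U γ z - lapse U γ N z) / z 0 else 0 := by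
  have h : ∀ y ∈ spacetimeDomain U T, lapse U γ N y = stScal U γ y - ((N : ℝ) / 2) / y 0 := by
    intro y hy
    rw [lapse, div_div]
  have h0 := (time_pos hz).ne'
  rw [pderivOn_congr h hz, pderivOn_sub hγ.regularDomain hz hγ.stScal_smooth (inv_time_smooth _),
    hγ.pderivOn_inv_time hz]
  split_ifs
  · rw [lapse]
    field_simp
    ring
  · ring

theorem expansionScale : ExpansionScale (spacetimeDomain U T) (lapse U γ) where
  smooth := hγ.lapse_smooth
  pderiv_inv a := by
    have hD := hγ.regularDomain
    have hs : ∀ {f : Coords (Fin (n + 1)) → ℝ}, SmoothFn (spacetimeDomain U T) f →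
        ContDiffOn ℝ ∞ (fun p : ℝ × Coords (Fin (n + 1)) => f p.2)
          (univ ×ˢ spacetimeDomain U T) := fun hf =>
      hf.comp contDiffOn_snd fun _ hp => hp.2
    let τ : ℝ := if a = 0 then 1 else 0
    -- With `s = 1/v`, the formula `∂_a s = - s² ∂_a v` and `pderivOn_lapse` give `- s² (∂_a R +
    -- δ_{a0} R/t) + δ_{a0} s/t`; the term `-v/t` of `∂_t v` loses one power of `s`.
    refine ⟨fun p => - p.1 ^ 2 * (pderivOn (spacetimeDomain U T) a (stScal U γ) p.2
      + τ * (stScal U γ p.2 * (1 / p.2 0))) + τ * (p.1 * (1 / p.2 0)), ?_, ?_, ?_⟩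
    · exact (((contDiffOn_fst.pow 2).neg).mul ((hs (hγ.stScal_smooth.pderivOn hD a)).add
        (contDiffOn_const.mul ((hs hγ.stScal_smooth).mul (hs (inv_time_smooth 1)))))).add
        (contDiffOn_const.mul (contDiffOn_fst.mul (hs (inv_time_smooth 1))))
    · intro y hy
      simp
    · intro N y hy hv
      have h1 : HasFDerivWithinAt (lapse U γ N)
        (fderivWithin ℝ (lapse U γ N) (spacetimeDomain U T) y) (spacetimeDomain U T) y :=
        ((hγ.lapse_smooth N).differentiableWithinAt hy).hasFDerivWithinAt
      have h2 : HasFDerivWithinAt (fun y => (lapse U γ N y)⁻¹)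
          ((-((lapse U γ N y) ^ 2)⁻¹) •
            fderivWithin ℝ (lapse U γ N) (spacetimeDomain U T) y) (spacetimeDomain U T) y :=
        (hasDerivAt_inv hv).comp_hasFDerivWithinAt y h1
      have h3 : pderivOn (spacetimeDomain U T) a (fun y => (lapse U γ N y)⁻¹) y
          = -((lapse U γ N y) ^ 2)⁻¹ * pderivOn (spacetimeDomain U T) a (lapse U γ N) y := by
        unfold pderivOn
        rw [h2.fderivWithin (hD.uniqueDiffOn y hy)]
        rfl
      have h0 := (time_pos hy).ne'
      rw [h3, hγ.pderivOn_lapse hy]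
      simp only [τ]
      split_ifs
      · field_simp
        ring
      · field_simp
        ring
  bound K hK hKc := by
    obtain ⟨B, hB⟩ := hKc.exists_bound_of_continuousOn (hγ.stScal_smooth.continuousOn.mono hK)
    have hT := hγ.pos
    -- On `K` one has `v ≤ |B| - N/(2T)`. Once `N ≥ 4T|B|`, half of `N/(2T)` absorbs `|B|` and `v ≤
    -- - N/(4T)`.
    refine ⟨4 * T, Nat.ceil (4 * T * |B|), by positivity, fun N h1 hN z hz => ?_⟩
    have hNpos : (0 : ℝ) < N := by exact_mod_cast h1
    have hz0 := time_pos (hK hz)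
    have hzT : z 0 ≤ T := (hK hz).1.2
    have hN4 : 4 * T * |B| ≤ N := (Nat.le_ceil _).trans (by exact_mod_cast hN)
    have hS : stScal U γ z ≤ |B| := (le_abs_self _).trans ((hB z hz).trans (le_abs_self B))
    have hq : (N : ℝ) / (2 * T) ≤ N / (2 * z 0) := by gcongr
    have hq2 : |B| ≤ N / (4 * T) := by
      rw [le_div_iff₀ (by positivity)]
      linarith
    have hq3 : (N : ℝ) / (2 * T) = N / (4 * T) + N / (4 * T) := by
      field_simp
      ring
    have hpos : 0 < (N : ℝ) / (4 * T) := by positivity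
    have hle : lapse U γ N z ≤ - (N / (4 * T)) := by
      unfold lapse
      linarith
    have habs : N / (4 * T) ≤ |lapse U γ N z| := by
      rw [abs_of_neg (by linarith)]
      linarith
    refine ⟨fun h => by rw [h] at hle; linarith, ?_⟩
    rw [abs_inv, inv_le_comm₀ (by linarith) (by positivity), inv_div]
    exact habs

end CoordRicciFlow

end Thermostat

/-! ### The limit of the Levi-Civita connections. -/

section LimitConnection

variable {n : ℕ}

/-- The limit of the inverse metrics of the thermostat. -/
def limInv (γ : ℝ → Coords (Fin n) → Matrix (Fin n) (Fin n) ℝ) (a b : Fin (n + 1))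
    (z : Coords (Fin (n + 1))) : ℝ := barInv γ 0 z a b

/-- The space-time Ricci tensor of the limit connection: `R_{ij}`, `∂_i R / 2` and
`(∂_t R + R / t) / 2`. -/
def limRic (U : Set (Coords (Fin n))) (T : ℝ)
    (γ : ℝ → Coords (Fin n) → Matrix (Fin n) (Fin n) ℝ) (a b : Fin (n + 1))
    (z : Coords (Fin (n + 1))) : ℝ :=
  Fin.cases
    (Fin.cases
      ((1 / 2) * (pderivOn (spacetimeDomain U T) 0 (stScal U γ) z + stScal U γ z / z 0))
      (fun j => (1 / 2) * pderivOn (spacetimeDomain U T) j.succ (stScal U γ) z) b)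
    (fun i => Fin.cases ((1 / 2) * pderivOn (spacetimeDomain U T) i.succ (stScal U γ) z)
      (fun j => stRic U γ z i j) b) a

/-- The limit of the Levi-Civita connections of the thermostat. -/
def limConn (U : Set (Coords (Fin n))) (T : ℝ)
    (γ : ℝ → Coords (Fin n) → Matrix (Fin n) (Fin n) ℝ) (a b c : Fin (n + 1))
    (z : Coords (Fin (n + 1))) : ℝ :=
  Fin.cases (Fin.cases (Fin.cases (- (1 / 2 / z 0)) (fun _ => 0) c) (fun _ => 0) b)
    (fun k => Fin.cases (- ∑ l, stInv γ z k l * limRic U T γ l.succ c z)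
      (fun i => Fin.cases (- ∑ l, stInv γ z k l * limRic U T γ l.succ i.succ z)
        (fun j => stChr U γ k i j z) c) b) a

variable {U : Set (Coords (Fin n))} {T : ℝ}
  {γ : ℝ → Coords (Fin n) → Matrix (Fin n) (Fin n) ℝ} {z : Coords (Fin (n + 1))}

namespace CoordRicciFlow

variable (hγ : CoordRicciFlow U T γ)
include hγ

/-- The Ricci tensor is, up to the factor `-2`, the time derivative of the symmetric matrix `g`. -/
theorem stRic_symm (hz : z ∈ spacetimeDomain U T) (i j : Fin n) :
    stRic U γ z i j = stRic U γ z j i := by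
  have h1 := hγ.pderivOn_zero_stG hz i j
  rw [pderivOn_congr (fun y hy => hγ.stG_symm hy i j) hz, hγ.pderivOn_zero_stG hz] at h1
  linarith

theorem limRic_smooth (a b : Fin (n + 1)) :
    SmoothFn (spacetimeDomain U T) (limRic U T γ a b) := by
  have hS := fun c => hγ.stScal_smooth.pderivOn hγ.regularDomain c
  refine Fin.cases ?_ (fun i => ?_) a <;> refine Fin.cases ?_ (fun j => ?_) b
  · exact contDiffOn_const.mul ((hS 0).add (hγ.stScal_smooth.div time_smooth
      fun z hz => (time_pos hz).ne'))
  · exact contDiffOn_const.mul (hS j.succ)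
  · exact contDiffOn_const.mul (hS i.succ)
  · exact hγ.stRic_smooth i j

theorem hasExp_inv (a b : Fin (n + 1)) : HasExp (spacetimeDomain U T) (lapse U γ)
    (fun N z => (barMetric U γ N z)⁻¹ a b) (limInv γ a b) := by
  have h : HasExp (spacetimeDomain U T) (lapse U γ)
      (fun N z => barInv γ (lapse U γ N z)⁻¹ z a b) (limInv γ a b) := by
    refine Fin.cases ?_ (fun i => ?_) a <;> refine Fin.cases ?_ (fun j => ?_) b
    · exact HasExp.inv
    · exact HasExp.of_smooth contDiffOn_const
    · exact HasExp.of_smooth contDiffOn_const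
    · exact HasExp.of_smooth (hγ.stInv_smooth i j)
  exact h.congr (fun N y hy hv => by rw [hγ.barMetric_inv hy hv]) fun _ _ => rfl

theorem pderivOn_bar_zero_zero {N : ℕ} (hz : z ∈ spacetimeDomain U T) (i : Fin n) :
    pderivOn (spacetimeDomain U T) i.succ (fun y => barMetric U γ N y 0 0) z
      = pderivOn (spacetimeDomain U T) i.succ (stScal U γ) z := by
  have h := hγ.pderivOn_lapse (N := N) hz i.succ
  rwa [if_neg (Fin.succ_ne_zero i), add_zero] at h

/-- For a spatial upper index only `g^{kl}` enters, and `ḡ_{00}` enters only through its spatial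
derivatives, in which `N/(2t)` disappears. These symbols are therefore exactly independent of `N`.
-/
theorem christoffel_bar_succ {N : ℕ} (hz : z ∈ spacetimeDomain U T) (hv : lapse U γ N z ≠ 0)
    (k : Fin n) (b c : Fin (n + 1)) :
    christoffel (spacetimeDomain U T) (barMetric U γ N) k.succ b c z
      = limConn U T γ k.succ b c z := by
  unfold christoffel
  rw [hγ.barMetric_inv hz hv, Fin.sum_univ_succ, barInv_succ_zero, zero_mul, zero_add]
  simp only [barInv_succ_succ]
  have hconst : ∀ a, pderivOn (spacetimeDomain U T) a
    (fun _ : Coords (Fin (n + 1)) => (0 : ℝ)) z = 0 := fun a => pderivOn_const a 0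
  have hflow : ∀ i j, pderivOn (spacetimeDomain U T) 0
      (fun y => barMetric U γ N y (Fin.succ i) (Fin.succ j)) z = -2 * stRic U γ z i j :=
    fun i j => hγ.pderivOn_zero_stG hz i j
  refine Fin.cases ?_ (fun i => ?_) b <;> refine Fin.cases ?_ (fun j => ?_) c
  · simp only [barMetric_zero_succ, hconst, hγ.pderivOn_bar_zero_zero hz, limConn, limRic,
      Fin.cases_zero, Fin.cases_succ, Finset.mul_sum, ← Finset.sum_neg_distrib]
    exact Finset.sum_congr rfl fun l _ => by ring
  · simp only [barMetric_zero_succ, hconst, hflow, limConn, limRic,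
      Fin.cases_zero, Fin.cases_succ, Finset.mul_sum, ← Finset.sum_neg_distrib]
    refine Finset.sum_congr rfl fun l _ => ?_
    rw [hγ.stRic_symm hz]
    ring
  · simp only [barMetric_zero_succ, barMetric_succ_zero, hconst, hflow, limConn, limRic,
      Fin.cases_zero, Fin.cases_succ, Finset.mul_sum, ← Finset.sum_neg_distrib]
    refine Finset.sum_congr rfl fun l _ => ?_
    rw [hγ.stRic_symm hz]
    ring
  · exact (hγ.stChr_eq hz k i j).symm

/-- Symbols with upper index `0` carry the factor `1/v` and tend to zero, with one exception: in
`Γ^0_{00} = ∂_t v / (2v)` the growing term `-v/t` of `∂_t v` survives as `-1/(2t)`. -/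
theorem hasExp_christoffel (a b c : Fin (n + 1)) : HasExp (spacetimeDomain U T) (lapse U γ)
    (fun N => christoffel (spacetimeDomain U T) (barMetric U γ N) a b c)
    (limConn U T γ a b c) := by
  have hD := hγ.regularDomain
  have hS := hγ.stScal_smooth
  revert a
  refine Fin.cases ?_ fun k => ?_
  · have h : ∀ N b c, ∀ z ∈ spacetimeDomain U T, lapse U γ N z ≠ 0 →
        christoffel (spacetimeDomain U T) (barMetric U γ N) 0 b c z
        = (1 / 2) * ((lapse U γ N z)⁻¹ *
          (pderivOn (spacetimeDomain U T) b (fun y => barMetric U γ N y c 0) z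
            + pderivOn (spacetimeDomain U T) c (fun y => barMetric U γ N y b 0) z
            - pderivOn (spacetimeDomain U T) 0 (fun y => barMetric U γ N y b c) z)) := by
      intro N b c z hz hv
      unfold christoffel
      rw [hγ.barMetric_inv hz hv, Fin.sum_univ_succ]
      simp
    have hsm : ∀ {f : Coords (Fin (n + 1)) → ℝ}, SmoothFn (spacetimeDomain U T) f →
        HasExp (spacetimeDomain U T) (lapse U γ) (fun N z => (lapse U γ N z)⁻¹ * f z)
          (fun _ => 0) := fun hf =>
      (HasExp.inv.mul (HasExp.of_smooth hf)).congr (fun _ _ _ _ => rfl)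
        fun y _ => (zero_mul _).symm
    refine Fin.cases ?_ (fun i => ?_) b <;> refine Fin.cases ?_ (fun j => ?_) c
    · refine ((hsm (contDiffOn_const.mul ((hS.pderivOn hD 0).add
        (hS.mul (inv_time_smooth 1)))) (f := fun z => (1 / 2) * (pderivOn (spacetimeDomain U T) 0
          (stScal U γ) z + stScal U γ z * (1 / z 0)))).add
        (HasExp.of_smooth (inv_time_smooth (1 / 2)).neg)).congr ?_ fun y _ => (zero_add _).symm
      intro N z hz hv
      rw [h N _ _ z hz hv]
      have e := hγ.pderivOn_lapse (N := N) hz 0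
      rw [if_pos rfl] at e
      have h0 := (time_pos hz).ne'
      change 1 / 2 * ((lapse U γ N z)⁻¹ * (pderivOn _ 0 (lapse U γ N) z
        + pderivOn _ 0 (lapse U γ N) z - pderivOn _ 0 (lapse U γ N) z)) = _
      rw [e]
      field_simp
      ring
    · refine (hsm (contDiffOn_const.mul (hS.pderivOn hD j.succ)) (f := fun z => (1 / 2) *
        pderivOn (spacetimeDomain U T) j.succ (stScal U γ) z)).congr ?_ fun _ _ => rfl
      intro N z hz hv
      rw [h N _ _ z hz hv, hγ.pderivOn_bar_zero_zero hz]
      simp only [barMetric_zero_succ, barMetric_succ_zero, pderivOn_const]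
      ring
    · refine (hsm (contDiffOn_const.mul (hS.pderivOn hD i.succ)) (f := fun z => (1 / 2) *
        pderivOn (spacetimeDomain U T) i.succ (stScal U γ) z)).congr ?_ fun _ _ => rfl
      intro N z hz hv
      rw [h N _ _ z hz hv, hγ.pderivOn_bar_zero_zero hz]
      simp only [barMetric_succ_zero, pderivOn_const]
      ring
    · refine (hsm (hγ.stRic_smooth i j)).congr ?_ fun _ _ => rfl
      intro N z hz hv
      rw [h N _ _ z hz hv]
      simp only [barMetric_succ_zero, pderivOn_const]
      change 1 / 2 * ((lapse U γ N z)⁻¹ * (0 + 0 - pderivOn _ 0 (stG γ i j) z)) = _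
      rw [hγ.pderivOn_zero_stG hz]
      ring
  · have hconn : SmoothFn (spacetimeDomain U T) (limConn U T γ k.succ b c) := by
      refine Fin.cases ?_ (fun i => ?_) b <;> refine Fin.cases ?_ (fun j => ?_) c
      · exact (SmoothFn.sum fun _ _ => (hγ.stInv_smooth _ _).mul (hγ.limRic_smooth _ _)).neg
      · exact (SmoothFn.sum fun _ _ => (hγ.stInv_smooth _ _).mul (hγ.limRic_smooth _ _)).neg
      · exact (SmoothFn.sum fun _ _ => (hγ.stInv_smooth _ _).mul (hγ.limRic_smooth _ _)).neg
      · exact hγ.stChr_smooth k i j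
    exact (HasExp.of_smooth hconn).congr
      (fun N y hy hv => hγ.christoffel_bar_succ hy hv k b c) fun _ _ => rfl

end CoordRicciFlow

end LimitConnection

/-! ### The structure that survives in the limit. -/

section LimitGeometry

variable {ι : Type} [Fintype ι] [DecidableEq ι]

/-- A torsion-free connection `Γ` with a parallel, possibly degenerate, symmetric bivector `h`
and a tensor `T` with the symmetries of a Riemann tensor, such that `h` raises the last index of
`T` to the curvature of `Γ`. -/
structure CurvatureGeometry (D : Set (Coords ι)) (Γ : ι → ι → ι → Coords ι → ℝ)
    (h : ι → ι → Coords ι → ℝ) (R : CovTensor ι 4) : Prop where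
  domain : RegularDomain D
  conn_smooth : ∀ a b c, SmoothFn D (Γ a b c)
  inv_smooth : ∀ a b, SmoothFn D (h a b)
  smooth : SmoothTensor D R
  conn_symm : ∀ a b c, ∀ y ∈ D, Γ a b c y = Γ a c b y
  inv_symm : ∀ a b, ∀ y ∈ D, h a b y = h b a y
  parallel : ParallelBivector D Γ h
  antisymm_left : ∀ a b c d, ∀ y ∈ D, R ![b, a, c, d] y = - R ![a, b, c, d] y
  antisymm_right : ∀ a b c d, ∀ y ∈ D, R ![a, b, d, c] y = - R ![a, b, c, d] y
  bianchi_first : ∀ a b c d, ∀ y ∈ D, R ![a, b, c, d] y + R ![b, c, a, d] y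
    + R ![c, a, b, d] y = 0
  bianchi_second : ∀ e a b c d, ∀ y ∈ D, covD D Γ R ![e, a, b, c, d] y
    + covD D Γ R ![a, b, e, c, d] y + covD D Γ R ![b, e, a, c, d] y = 0
  curv : ∀ a b c f, ∀ y ∈ D, connCurv D Γ a b c f y = ∑ q, h f q y * R ![a, b, c, q] y

end LimitGeometry

/-! ### The limit of the curvature tensors and of the heat operator. -/

section LimitTensor

variable {n : ℕ} {U : Set (Coords (Fin n))} {T : ℝ}
  {γ : ℝ → Coords (Fin n) → Matrix (Fin n) (Fin n) ℝ} {z : Coords (Fin (n + 1))}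

namespace CoordRicciFlow

variable (hγ : CoordRicciFlow U T γ)
include hγ

theorem exists_isOpen_metricOn (N : ℕ) : ∃ O : Set (Coords (Fin (n + 1))), IsOpen O ∧
    (∀ y ∈ spacetimeDomain U T, lapse U γ N y ≠ 0 ↔ y ∈ O) ∧
    MetricOn (spacetimeDomain U T ∩ O) (barMetric U γ N) := by
  obtain ⟨O, hO, hOe⟩ := continuousOn_iff'.1 (hγ.lapse_smooth N).continuousOn {0}ᶜ
    isOpen_compl_singleton
  have hiff : ∀ y ∈ spacetimeDomain U T, lapse U γ N y ≠ 0 ↔ y ∈ O := by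
    intro y hy
    have := Set.ext_iff.1 hOe y
    simp only [mem_inter_iff, mem_preimage, mem_compl_iff, mem_singleton_iff, hy, and_true] at this
    exact this
  refine ⟨O, hO, hiff, ?_, ?_, ?_⟩
  · intro a b
    refine ContDiffOn.mono (t := spacetimeDomain U T ∩ O) (s := spacetimeDomain U T) ?_
      inter_subset_left
    refine Fin.cases ?_ (fun i => ?_) a <;> refine Fin.cases ?_ (fun j => ?_) b
    · exact hγ.lapse_smooth N
    · exact contDiffOn_const
    · exact contDiffOn_const
    · exact hγ.stG_smooth i j
  · intro y hy a b
    refine Fin.cases ?_ (fun i => ?_) a <;> refine Fin.cases ?_ (fun j => ?_) b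
    · rfl
    · rfl
    · rfl
    · exact hγ.stG_symm hy.1 i j
  · intro y hy
    exact Matrix.isUnit_det_of_right_inverse
      (hγ.barMetric_mul_barInv hy.1 ((hiff y hy.1).2 hy.2))

omit hγ in
theorem riemann_bar_succ {N : ℕ} (a b c : Fin (n + 1)) (k : Fin n) :
    riemann (spacetimeDomain U T) (barMetric U γ N) ![a, b, c, k.succ] z
      = ∑ f : Fin n, stG γ k f z * connCurv (spacetimeDomain U T)
        (christoffel (spacetimeDomain U T) (barMetric U γ N)) a b c f.succ z := by
  rw [riemann_apply, Fin.sum_univ_succ]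
  simp

theorem hasExp_riemann_succ (a b c : Fin (n + 1)) (k : Fin n) :
    HasExp (spacetimeDomain U T) (lapse U γ)
      (fun N => riemann (spacetimeDomain U T) (barMetric U γ N) ![a, b, c, k.succ])
      (fun z => ∑ f : Fin n, stG γ k f z * connCurv (spacetimeDomain U T)
        (limConn U T γ) a b c f.succ z) :=
  HasExp.congr (HasExp.sum fun f => (HasExp.of_smooth (hγ.stG_smooth k f)).mul
      (HasExp.connCurv hγ.regularDomain hγ.expansionScale hγ.hasExp_christoffel a b c f.succ))
    (fun _ _ _ _ => riemann_bar_succ a b c k) fun _ _ => rfl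

theorem riemann_bar_antisymm_right {N : ℕ} (hz : z ∈ spacetimeDomain U T)
    (hv : lapse U γ N z ≠ 0) (a b c d : Fin (n + 1)) :
    riemann (spacetimeDomain U T) (barMetric U γ N) ![a, b, d, c] z
      = - riemann (spacetimeDomain U T) (barMetric U γ N) ![a, b, c, d] z := by
  obtain ⟨O, hO, hiff, hG⟩ := hγ.exists_isOpen_metricOn N
  have hzO : z ∈ spacetimeDomain U T ∩ O := ⟨hz, (hiff z hz).1 hv⟩
  have h := hG.riemann_antisymm_right (hγ.regularDomain.inter_isOpen hO) hzO a b c d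
  rwa [riemann_inter hO hzO, riemann_inter hO hzO] at h

/-- Lowering to a spatial last index involves only `g_{ij}` and preserves expansions, whereas
lowering to `0` multiplies by the growing `v`. In that case the antisymmetry moves the `0` to the
third slot, or gives zero if both last indices are `0`. -/
theorem exists_hasExp_riemann (s : Fin 4 → Fin (n + 1)) :
    ∃ a, HasExp (spacetimeDomain U T) (lapse U γ)
      (fun N => riemann (spacetimeDomain U T) (barMetric U γ N) s) a := by
  obtain ⟨a, b, c, d, rfl⟩ : ∃ a b c d, s = ![a, b, c, d] :=
    ⟨s 0, s 1, s 2, s 3, by ext i; fin_cases i <;> rfl⟩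
  revert d
  refine Fin.cases ?_ fun k => ⟨_, hγ.hasExp_riemann_succ a b c k⟩
  revert c
  refine Fin.cases ?_ fun k => ?_
  · refine ⟨fun _ => 0, (HasExp.of_smooth contDiffOn_const).congr ?_ fun _ _ => rfl⟩
    intro N y hy hv
    have := hγ.riemann_bar_antisymm_right hy hv a b 0 0
    linarith
  · exact ⟨_, (hγ.hasExp_riemann_succ a b 0 k).neg.congr
      (fun N y hy hv => hγ.riemann_bar_antisymm_right hy hv a b 0 k.succ) fun _ _ => rfl⟩

/-- The limit of the Riemann tensors of the thermostat. -/
theorem exists_limit_riemann : ∃ R : CovTensor (Fin (n + 1)) 4,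
    (∀ s, HasExp (spacetimeDomain U T) (lapse U γ)
      (fun N => riemann (spacetimeDomain U T) (barMetric U γ N) s) (R s)) ∧
    (∀ a b c k, ∀ z ∈ spacetimeDomain U T, R ![a, b, c, Fin.succ k] z
      = ∑ f : Fin n, stG γ k f z * connCurv (spacetimeDomain U T)
        (limConn U T γ) a b c f.succ z) ∧
    CurvatureGeometry (spacetimeDomain U T) (limConn U T γ) (limInv γ) R := by
  have hD := hγ.regularDomain
  have hv := hγ.expansionScale
  choose R hR using hγ.exists_hasExp_riemann
  have hdom : ∀ N, ∀ y ∈ spacetimeDomain U T, lapse U γ N y ≠ 0 →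
      ∃ O : Set (Coords (Fin (n + 1))), IsOpen O ∧ y ∈ spacetimeDomain U T ∩ O ∧
        RegularDomain (spacetimeDomain U T ∩ O) ∧
        MetricOn (spacetimeDomain U T ∩ O) (barMetric U γ N) := by
    intro N y hy hv
    obtain ⟨O, hO, hiff, hG⟩ := hγ.exists_isOpen_metricOn N
    exact ⟨O, hO, ⟨hy, (hiff y hy).1 hv⟩, hD.inter_isOpen hO, hG⟩
  refine ⟨R, hR, fun a b c k z hz => (hR _).leading_eq hv (hγ.hasExp_riemann_succ a b c k)
    (fun _ _ _ _ => rfl) hz, ?_⟩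
  -- Each remaining property holds at finite `N` where the lapse is nonzero, and passes to the
  -- leading terms by `HasExp.leading_eq`.
  refine ⟨hD, fun a b c => (hγ.hasExp_christoffel a b c).smooth,
    fun a b => (hγ.hasExp_inv a b).smooth, fun s => (hR s).smooth, ?_, ?_, ?_, ?_, ?_, ?_, ?_, ?_⟩
  · intro a b c z hz
    refine (hγ.hasExp_christoffel a b c).leading_eq hv (hγ.hasExp_christoffel a c b) ?_ hz
    intro N y hy hvy
    obtain ⟨O, hO, hyO, -, hG⟩ := hdom N y hy hvy
    have h := hG.christoffel_symm hyO a b c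
    rwa [christoffel_inter hO hyO.2, christoffel_inter hO hyO.2] at h
  · intro a b z hz
    refine (hγ.hasExp_inv a b).leading_eq hv (hγ.hasExp_inv b a) ?_ hz
    intro N y hy hvy
    obtain ⟨O, hO, hyO, -, hG⟩ := hdom N y hy hvy
    exact hG.inv_symm hyO a b
  · intro c a b z hz
    refine ((hγ.hasExp_inv a b).pderivOn hD hv c).leading_eq hv
      ((HasExp.sum (s := Finset.univ) fun m =>
        (hγ.hasExp_christoffel a c m).mul (hγ.hasExp_inv m b)).neg.sub
        (HasExp.sum (s := Finset.univ) fun m =>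
          (hγ.hasExp_christoffel b c m).mul (hγ.hasExp_inv a m))) ?_ hz
    intro N y hy hvy
    obtain ⟨O, hO, hyO, hDO, hG⟩ := hdom N y hy hvy
    have h := hG.parallelBivector_inv hDO c a b y hyO
    rw [pderivOn_inter (hO.mem_nhds hyO.2)] at h
    simpa only [christoffel_inter hO hyO.2] using h
  · intro a b c d z hz
    exact (hR _).leading_eq hv (hR _).neg (fun N y hy hvy => riemann_antisymm_left a b c d) hz
  · intro a b c d z hz
    exact (hR _).leading_eq hv (hR _).neg
      (fun N y hy hvy => hγ.riemann_bar_antisymm_right hy hvy a b c d) hz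
  · intro a b c d z hz
    refine (((hR _).add (hR _)).add (hR _)).leading_eq hv
      (HasExp.of_smooth (contDiffOn_const (c := (0 : ℝ)))) ?_ hz
    intro N y hy hvy
    obtain ⟨O, hO, hyO, hDO, hG⟩ := hdom N y hy hvy
    have h := hG.riemann_bianchi_first hyO a b c d
    simpa only [riemann_inter hO hyO] using h
  · intro e a b c d z hz
    have hc := HasExp.covD hD hv (fun a b c => hγ.hasExp_christoffel a b c) hR
    refine (((hc _).add (hc _)).add (hc _)).leading_eq hv
      (HasExp.of_smooth (contDiffOn_const (c := (0 : ℝ)))) ?_ hz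
    intro N y hy hvy
    obtain ⟨O, hO, hyO, hDO, hG⟩ := hdom N y hy hvy
    have h := hG.riemann_bianchi_second hDO hyO e a b c d
    rw [covDeriv_riemann_inter hO hyO, covDeriv_riemann_inter hO hyO,
      covDeriv_riemann_inter hO hyO] at h
    exact h
  · intro a b c f z hz
    refine (HasExp.connCurv hD hv hγ.hasExp_christoffel a b c f).leading_eq hv
      (HasExp.sum (s := Finset.univ) fun q => (hγ.hasExp_inv f q).mul (hR _)) ?_ hz
    intro N y hy hvy
    obtain ⟨O, hO, hyO, hDO, hG⟩ := hdom N y hy hvy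
    -- At finite `N` the inverse metric undoes the lowering of the last index; only the raised form
    -- of this relation has a limit.
    simp only [riemann_apply, Finset.mul_sum]
    rw [Finset.sum_comm]
    have : ∀ p, ∑ q, (barMetric U γ N y)⁻¹ f q * (barMetric U γ N y q p *
        connCurv (spacetimeDomain U T) (christoffel (spacetimeDomain U T) (barMetric U γ N))
          a b c p y) = (if f = p then 1 else 0) * connCurv (spacetimeDomain U T)
          (christoffel (spacetimeDomain U T) (barMetric U γ N)) a b c p y := by
      intro p
      rw [← hG.inv_mul hyO f p, Finset.sum_mul]
      exact Finset.sum_congr rfl fun q _ => (mul_assoc _ _ _).symm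
    simp only [this, ite_mul, one_mul, zero_mul, Finset.sum_ite_eq, Finset.mem_univ, if_true]

theorem hasExp_barHeatRm {R : CovTensor (Fin (n + 1)) 4}
    (hR : ∀ s, HasExp (spacetimeDomain U T) (lapse U γ)
      (fun N => riemann (spacetimeDomain U T) (barMetric U γ N) s) (R s))
    (s : Fin 4 → Fin (n + 1)) :
    HasExp (spacetimeDomain U T) (lapse U γ) (fun N => barHeatRm U T γ N s)
      (fun z => covD (spacetimeDomain U T) (limConn U T γ) R (Matrix.vecCons 0 s) z
        - ∑ a, ∑ b, limInv γ a b z * covD (spacetimeDomain U T) (limConn U T γ)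
          (covD (spacetimeDomain U T) (limConn U T γ) R) (Matrix.vecCons a (Matrix.vecCons b s))
            z) := by
  have hD := hγ.regularDomain
  have hv := hγ.expansionScale
  have hc := HasExp.covD hD hv (fun a b c => hγ.hasExp_christoffel a b c) hR
  have hcc := HasExp.covD hD hv (fun a b c => hγ.hasExp_christoffel a b c) hc
  exact (hc _).sub (HasExp.sum fun a => HasExp.sum fun b => (hγ.hasExp_inv a b).mul (hcc _))

end CoordRicciFlow

end LimitTensor

/-! ### Quadratic expressions in the curvature. -/

section DoubleContraction

variable {ι : Type} [Fintype ι] [DecidableEq ι]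

/-- The double contraction `h^{mn} h^{pq} f_{mnpq}`. -/
def contract₂ (h : ι → ι → ℝ) (f : ι → ι → ι → ι → ℝ) : ℝ :=
  ∑ m, ∑ n, ∑ p, ∑ q, h m n * h p q * f m n p q

theorem contract₂_add (h : ι → ι → ℝ) (f g : ι → ι → ι → ι → ℝ) :
    contract₂ h (fun m n p q => f m n p q + g m n p q) = contract₂ h f + contract₂ h g := by
  simp only [contract₂, mul_add, Finset.sum_add_distrib]

theorem contract₂_sub (h : ι → ι → ℝ) (f g : ι → ι → ι → ι → ℝ) :
    contract₂ h (fun m n p q => f m n p q - g m n p q) = contract₂ h f - contract₂ h g := by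
  simp only [contract₂, mul_sub, Finset.sum_sub_distrib]

theorem contract₂_neg (h : ι → ι → ℝ) (f : ι → ι → ι → ι → ℝ) :
    contract₂ h (fun m n p q => - f m n p q) = - contract₂ h f := by
  simp only [contract₂, mul_neg, Finset.sum_neg_distrib]

theorem contract₂_const_mul (h : ι → ι → ℝ) (c : ℝ) (f : ι → ι → ι → ι → ℝ) :
    contract₂ h (fun m n p q => c * f m n p q) = c * contract₂ h f := by
  simp only [contract₂, Finset.mul_sum]
  refine Finset.sum_congr rfl fun _ _ => Finset.sum_congr rfl fun _ _ =>
    Finset.sum_congr rfl fun _ _ => Finset.sum_congr rfl fun _ _ => ?_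
  ring

theorem contract₂_congr (h : ι → ι → ℝ) {f g : ι → ι → ι → ι → ℝ}
    (hfg : ∀ m n p q, f m n p q = g m n p q) : contract₂ h f = contract₂ h g := by
  simp only [contract₂, hfg]

theorem contract₂_swap_left {h : ι → ι → ℝ} (hs : ∀ a b, h a b = h b a)
    (f : ι → ι → ι → ι → ℝ) :
    contract₂ h (fun m n p q => f n m p q) = contract₂ h f := by
  unfold contract₂
  rw [Finset.sum_comm]
  simp only [hs]

theorem contract₂_swap_right {h : ι → ι → ℝ} (hs : ∀ a b, h a b = h b a)
    (f : ι → ι → ι → ι → ℝ) :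
    contract₂ h (fun m n p q => f m n q p) = contract₂ h f := by
  unfold contract₂
  refine Finset.sum_congr rfl fun m _ => Finset.sum_congr rfl fun n _ => ?_
  rw [Finset.sum_comm]
  exact Finset.sum_congr rfl fun p _ => Finset.sum_congr rfl fun q _ => by rw [hs q p]

theorem contract₂_swap_pairs (h : ι → ι → ℝ) (f : ι → ι → ι → ι → ℝ) :
    contract₂ h (fun m n p q => f p q m n) = contract₂ h f := by
  unfold contract₂
  rw [sum_pair_comm]
  refine Finset.sum_congr rfl fun _ _ => Finset.sum_congr rfl fun _ _ =>
    Finset.sum_congr rfl fun _ _ => Finset.sum_congr rfl fun _ _ => ?_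
  ring

theorem contract₂_mul_left (h : ι → ι → ℝ) (f : ι → ι → ι → ι → ℝ) (g : ι → ι → ℝ) :
    contract₂ h (fun m n p q => f m n p q * g p q)
      = ∑ p, ∑ q, h p q * ((∑ m, ∑ n, h m n * f m n p q) * g p q) := by
  unfold contract₂
  rw [sum_pair_comm]
  refine Finset.sum_congr rfl fun p _ => Finset.sum_congr rfl fun q _ => ?_
  simp only [Finset.mul_sum, Finset.sum_mul]
  refine Finset.sum_congr rfl fun m _ => Finset.sum_congr rfl fun n _ => ?_
  ring

/-- The quadratic terms `2 R_{ambp} R_c{}^m{}_d{}^p - 2 R_{ambp} R_d{}^m{}_c{}^p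
+ 2 R_{amcp} R_b{}^m{}_d{}^p - 2 R_{amdp} R_b{}^m{}_c{}^p`. -/
def curvQuad (h : ι → ι → ℝ) (r : ι → ι → ι → ι → ℝ) (a b c d : ι) : ℝ :=
  contract₂ h fun m n p q => 2 * (r a m b p * r c n d q) - 2 * (r a m b p * r d n c q)
    + 2 * (r a m c p * r b n d q) - 2 * (r a m d p * r b n c q)

/-- The left side collects the products produced by commuting covariant derivatives. Renaming
contracted indices makes them coincide in pairs (`e1` with `e6`, `e3` with `e8`, `e4` with `e7`),
and the first Bianchi identity splits the pair containing `r n q c d` into two terms (`e9`). -/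
theorem curvQuad_eq {h : ι → ι → ℝ} (hs : ∀ a b, h a b = h b a) {r : ι → ι → ι → ι → ℝ}
    (h1 : ∀ a b c d, r b a c d = - r a b c d) (h2 : ∀ a b c d, r a b d c = - r a b c d)
    (h3 : ∀ a b c d, r a b c d + r b c a d + r c a b d = 0) (a b c d : ι) :
    contract₂ h (fun m n p q => r m a b q * r p n c d + r m a c q * r b n p d
        + r m a d q * r b n c p + r m b a q * r n p c d + r m b c q * r n a p d
        + r m b d q * r n a c p) = curvQuad h r a b c d := by
  have hp := pair_symm_of_bianchi h1 h2 h3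
  have e1 : contract₂ h (fun m n p q => r m a b q * r p n c d)
      = contract₂ h (fun m n p q => r a m b p * r n q c d) := by
    rw [← contract₂_swap_right hs]
    exact contract₂_congr h fun m n p q => by rw [h1 a m, h1 n q]; ring
  have e6 : contract₂ h (fun m n p q => r m b a q * r n p c d)
      = contract₂ h (fun m n p q => r a m b p * r n q c d) := by
    rw [← contract₂_swap_pairs, ← contract₂_swap_left hs]
    exact contract₂_congr h fun m n p q => by
      rw [hp p b a m, h2 a m b p, h1 n q]; ring
  have e3 : contract₂ h (fun m n p q => r m a c q * r b n p d)
      = contract₂ h (fun m n p q => r a m c p * r b n d q) := by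
    rw [← contract₂_swap_right hs]
    exact contract₂_congr h fun m n p q => by rw [h1 a m, h2 b n d q]; ring
  have e8 : contract₂ h (fun m n p q => r m b d q * r n a c p)
      = contract₂ h (fun m n p q => r a m c p * r b n d q) := by
    rw [← contract₂_swap_left hs]
    exact contract₂_congr h fun m n p q => by rw [h1 a m, h1 b n]; ring
  have e4 : contract₂ h (fun m n p q => r m a d q * r b n c p)
      = - contract₂ h (fun m n p q => r a m d p * r b n c q) := by
    rw [← contract₂_swap_right hs, ← contract₂_neg]
    exact contract₂_congr h fun m n p q => by rw [h1 a m]; ring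
  have e7 : contract₂ h (fun m n p q => r m b c q * r n a p d)
      = - contract₂ h (fun m n p q => r a m d p * r b n c q) := by
    rw [← contract₂_swap_left hs, ← contract₂_neg]
    exact contract₂_congr h fun m n p q => by rw [h1 a m, h1 b n, h2 a m d p]; ring
  have e9 : contract₂ h (fun m n p q => r a m b p * r n q c d)
      = contract₂ h (fun m n p q => r a m b p * r c n d q)
        - contract₂ h (fun m n p q => r a m b p * r d n c q) := by
    rw [← contract₂_sub]
    refine contract₂_congr h fun m n p q => ?_
    have b1 := h3 n q c d
    have b2 := hp d n c q
    have b3 := h1 q c n d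
    have b4 := h2 c q d n
    have b5 := h1 c n q d
    have b6 := h2 c n d q
    have b7 := h1 c q n d
    have b8 := h2 c q n d
    have : r n q c d = r c n d q - r d n c q := by linarith
    rw [this]
    ring
  simp only [curvQuad, contract₂_add, contract₂_sub, contract₂_const_mul]
  rw [e1, e6, e3, e8, e4, e7, e9]
  ring

end DoubleContraction

/-! ### Ricci contraction, divergence and contracted Bianchi identities. -/

section CurvatureTheory

open Matrix (vecCons)

variable {ι : Type} [Fintype ι] [DecidableEq ι]

/-- The Ricci contraction `h^{kl} R_{akcl}`. -/
def ricciOf (h : ι → ι → Coords ι → ℝ) (R : CovTensor ι 4) : CovTensor ι 2 :=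
  fun s y => ∑ k, ∑ l, h k l y * R ![s 0, k, s 1, l] y

/-- The divergence `h^{mn} ∇_m R_{nbcd}`. -/
def divOf (D : Set (Coords ι)) (Γ : ι → ι → ι → Coords ι → ℝ) (h : ι → ι → Coords ι → ℝ)
    (R : CovTensor ι 4) : CovTensor ι 3 :=
  fun s y => ∑ m, ∑ n, h m n y * covD D Γ R (vecCons m (vecCons n s)) y

/-- The trace `h^{ab} A_{ab}`. -/
def traceOf (h : ι → ι → Coords ι → ℝ) (A : CovTensor ι 2) (y : Coords ι) : ℝ :=
  ∑ a, ∑ b, h a b y * A ![a, b] y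

variable {D : Set (Coords ι)} {Γ : ι → ι → ι → Coords ι → ℝ} {h : ι → ι → Coords ι → ℝ}
  {R : CovTensor ι 4} {z : Coords ι}

theorem vec_two_eta {α : Type*} (s : Fin 2 → α) : s = ![s 0, s 1] := by
  ext i; fin_cases i <;> rfl

theorem vec_three_eta {α : Type*} (s : Fin 3 → α) : s = ![s 0, s 1, s 2] := by
  ext i; fin_cases i <;> rfl

theorem vec_four_eta {α : Type*} (s : Fin 4 → α) : s = ![s 0, s 1, s 2, s 3] := by
  ext i; fin_cases i <;> rfl

theorem vec_five_eta {α : Type*} (s : Fin 5 → α) : s = ![s 0, s 1, s 2, s 3, s 4] := by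
  ext i; fin_cases i <;> rfl

namespace CurvatureGeometry

variable (hR : CurvatureGeometry D Γ h R)
include hR

theorem pair_symm (hz : z ∈ D) (a b c d : ι) : R ![a, b, c, d] z = R ![c, d, a, b] z :=
  pair_symm_of_bianchi (R := fun a b c d => R ![a, b, c, d] z)
    (fun a b c d => hR.antisymm_left a b c d z hz)
    (fun a b c d => hR.antisymm_right a b c d z hz)
    (fun a b c d => hR.bianchi_first a b c d z hz) a b c d

theorem covD_smooth : SmoothTensor D (covD D Γ R) :=
  SmoothTensor.covD hR.domain hR.conn_smooth hR.smooth

theorem covD_antisymm_left (hz : z ∈ D) (e a b c d : ι) :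
    covD D Γ R ![e, b, a, c, d] z = - covD D Γ R ![e, a, b, c, d] z := by
  have h1 := covD_symm (Γ := Γ) hR.domain hz hR.smooth (Equiv.swap 0 1) (-1) (fun s y hy => by
    rw [vec_four_eta (s ∘ _), vec_four_eta s, neg_one_mul]
    exact hR.antisymm_left (s 0) (s 1) (s 2) (s 3) y hy) e ![a, b, c, d]
  rw [neg_one_mul, vec_four_eta (_ ∘ _)] at h1
  exact h1

theorem covD_antisymm_right (hz : z ∈ D) (e a b c d : ι) :
    covD D Γ R ![e, a, b, d, c] z = - covD D Γ R ![e, a, b, c, d] z := by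
  have h1 := covD_symm (Γ := Γ) hR.domain hz hR.smooth (Equiv.swap 2 3) (-1) (fun s y hy => by
    rw [vec_four_eta (s ∘ _), vec_four_eta s, neg_one_mul]
    exact hR.antisymm_right (s 0) (s 1) (s 2) (s 3) y hy) e ![a, b, c, d]
  rw [neg_one_mul, vec_four_eta (_ ∘ _)] at h1
  exact h1

theorem covD_pair_symm (hz : z ∈ D) (e a b c d : ι) :
    covD D Γ R ![e, c, d, a, b] z = covD D Γ R ![e, a, b, c, d] z := by
  have h1 := covD_symm (Γ := Γ) hR.domain hz hR.smooth
    (Equiv.swap 0 2 * Equiv.swap 1 3) 1 (fun s y hy => by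
    rw [vec_four_eta (s ∘ _), vec_four_eta s, one_mul]
    exact hR.pair_symm hy (s 2) (s 3) (s 0) (s 1)) e ![a, b, c, d]
  rw [one_mul, vec_four_eta (_ ∘ _)] at h1
  exact h1

theorem covD_covD_antisymm (hz : z ∈ D) (m e a b c d : ι) :
    covD D Γ (covD D Γ R) ![m, e, b, a, c, d] z = - covD D Γ (covD D Γ R) ![m, e, a, b, c, d] z := by
  have h1 := covD_symm (Γ := Γ) hR.domain hz hR.covD_smooth (Equiv.swap 1 2) (-1)
    (fun s y hy => by
      rw [vec_five_eta (s ∘ _), vec_five_eta s, neg_one_mul]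
      exact hR.covD_antisymm_left hy (s 0) (s 1) (s 2) (s 3) (s 4)) m ![e, a, b, c, d]
  rw [neg_one_mul, vec_five_eta (_ ∘ _)] at h1
  exact h1

theorem covD_covD_bianchi (hz : z ∈ D) (m e a b c d : ι) :
    covD D Γ (covD D Γ R) ![m, e, a, b, c, d] z + covD D Γ (covD D Γ R) ![m, a, b, e, c, d] z
      + covD D Γ (covD D Γ R) ![m, b, e, a, c, d] z = 0 := by
  let W := covD D Γ R
  let σ : Equiv.Perm (Fin 5) := Equiv.swap 0 1 * Equiv.swap 1 2
  let τ : Equiv.Perm (Fin 5) := Equiv.swap 1 2 * Equiv.swap 0 1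
  have hW : SmoothTensor D W := hR.covD_smooth
  have h0 := covD_zero_of_forall (Γ := Γ) (A := fun s y => (W s y + W (s ∘ σ) y) + W (s ∘ τ) y)
    (fun s y hy => by
      rw [vec_five_eta (s ∘ σ), vec_five_eta (s ∘ τ), vec_five_eta s]
      exact hR.bianchi_second (s 0) (s 1) (s 2) (s 3) (s 4) y hy) hz (vecCons m ![e, a, b, c, d])
  rw [covD_add hR.domain hz (fun s => (hW s).add (hW _)) (fun s => hW _),
    covD_add hR.domain hz hW (fun s => hW _), covD_perm σ W, covD_perm τ W,
    vec_five_eta (_ ∘ σ), vec_five_eta (_ ∘ τ)] at h0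
  exact h0

theorem ricciOf_smooth : SmoothTensor D (ricciOf h R) := fun _ =>
  SmoothFn.sum fun _ _ => SmoothFn.sum fun _ _ => (hR.inv_smooth _ _).mul (hR.smooth _)

theorem divOf_smooth : SmoothTensor D (divOf D Γ h R) := fun _ =>
  SmoothFn.sum fun _ _ => SmoothFn.sum fun _ _ => (hR.inv_smooth _ _).mul (hR.covD_smooth _)

theorem ricciOf_symm (hz : z ∈ D) (a b : ι) :
    ricciOf h R ![a, b] z = ricciOf h R ![b, a] z := by
  change ∑ k, ∑ l, h k l z * R ![a, k, b, l] z = ∑ k, ∑ l, h k l z * R ![b, k, a, l] z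
  rw [Finset.sum_comm]
  refine Finset.sum_congr rfl fun k _ => Finset.sum_congr rfl fun l _ => ?_
  rw [hR.pair_symm hz a l b k, hR.inv_symm _ _ _ hz]

theorem covD_ricciOf (hz : z ∈ D) (e a c : ι) : covD D Γ (ricciOf h R) ![e, a, c] z
    = ∑ k, ∑ l, h k l z * covD D Γ R ![e, a, k, c, l] z := by
  -- The permutation brings the two contracted slots to the front, as `covD_contract` requires.
  let σ : Equiv.Perm (Fin 4) := ⟨![2, 0, 3, 1], ![1, 3, 0, 2], by decide, by decide⟩
  have hσ : ∀ k l a c : ι, ![k, l, a, c] ∘ σ = ![a, k, c, l] := by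
    intro k l a c
    rw [vec_four_eta (_ ∘ _)]
    rfl
  have h1 := covD_contract (Γ := Γ) hR.domain hz hR.inv_smooth hR.parallel
    (A := fun s => R (s ∘ σ)) (fun s => hR.smooth _) e ![a, c]
  simp only [covD_perm, hσ] at h1
  rw [← h1]
  refine covD_congr (fun s y hy => ?_) hz _
  refine Finset.sum_congr rfl fun k _ => Finset.sum_congr rfl fun l _ => ?_
  have : vecCons k (vecCons l s) ∘ σ = ![s 0, k, s 1, l] := by
    rw [vec_two_eta s]
    exact hσ k l (s 0) (s 1)
  rw [this]

theorem covD_ricciOf_symm (hz : z ∈ D) (e a b : ι) :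
    covD D Γ (ricciOf h R) ![e, a, b] z = covD D Γ (ricciOf h R) ![e, b, a] z := by
  have h1 := covD_symm (Γ := Γ) hR.domain hz hR.ricciOf_smooth (Equiv.swap 0 1) 1
    (fun s y hy => by
      rw [vec_two_eta (s ∘ _), vec_two_eta s, one_mul]
      exact hR.ricciOf_symm hy (s 1) (s 0)) e ![b, a]
  rw [one_mul, vec_two_eta (_ ∘ _)] at h1
  exact h1

/-- Exchange the index pairs, apply the second Bianchi identity to the derivative index together
with `c` and `d`, and contract. -/
theorem divOf_eq (hz : z ∈ D) (b c d : ι) : divOf D Γ h R ![b, c, d] z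
    = covD D Γ (ricciOf h R) ![c, d, b] z - covD D Γ (ricciOf h R) ![d, c, b] z := by
  rw [hR.covD_ricciOf hz, hR.covD_ricciOf hz]
  simp only [← Finset.sum_sub_distrib]
  refine Finset.sum_congr rfl fun m _ => Finset.sum_congr rfl fun n _ => ?_
  have e1 := hR.covD_pair_symm hz m n b c d
  have e2 := hR.bianchi_second m c d n b z hz
  have e3 := hR.covD_antisymm_right hz c d m n b
  have e4 := hR.covD_antisymm_left hz d m c n b
  have e5 := hR.covD_antisymm_right hz d c m n b
  change h m n z * covD D Γ R ![m, n, b, c, d] z = _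
  rw [← mul_sub]
  congr 1
  linarith

theorem covD_divOf (hz : z ∈ D) (a b c d : ι) : covD D Γ (divOf D Γ h R) ![a, b, c, d] z
    = ∑ m, ∑ n, h m n z * covD D Γ (covD D Γ R) ![a, m, n, b, c, d] z :=
  covD_contract hR.domain hz hR.inv_smooth hR.parallel hR.covD_smooth a ![b, c, d]

theorem covD_divOf_eq (hz : z ∈ D) (a b c d : ι) : covD D Γ (divOf D Γ h R) ![a, b, c, d] z
    = covD D Γ (covD D Γ (ricciOf h R)) ![a, c, d, b] z
      - covD D Γ (covD D Γ (ricciOf h R)) ![a, d, c, b] z := by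
  let W := covD D Γ (ricciOf h R)
  have hW : SmoothTensor D W := SmoothTensor.covD hR.domain hR.conn_smooth hR.ricciOf_smooth
  let σ : Equiv.Perm (Fin 3) := ⟨![1, 2, 0], ![2, 0, 1], by decide, by decide⟩
  let τ : Equiv.Perm (Fin 3) := ⟨![2, 1, 0], ![2, 1, 0], by decide, by decide⟩
  have h1 : covD D Γ (divOf D Γ h R) ![a, b, c, d] z
      = covD D Γ (fun s y => W (s ∘ σ) y - W (s ∘ τ) y) (vecCons a ![b, c, d]) z := by
    refine covD_congr (fun s y hy => ?_) hz _
    rw [vec_three_eta (s ∘ σ), vec_three_eta (s ∘ τ), vec_three_eta s]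
    exact hR.divOf_eq hy (s 0) (s 1) (s 2)
  rw [h1, covD_sub hR.domain hz (fun s => hW _) (fun s => hW _), covD_perm σ W, covD_perm τ W,
    vec_three_eta (_ ∘ σ), vec_three_eta (_ ∘ τ)]
  rfl

theorem pderivOn_traceOf (hz : z ∈ D) {A : CovTensor ι 2} (hA : SmoothTensor D A) (c : ι) :
    pderivOn D c (traceOf h A) z = ∑ a, ∑ b, h a b z * covD D Γ A ![c, a, b] z := by
  have h1 := covD_contract (Γ := Γ) hR.domain hz hR.inv_smooth hR.parallel hA c ![]
  rw [covD_cons] at h1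
  change pderivOn D c (fun y => ∑ a, ∑ b, h a b y * A ![a, b] y) z = _
  simpa using h1

/-- The contracted second Bianchi identity. -/
theorem contracted_bianchi (hz : z ∈ D) (c : ι) :
    ∑ a, ∑ b, h a b z * covD D Γ (ricciOf h R) ![a, b, c] z
      = (1 / 2) * pderivOn D c (traceOf h (ricciOf h R)) z := by
  -- The trace of the divergence is computed twice: directly it is the divergence of the Ricci
  -- tensor (`h1`), and by `divOf_eq` it is the derivative of the scalar trace minus that divergence
  -- (`h2`).
  have h1 : ∑ b, ∑ d, h b d z * divOf D Γ h R ![b, c, d] z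
      = ∑ a, ∑ b, h a b z * covD D Γ (ricciOf h R) ![a, b, c] z := by
    simp only [hR.covD_ricciOf hz, Finset.mul_sum]
    change ∑ b, ∑ d, h b d z * ∑ m, ∑ n, h m n z * covD D Γ R ![m, n, b, c, d] z = _
    simp only [Finset.mul_sum]
    rw [sum_pair_comm]
    refine Finset.sum_congr rfl fun m _ => Finset.sum_congr rfl fun n _ =>
      Finset.sum_congr rfl fun b _ => Finset.sum_congr rfl fun d _ => ?_
    ring
  have h2 : ∑ b, ∑ d, h b d z * divOf D Γ h R ![b, c, d] z
      = pderivOn D c (traceOf h (ricciOf h R)) z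
        - ∑ a, ∑ b, h a b z * covD D Γ (ricciOf h R) ![a, b, c] z := by
    rw [hR.pderivOn_traceOf hz hR.ricciOf_smooth]
    simp only [hR.divOf_eq hz, mul_sub, Finset.sum_sub_distrib]
    congr 1
    · refine Finset.sum_congr rfl fun m _ => Finset.sum_congr rfl fun n _ => ?_
      rw [hR.covD_ricciOf_symm hz]
    · rw [Finset.sum_comm]
      refine Finset.sum_congr rfl fun m _ => Finset.sum_congr rfl fun n _ => ?_
      rw [hR.covD_ricciOf_symm hz, hR.inv_symm _ _ _ hz]
  linarith

end CurvatureGeometry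

end CurvatureTheory

/-! ### The Laplacian of the curvature tensor. -/

section Laplacian

open Matrix (vecCons)

variable {ι : Type} [Fintype ι] [DecidableEq ι]

/-- The Laplacian `h^{ab} ∇_a ∇_b`. -/
def lapOf (D : Set (Coords ι)) (Γ : ι → ι → ι → Coords ι → ℝ) (h : ι → ι → Coords ι → ℝ) {k : ℕ}
    (A : CovTensor ι k) : CovTensor ι k :=
  fun s z => ∑ a, ∑ b, h a b z * covD D Γ (covD D Γ A) (vecCons a (vecCons b s)) z

variable {D : Set (Coords ι)} {Γ : ι → ι → ι → Coords ι → ℝ} {h : ι → ι → Coords ι → ℝ}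
  {R : CovTensor ι 4} {z : Coords ι}

namespace CurvatureGeometry

variable (hR : CurvatureGeometry D Γ h R)
include hR

theorem covD_covD_comm_four (hz : z ∈ D) (a b c d e f : ι) :
    covD D Γ (covD D Γ R) ![a, b, c, d, e, f] z = covD D Γ (covD D Γ R) ![b, a, c, d, e, f] z
      + ∑ p, ∑ q, h p q z * (R ![a, b, c, q] z * R ![p, d, e, f] z
        + R ![a, b, d, q] z * R ![c, p, e, f] z + R ![a, b, e, q] z * R ![c, d, p, f] z
        + R ![a, b, f, q] z * R ![c, d, e, p] z) := by
  have h1 := covD_covD_comm hR.domain hz hR.conn_smooth (fun a b c => hR.conn_symm a b c z hz)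
    hR.smooth a b ![c, d, e, f]
  rw [h1]
  congr 1
  simp only [Fin.sum_univ_succ, Fin.sum_univ_zero, update_vecCons_zero, update_vecCons_succ,
    add_zero]
  simp only [Matrix.cons_val_zero, Matrix.cons_val_succ, hR.curv _ _ _ _ z hz, Finset.sum_mul,
    mul_add, Finset.sum_add_distrib, mul_assoc, add_assoc]

theorem covD_covD_comm_two (hz : z ∈ D) {A : CovTensor ι 2} (hA : SmoothTensor D A)
    (a b c d : ι) :
    covD D Γ (covD D Γ A) ![a, b, c, d] z = covD D Γ (covD D Γ A) ![b, a, c, d] z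
      + ∑ p, ∑ q, h p q z * (R ![a, b, c, q] z * A ![p, d] z
        + R ![a, b, d, q] z * A ![c, p] z) := by
  have h1 := covD_covD_comm hR.domain hz hR.conn_smooth (fun a b c => hR.conn_symm a b c z hz)
    hA a b ![c, d]
  rw [h1]
  congr 1
  simp only [Fin.sum_univ_succ, Fin.sum_univ_zero, update_vecCons_zero, update_vecCons_succ,
    add_zero]
  simp only [Matrix.cons_val_zero, Matrix.cons_val_succ, hR.curv _ _ _ _ z hz, Finset.sum_mul,
    mul_add, Finset.sum_add_distrib, mul_assoc]

/-- The Laplacian of the curvature tensor in terms of its divergence. -/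
theorem lapOf_curvature (hz : z ∈ D) (a b c d : ι) : lapOf D Γ h R ![a, b, c, d] z
    = covD D Γ (divOf D Γ h R) ![a, b, c, d] z - covD D Γ (divOf D Γ h R) ![b, a, c, d] z
      + ∑ p, ∑ q, h p q z * (ricciOf h R ![a, q] z * R ![p, b, c, d] z)
      + ∑ p, ∑ q, h p q z * (ricciOf h R ![b, q] z * R ![a, p, c, d] z)
      - curvQuad (fun m n => h m n z) (fun a b c d => R ![a, b, c, d] z) a b c d := by
  -- The differentiated Bianchi identity trades the derivative index `n` for `a` and `b`; then `∇_m`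
  -- is commuted inwards, so that contraction over `m, n` produces derivatives of the divergence.
  have e0 : ∀ m n, covD D Γ (covD D Γ R) ![m, n, a, b, c, d] z
      = covD D Γ (covD D Γ R) ![a, m, n, b, c, d] z
        - covD D Γ (covD D Γ R) ![b, m, n, a, c, d] z
        - ∑ p, ∑ q, h p q z * (R ![m, a, b, q] z * R ![p, n, c, d] z
        + R ![m, a, n, q] z * R ![b, p, c, d] z + R ![m, a, c, q] z * R ![b, n, p, d] z
        + R ![m, a, d, q] z * R ![b, n, c, p] z)
        - ∑ p, ∑ q, h p q z * (R ![m, b, n, q] z * R ![p, a, c, d] z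
        + R ![m, b, a, q] z * R ![n, p, c, d] z + R ![m, b, c, q] z * R ![n, a, p, d] z
        + R ![m, b, d, q] z * R ![n, a, c, p] z) := by
    intro m n
    have b1 := hR.covD_covD_bianchi hz m n a b c d
    have b2 := hR.covD_covD_comm_four hz m a b n c d
    have b3 := hR.covD_covD_comm_four hz m b n a c d
    have b4 := hR.covD_covD_antisymm hz a m n b c d
    linarith
  have hq := curvQuad_eq (h := fun m n => h m n z) (fun a b => hR.inv_symm a b z hz)
    (r := fun a b c d => R ![a, b, c, d] z) (fun a b c d => hR.antisymm_left a b c d z hz)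
    (fun a b c d => hR.antisymm_right a b c d z hz)
    (fun a b c d => hR.bianchi_first a b c d z hz) a b c d
  have hric : ∀ a q, ∑ m, ∑ n, h m n z * R ![m, a, n, q] z = ricciOf h R ![a, q] z := by
    intro a q
    change _ = ∑ m, ∑ n, h m n z * R ![a, m, q, n] z
    refine Finset.sum_congr rfl fun m _ => Finset.sum_congr rfl fun n _ => ?_
    rw [hR.antisymm_left a m n q z hz, hR.antisymm_right a m q n z hz, neg_neg]
  have h2 := contract₂_mul_left (fun m n => h m n z) (fun m n p q => R ![m, a, n, q] z)
    (fun p _ => R ![b, p, c, d] z)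
  have h3 := contract₂_mul_left (fun m n => h m n z) (fun m n p q => R ![m, b, n, q] z)
    (fun p _ => R ![p, a, c, d] z)
  -- Of the eight commutator terms, the two in which `m, n` trace a single curvature factor yield
  -- Ricci terms; the other six form `curvQuad`.
  have h4 : ∑ m, ∑ n, h m n z * ∑ p, ∑ q, h p q z * (R ![m, a, b, q] z * R ![p, n, c, d] z
        + R ![m, a, n, q] z * R ![b, p, c, d] z + R ![m, a, c, q] z * R ![b, n, p, d] z
        + R ![m, a, d, q] z * R ![b, n, c, p] z)
      + ∑ m, ∑ n, h m n z * ∑ p, ∑ q, h p q z * (R ![m, b, n, q] z * R ![p, a, c, d] z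
        + R ![m, b, a, q] z * R ![n, p, c, d] z + R ![m, b, c, q] z * R ![n, a, p, d] z
        + R ![m, b, d, q] z * R ![n, a, c, p] z)
      = curvQuad (fun m n => h m n z) (fun a b c d => R ![a, b, c, d] z) a b c d
        + contract₂ (fun m n => h m n z)
          (fun m n p q => R ![m, a, n, q] z * R ![b, p, c, d] z)
        + contract₂ (fun m n => h m n z)
          (fun m n p q => R ![m, b, n, q] z * R ![p, a, c, d] z) := by
    rw [← hq]
    simp only [contract₂, Finset.mul_sum, ← Finset.sum_add_distrib]
    refine Finset.sum_congr rfl fun _ _ => Finset.sum_congr rfl fun _ _ =>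
      Finset.sum_congr rfl fun _ _ => Finset.sum_congr rfl fun _ _ => ?_
    ring
  have h5 : ∑ p, ∑ q, h p q z * (ricciOf h R ![a, q] z * R ![b, p, c, d] z)
      = - ∑ p, ∑ q, h p q z * (ricciOf h R ![a, q] z * R ![p, b, c, d] z) := by
    simp only [← Finset.sum_neg_distrib]
    refine Finset.sum_congr rfl fun p _ => Finset.sum_congr rfl fun q _ => ?_
    rw [hR.antisymm_left p b c d z hz]
    ring
  have h6 : ∑ p, ∑ q, h p q z * (ricciOf h R ![b, q] z * R ![p, a, c, d] z)
      = - ∑ p, ∑ q, h p q z * (ricciOf h R ![b, q] z * R ![a, p, c, d] z) := by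
    simp only [← Finset.sum_neg_distrib]
    refine Finset.sum_congr rfl fun p _ => Finset.sum_congr rfl fun q _ => ?_
    rw [hR.antisymm_left a p c d z hz]
    ring
  simp only [hric] at h2 h3
  rw [h5] at h2
  rw [h6] at h3
  rw [h2, h3] at h4
  rw [hR.covD_divOf hz, hR.covD_divOf hz]
  change ∑ m, ∑ n, h m n z * covD D Γ (covD D Γ R) ![m, n, a, b, c, d] z = _
  simp only [e0]
  simp only [mul_sub, Finset.sum_sub_distrib]
  linarith

end CurvatureGeometry

end Laplacian

/-! ### The soliton equation and its consequences for the curvature. -/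

section Soliton

open Matrix (vecCons)

variable {ι : Type} [Fintype ι] [DecidableEq ι]

/-- The components `θ_a` of the differential of the coordinate `x^o`. -/
def coordForm (o a : ι) : ℝ := if a = o then 1 else 0

@[simp] theorem coordForm_self (o : ι) : coordForm o o = 1 := if_pos rfl

theorem coordForm_of_ne {o a : ι} (h : a ≠ o) : coordForm o a = 0 := if_neg h

/-- A curvature geometry with a time coordinate `x^o` whose coordinate field satisfies the
soliton equation `∇_c ∂_o = - Ric_c - τ dx^o_c ∂_o`; the tensor `ρ` is the Ricci tensor
with its components in the direction `o` expressed by the scalar curvature. -/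
structure SolitonGeometry (D : Set (Coords ι)) (Γ : ι → ι → ι → Coords ι → ℝ)
    (h : ι → ι → Coords ι → ℝ) (R : CovTensor ι 4) (o : ι) (τ : Coords ι → ℝ)
    (ρ : CovTensor ι 2) : Prop extends CurvatureGeometry D Γ h R where
  rate_smooth : SmoothFn D τ
  field_smooth : SmoothTensor D ρ
  inv_time : ∀ b, ∀ y ∈ D, h o b y = 0
  conn_time : ∀ b c, ∀ y ∈ D, Γ o b c y = - τ y * coordForm o b * coordForm o c
  conn_field : ∀ a c, ∀ y ∈ D, Γ a c o y
    = - ∑ p, h a p y * ρ ![p, c] y - τ y * coordForm o c * coordForm o a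
  pderivOn_rate : ∀ c, ∀ y ∈ D, pderivOn D c τ y = -2 * τ y ^ 2 * coordForm o c
  field_symm : ∀ a b, ∀ y ∈ D, ρ ![a, b] y = ρ ![b, a] y
  field_space : ∀ a b, a ≠ o → b ≠ o → ∀ y ∈ D, ρ ![a, b] y = ricciOf h R ![a, b] y
  field_time : ∀ a, ∀ y ∈ D, ρ ![a, o] y = (1 / 2) * pderivOn D a (traceOf h (ricciOf h R)) y
    + τ y * traceOf h (ricciOf h R) y * coordForm o a
  exists_lower : ∃ G : ι → ι → Coords ι → ℝ, ∀ y ∈ D, ∀ i, i ≠ o → ∀ p,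
    ∑ f, G i f y * h f p y = if i = p then 1 else 0

variable {D : Set (Coords ι)} {Γ : ι → ι → ι → Coords ι → ℝ} {h : ι → ι → Coords ι → ℝ}
  {R : CovTensor ι 4} {o : ι} {τ : Coords ι → ℝ} {ρ : CovTensor ι 2} {z : Coords ι}

namespace SolitonGeometry

variable (hR : SolitonGeometry D Γ h R o τ ρ)
include hR

theorem inv_time' (hz : z ∈ D) (a : ι) : h a o z = 0 := by
  rw [hR.inv_symm a o z hz, hR.inv_time a z hz]

theorem pderivOn_conn_field (hz : z ∈ D) (f a b : ι) : pderivOn D b (Γ f a o) z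
    = - ∑ p, (pderivOn D b (h f p) z * ρ ![p, a] z + h f p z * pderivOn D b (ρ ![p, a]) z)
      + 2 * τ z ^ 2 * coordForm o b * coordForm o a * coordForm o f := by
  have hD := hR.domain
  have hsm : ∀ p, SmoothFn D (fun y => h f p y * ρ ![p, a] y) := fun p =>
    (hR.inv_smooth f p).mul (hR.field_smooth _)
  have h1 : ∀ y ∈ D, Γ f a o y = (- ∑ p, h f p y * ρ ![p, a] y)
      - (coordForm o a * coordForm o f) * τ y := by
    intro y hy
    rw [hR.conn_field f a y hy]
    ring
  rw [pderivOn_congr h1 hz, pderivOn_sub hD hz (SmoothFn.sum fun p _ => hsm p).neg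
    (contDiffOn_const.mul hR.rate_smooth), pderivOn_neg hD hz,
    pderivOn_sum hD hz fun p _ => hsm p, pderivOn_const_mul hD hz _ hR.rate_smooth,
    hR.pderivOn_rate b z hz]
  simp only [pderivOn_mul hD hz (hR.inv_smooth f _) (hR.field_smooth _)]
  ring

/-- The curvature in the direction of the time field. -/
theorem connCurv_field (hz : z ∈ D) (a b f : ι) : connCurv D Γ a b o f z
    = ∑ p, h f p z * (covD D Γ ρ ![a, p, b] z - covD D Γ ρ ![b, p, a] z
      + τ z * (coordForm o a * ρ ![p, b] z - coordForm o b * ρ ![p, a] z)) := by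
  -- This is one half of the curvature of `∂_o`. In the antisymmetrisation the `τ²` term drops out,
  -- being symmetric in `a, b`, and the remaining connection term drops out by torsion-freeness.
  have key : ∀ a b, pderivOn D b (Γ f a o) z + ∑ e, Γ e a o z * Γ f b e z
      = - ∑ p, h f p z * (covD D Γ ρ ![b, p, a] z + ∑ m, Γ m b a z * ρ ![p, m] z)
        + τ z * coordForm o a * ∑ p, h f p z * ρ ![p, b] z
        + 3 * τ z ^ 2 * coordForm o b * coordForm o a * coordForm o f := by
    intro a b
    have e1 : ∑ e, Γ e a o z * Γ f b e z
        = - ∑ e, (∑ p, h e p z * ρ ![p, a] z) * Γ f b e z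
          - τ z * coordForm o a * Γ f b o z := by
      have : ∀ e, Γ e a o z * Γ f b e z = - ((∑ p, h e p z * ρ ![p, a] z) * Γ f b e z)
          - τ z * coordForm o a * (if e = o then Γ f b e z else 0) := by
        intro e
        rw [hR.conn_field e a z hz]
        simp only [coordForm]
        split_ifs <;> ring
      simp only [this, Finset.sum_sub_distrib, Finset.sum_neg_distrib, ← Finset.mul_sum,
        Finset.sum_ite_eq', Finset.mem_univ, if_true]
    have e2 : ∑ p, pderivOn D b (h f p) z * ρ ![p, a] z
        = - ∑ e, (∑ p, h e p z * ρ ![p, a] z) * Γ f b e z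
          - ∑ p, h f p z * ∑ m, Γ m b p z * ρ ![m, a] z := by
      simp only [hR.parallel b f _ z hz, sub_mul, neg_mul, Finset.sum_sub_distrib,
        Finset.sum_neg_distrib, Finset.sum_mul, Finset.mul_sum]
      congr 1
      · congr 1
        rw [Finset.sum_comm]
        exact Finset.sum_congr rfl fun _ _ => Finset.sum_congr rfl fun _ _ => by ring
      · rw [Finset.sum_comm]
        exact Finset.sum_congr rfl fun _ _ => Finset.sum_congr rfl fun _ _ => by ring
    have e3 : ∑ p, h f p z * (covD D Γ ρ ![b, p, a] z + ∑ m, Γ m b a z * ρ ![p, m] z)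
        = ∑ p, h f p z * pderivOn D b (ρ ![p, a]) z
          - ∑ p, h f p z * ∑ m, Γ m b p z * ρ ![m, a] z := by
      simp only [covD_two, ← Finset.sum_sub_distrib]
      exact Finset.sum_congr rfl fun p _ => by ring
    rw [hR.pderivOn_conn_field hz, e1, e3, hR.conn_field f b z hz, Finset.sum_add_distrib, e2]
    ring
  have k1 := key a b
  have k2 := key b a
  have hs : ∑ p, h f p z * ∑ m, Γ m b a z * ρ ![p, m] z
      = ∑ p, h f p z * ∑ m, Γ m a b z * ρ ![p, m] z := by
    simp only [hR.conn_symm _ a b z hz]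
  simp only [mul_add, Finset.sum_add_distrib, hs] at k1 k2
  simp only [connCurv, mul_add, mul_sub, Finset.sum_add_distrib, Finset.sum_sub_distrib]
  have e5 : ∀ a b, ∑ p, h f p z * (τ z * (coordForm o a * ρ ![p, b] z))
      = τ z * coordForm o a * ∑ p, h f p z * ρ ![p, b] z := by
    intro a b
    rw [Finset.mul_sum]
    exact Finset.sum_congr rfl fun p _ => by ring
  rw [e5, e5]
  linarith

theorem sum_inv_field (hz : z ∈ D) :
    ∑ k, ∑ p, h k p z * ρ ![p, k] z = traceOf h (ricciOf h R) z := by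
  refine Finset.sum_congr rfl fun k _ => Finset.sum_congr rfl fun p _ => ?_
  by_cases hk : k = o
  · rw [hk, hR.inv_time p z hz, zero_mul, zero_mul]
  by_cases hp : p = o
  · rw [hp, hR.inv_time' hz, zero_mul, zero_mul]
  rw [hR.field_space p k hp hk z hz, hR.ricciOf_symm hz]

/-- Trace `connCurv_field` over the second direction and the upper index, and replace `½ ∂_a S`,
with `S` the scalar trace, by the divergence of the Ricci tensor. The unknown difference `Ric - ρ`
at `(a, o)` is thereby expressed by spatial traces of its own derivative. -/
theorem ricci_sub_field_time (hz : z ∈ D) (a : ι) :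
    ricciOf h R ![a, o] z - ρ ![a, o] z
      = ∑ k, ∑ p, h k p z * (covD D Γ (ricciOf h R) ![k, p, a] z - covD D Γ ρ ![k, p, a] z) := by
  have e1 : ricciOf h R ![a, o] z = ∑ k, connCurv D Γ a k o k z := by
    simp only [hR.curv _ _ _ _ z hz]
    rfl
  have e2 : ∑ k, ∑ p, h k p z * covD D Γ ρ ![a, p, k] z
      = pderivOn D a (traceOf h (ricciOf h R)) z := by
    rw [← pderivOn_congr (f := traceOf h ρ) (fun y hy => ?_) hz,
      hR.pderivOn_traceOf hz hR.field_smooth, Finset.sum_comm]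
    · refine Finset.sum_congr rfl fun k _ => Finset.sum_congr rfl fun p _ => ?_
      rw [hR.inv_symm _ _ z hz]
    · rw [← hR.sum_inv_field hy]
      refine Finset.sum_congr rfl fun k _ => Finset.sum_congr rfl fun p _ => ?_
      rw [hR.field_symm _ _ y hy]
  have e3 : ∑ k, ∑ p, h k p z * (τ z * (coordForm o a * ρ ![p, k] z))
      = τ z * traceOf h (ricciOf h R) z * coordForm o a := by
    rw [← hR.sum_inv_field hz]
    simp only [Finset.mul_sum, Finset.sum_mul]
    exact Finset.sum_congr rfl fun k _ => Finset.sum_congr rfl fun p _ => by ring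
  have e4 : ∑ k, ∑ p, h k p z * (τ z * (coordForm o k * ρ ![p, a] z)) = 0 := by
    refine Finset.sum_eq_zero fun k _ => Finset.sum_eq_zero fun p _ => ?_
    by_cases hk : k = o
    · rw [hk, hR.inv_time p z hz, zero_mul]
    · rw [coordForm_of_ne hk, zero_mul, mul_zero, mul_zero]
  have e5 := hR.contracted_bianchi hz a
  rw [e1, hR.field_time a z hz]
  simp only [hR.connCurv_field hz, mul_add, mul_sub, Finset.sum_add_distrib,
    Finset.sum_sub_distrib, e2, e3, e4, e5]
  ring

/-- The tensor `ρ` is the Ricci tensor. -/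
theorem ricciOf_eq_field (a b : ι) (hz : z ∈ D) : ricciOf h R ![a, b] z = ρ ![a, b] z := by
  have hδ : ∀ a b, a ≠ o → b ≠ o → ∀ y ∈ D, ricciOf h R ![a, b] y = ρ ![a, b] y :=
    fun a b ha hb y hy => (hR.field_space a b ha hb y hy).symm
  have hpair : ∀ k p c, k ≠ o → p ≠ o → (∀ y ∈ D, ricciOf h R ![p, c] y = ρ ![p, c] y) →
      (∀ y ∈ D, ∀ m, m ≠ o → ricciOf h R ![m, c] y = ρ ![m, c] y) →
      (∀ y ∈ D, ∀ m, Γ m k c y * ricciOf h R ![p, m] y = Γ m k c y * ρ ![p, m] y) →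
      ∀ y ∈ D, covD D Γ (ricciOf h R) ![k, p, c] y - covD D Γ ρ ![k, p, c] y = 0 := by
    intro k p c hk hp h1 h2 h3 y hy
    have h4 : ∀ m, Γ m k p y * ricciOf h R ![m, c] y = Γ m k p y * ρ ![m, c] y := by
      intro m
      by_cases hm : m = o
      · rw [hm, hR.conn_time k p y hy, coordForm_of_ne hk]
        ring
      · rw [h2 y hy m hm]
    rw [covD_two, covD_two, pderivOn_congr h1 hy]
    simp only [h3 y hy, h4, sub_self]
  have hsum : ∀ c, (∀ k p, k ≠ o → p ≠ o → ∀ y ∈ D,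
      covD D Γ (ricciOf h R) ![k, p, c] y - covD D Γ ρ ![k, p, c] y = 0) →
      ∀ y ∈ D, ricciOf h R ![c, o] y = ρ ![c, o] y := by
    intro c hc y hy
    have := hR.ricci_sub_field_time hy c
    rw [Finset.sum_eq_zero] at this
    · linarith
    · intro k _
      refine Finset.sum_eq_zero fun p _ => ?_
      by_cases hk : k = o
      · rw [hk, hR.inv_time p y hy, zero_mul]
      by_cases hp : p = o
      · rw [hp, hR.inv_time' hy, zero_mul]
      rw [hc k p hk hp y hy, mul_zero]
  -- The argument is a bootstrap. Since `Γ^o_{k·} = 0` for spatial `k`, the derivative of `Ric - ρ`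
  -- at spatial indices involves only its spatial components, which vanish. This settles the mixed
  -- components, and these in turn settle the component `(o, o)` in `htime`.
  have hspace : ∀ a, a ≠ o → ∀ y ∈ D, ricciOf h R ![a, o] y = ρ ![a, o] y := by
    intro a ha
    refine hsum a fun k p hk hp => hpair k p a hk hp (hδ p a hp ha)
      (fun y hy m hm => hδ m a hm ha y hy) fun y hy m => ?_
    by_cases hm : m = o
    · rw [hm, hR.conn_time k a y hy, coordForm_of_ne hk]
      ring
    · rw [hδ p m hp hm y hy]
  have htime : ∀ y ∈ D, ricciOf h R ![o, o] y = ρ ![o, o] y := by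
    refine hsum o fun k p hk hp => hpair k p o hk hp (hspace p hp)
      (fun y hy m hm => hspace m hm y hy) fun y hy m => ?_
    by_cases hm : m = o
    · rw [hm, hspace p hp y hy]
    · rw [hδ p m hp hm y hy]
  by_cases ha : a = o
  · by_cases hb : b = o
    · rw [ha, hb]
      exact htime z hz
    · rw [ha, hR.ricciOf_symm hz, hR.field_symm o b z hz]
      exact hspace b hb z hz
  · by_cases hb : b = o
    · rw [hb]
      exact hspace a ha z hz
    · exact hδ a b ha hb z hz

theorem covD_field (hz : z ∈ D) (e a b : ι) :
    covD D Γ ρ ![e, a, b] z = covD D Γ (ricciOf h R) ![e, a, b] z :=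
  covD_congr (fun s y hy => by
    rw [vec_two_eta s]
    exact (hR.ricciOf_eq_field (s 0) (s 1) hy).symm) hz _

theorem ricciOf_time (hz : z ∈ D) (a : ι) : ricciOf h R ![a, o] z
    = (1 / 2) * pderivOn D a (traceOf h (ricciOf h R)) z
      + τ z * traceOf h (ricciOf h R) z * coordForm o a := by
  rw [hR.ricciOf_eq_field a o hz, hR.field_time a z hz]

theorem conn_field' (hz : z ∈ D) (a c : ι) : Γ a c o z
    = - ∑ p, h a p z * ricciOf h R ![p, c] z - τ z * coordForm o c * coordForm o a := by
  simp only [hR.ricciOf_eq_field _ _ hz]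
  exact hR.conn_field a c z hz

theorem sum_conn_field (hz : z ∈ D) (a : ι) (A : ι → ℝ) : ∑ p, Γ p a o z * A p
    = - ∑ p, ∑ q, h p q z * (ricciOf h R ![a, q] z * A p) - τ z * coordForm o a * A o := by
  have h1 : ∀ p, Γ p a o z * A p = - ∑ q, h p q z * (ricciOf h R ![a, q] z * A p)
      - τ z * coordForm o a * (if p = o then A p else 0) := by
    intro p
    rw [hR.conn_field' hz, sub_mul, neg_mul, Finset.sum_mul]
    congr 1
    · congr 1
      exact Finset.sum_congr rfl fun q _ => by rw [hR.ricciOf_symm hz q a]; ring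
    · simp only [coordForm]
      split_ifs <;> ring
  simp only [h1, Finset.sum_sub_distrib, Finset.sum_neg_distrib, ← Finset.mul_sum,
    Finset.sum_ite_eq', Finset.mem_univ, if_true]

/-- By `ricciOf_time` the form `Ric(∂_o, ·)` is `½ dS + τ S θ`. Its antisymmetrised derivative loses
the Hessian of `S`, the quadratic Ricci terms are symmetric, and the rest is again expressed by
`Ric(∂_o, ·)`. -/
theorem covD_ricciOf_time (hz : z ∈ D) (a b : ι) :
    covD D Γ (ricciOf h R) ![a, o, b] z - covD D Γ (ricciOf h R) ![b, o, a] z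
      = - τ z * (coordForm o a * ricciOf h R ![o, b] z
        - coordForm o b * ricciOf h R ![o, a] z) := by
  have hD := hR.domain
  let S := traceOf h (ricciOf h R)
  have hS : SmoothFn D S := SmoothFn.sum fun _ _ => SmoothFn.sum fun _ _ =>
    (hR.inv_smooth _ _).mul (hR.ricciOf_smooth _)
  have e1 : ∀ a b, pderivOn D a (ricciOf h R ![o, b]) z
      = (1 / 2) * pderivOn D a (pderivOn D b S) z + coordForm o b *
        (-2 * τ z ^ 2 * coordForm o a * S z + τ z * pderivOn D a S z) := by
    intro a b
    have h1 : ∀ y ∈ D, ricciOf h R ![o, b] y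
        = (1 / 2) * pderivOn D b S y + coordForm o b * (τ y * S y) := by
      intro y hy
      rw [hR.ricciOf_symm hy, hR.ricciOf_time hy]
      ring
    rw [pderivOn_congr h1 hz, pderivOn_add hD hz (contDiffOn_const.mul (hS.pderivOn hD b))
      (contDiffOn_const.mul (hR.rate_smooth.mul hS)),
      pderivOn_const_mul hD hz _ (hS.pderivOn hD b),
      pderivOn_const_mul hD hz _ (hR.rate_smooth.mul hS),
      pderivOn_mul hD hz hR.rate_smooth hS, hR.pderivOn_rate a z hz]
  have e2 : ∑ p, ∑ q, h p q z * (ricciOf h R ![a, q] z * ricciOf h R ![p, b] z)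
      = ∑ p, ∑ q, h p q z * (ricciOf h R ![b, q] z * ricciOf h R ![p, a] z) := by
    rw [Finset.sum_comm]
    refine Finset.sum_congr rfl fun p _ => Finset.sum_congr rfl fun q _ => ?_
    rw [hR.inv_symm _ _ z hz, hR.ricciOf_symm hz a, hR.ricciOf_symm hz b]
    ring
  have e3 : ∑ m, Γ m a b z * ricciOf h R ![o, m] z = ∑ m, Γ m b a z * ricciOf h R ![o, m] z := by
    simp only [hR.conn_symm _ a b z hz]
  have r1 := hR.ricciOf_time hz a
  have r2 := hR.ricciOf_time hz b
  rw [covD_two, covD_two, e1, e1, pderivOn_comm hD hz hS a b,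
    hR.sum_conn_field hz a (fun m => ricciOf h R ![m, b] z),
    hR.sum_conn_field hz b (fun m => ricciOf h R ![m, a] z), e2, e3,
    hR.ricciOf_symm hz o a, hR.ricciOf_symm hz o b, r1, r2]
  ring

/-- The component `R_{aboc}` of the curvature tensor. -/
theorem curvature_field (hz : z ∈ D) (a b f : ι) : R ![a, b, o, f] z
    = divOf D Γ h R ![f, a, b] z
      + τ z * (coordForm o a * ricciOf h R ![f, b] z - coordForm o b * ricciOf h R ![f, a] z) := by
  rw [hR.divOf_eq hz, hR.covD_ricciOf_symm hz a b f, hR.covD_ricciOf_symm hz b a f]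
  -- The curvature of the connection determines the tensor only after raising with the degenerate
  -- `h`. For `f ≠ o` this can be undone by `exists_lower`; for `f = o` the left side vanishes by
  -- antisymmetry, and `covD_ricciOf_time` gives the same for the right side.
  by_cases hf : f = o
  · rw [hf, hR.covD_ricciOf_time hz]
    have := hR.antisymm_right a b o o z hz
    linarith
  · obtain ⟨G, hG⟩ := hR.exists_lower
    have hlow : ∀ x : ι → ℝ, ∑ g, G f g z * ∑ p, h g p z * x p = x f := by
      intro x
      simp only [Finset.mul_sum]
      rw [Finset.sum_comm]
      have : ∀ p, ∑ g, G f g z * (h g p z * x p) = if f = p then x p else 0 := by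
        intro p
        simp only [← mul_assoc, ← Finset.sum_mul, hG z hz f hf p, ite_mul, one_mul, zero_mul]
      simp only [this, Finset.sum_ite_eq, Finset.mem_univ, if_true]
    have h1 : ∀ g, ∑ p, h g p z * R ![a, b, o, p] z = ∑ p, h g p z *
        (covD D Γ (ricciOf h R) ![a, p, b] z - covD D Γ (ricciOf h R) ![b, p, a] z
      + τ z * (coordForm o a * ricciOf h R ![p, b] z
        - coordForm o b * ricciOf h R ![p, a] z)) := by
      intro g
      rw [← hR.curv a b o g z hz, hR.connCurv_field hz]
      simp only [hR.covD_field hz, hR.ricciOf_eq_field _ _ hz]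
    rw [← hlow (fun p => R ![a, b, o, p] z)]
    simp only [h1]
    exact hlow _

end SolitonGeometry

end Soliton

/-! ### The heat operator in a soliton geometry. -/

section Heat

open Matrix (vecCons)

variable {ι : Type} [Fintype ι] [DecidableEq ι]

/-- The tensor `τ (θ_c A_{bd} - θ_d A_{bc})`, where `θ = dx^o`. -/
def timeWedge (o : ι) (τ : Coords ι → ℝ) (A : CovTensor ι 2) : CovTensor ι 3 :=
  fun s y => τ y * (coordForm o (s 1) * A ![s 0, s 2] y - coordForm o (s 2) * A ![s 0, s 1] y)

variable {D : Set (Coords ι)} {Γ : ι → ι → ι → Coords ι → ℝ} {h : ι → ι → Coords ι → ℝ}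
  {R : CovTensor ι 4} {o : ι} {τ : Coords ι → ℝ} {ρ : CovTensor ι 2} {z : Coords ι}

namespace SolitonGeometry

variable (hR : SolitonGeometry D Γ h R o τ ρ)
include hR

theorem timeWedge_smooth : SmoothTensor D (timeWedge o τ (ricciOf h R)) := fun _ =>
  hR.rate_smooth.mul ((contDiffOn_const.mul (hR.ricciOf_smooth _)).sub
    (contDiffOn_const.mul (hR.ricciOf_smooth _)))

theorem curvature_time (hz : z ∈ D) (b c d : ι) : R ![o, b, c, d] z
    = divOf D Γ h R ![b, c, d] z + timeWedge o τ (ricciOf h R) ![b, c, d] z := by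
  rw [hR.pair_symm hz, hR.curvature_field hz]
  rfl

/-- Here `∇(τ θ) = - τ² θ ⊗ θ`: the derivative of `τ` contributes `-2τ²`, and `∇θ = τ θ ⊗ θ` returns
one `τ²`. -/
theorem covD_timeWedge (hz : z ∈ D) (a b c d : ι) :
    covD D Γ (timeWedge o τ (ricciOf h R)) ![a, b, c, d] z
      = τ z * (coordForm o c * covD D Γ (ricciOf h R) ![a, b, d] z
        - coordForm o d * covD D Γ (ricciOf h R) ![a, b, c] z)
      - τ z ^ 2 * coordForm o a * (coordForm o c * ricciOf h R ![b, d] z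
        - coordForm o d * ricciOf h R ![b, c] z) := by
  have hD := hR.domain
  have hs : ∀ (m : ι) (x : ι → ℝ), ∀ c, ∑ m, Γ m a c z * (coordForm o m * x m)
      = Γ o a c z * x o := by
    intro m x c
    rw [Finset.sum_eq_single o]
    · rw [coordForm_self, one_mul]
    · intro p _ hp
      rw [coordForm_of_ne hp, zero_mul, mul_zero]
    · exact fun hn => absurd (Finset.mem_univ o) hn
  have hc : ∀ c e : ι, SmoothFn D (fun y => coordForm o c * ricciOf h R ![b, e] y) :=
    fun c e => contDiffOn_const.mul (hR.ricciOf_smooth _)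
  have e1 : pderivOn D a (timeWedge o τ (ricciOf h R) ![b, c, d]) z
      = -2 * τ z ^ 2 * coordForm o a * (coordForm o c * ricciOf h R ![b, d] z
        - coordForm o d * ricciOf h R ![b, c] z)
        + τ z * (coordForm o c * pderivOn D a (ricciOf h R ![b, d]) z
        - coordForm o d * pderivOn D a (ricciOf h R ![b, c]) z) := by
    change pderivOn D a (fun y => τ y * (coordForm o c * ricciOf h R ![b, d] y
      - coordForm o d * ricciOf h R ![b, c] y)) z = _
    rw [pderivOn_mul hD hz hR.rate_smooth ((hc c d).sub (hc d c)),
      pderivOn_sub hD hz (hc c d) (hc d c), pderivOn_const_mul hD hz _ (hR.ricciOf_smooth _),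
      pderivOn_const_mul hD hz _ (hR.ricciOf_smooth _), hR.pderivOn_rate a z hz]
  have e2 : ∑ m, Γ m a b z * timeWedge o τ (ricciOf h R) ![m, c, d] z
      = τ z * (coordForm o c * ∑ m, Γ m a b z * ricciOf h R ![m, d] z
        - coordForm o d * ∑ m, Γ m a b z * ricciOf h R ![m, c] z) := by
    simp only [Finset.mul_sum, ← Finset.sum_sub_distrib]
    refine Finset.sum_congr rfl fun m _ => ?_
    change Γ m a b z * (τ z * (coordForm o c * ricciOf h R ![m, d] z
      - coordForm o d * ricciOf h R ![m, c] z)) = _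
    ring
  have e3 : ∑ m, Γ m a c z * timeWedge o τ (ricciOf h R) ![b, m, d] z
      = τ z * (Γ o a c z * ricciOf h R ![b, d] z
        - coordForm o d * ∑ m, Γ m a c z * ricciOf h R ![b, m] z) := by
    rw [← hs o (fun _ => ricciOf h R ![b, d] z)]
    simp only [Finset.mul_sum, ← Finset.sum_sub_distrib]
    refine Finset.sum_congr rfl fun m _ => ?_
    change Γ m a c z * (τ z * (coordForm o m * ricciOf h R ![b, d] z
      - coordForm o d * ricciOf h R ![b, m] z)) = _
    ring
  have e4 : ∑ m, Γ m a d z * timeWedge o τ (ricciOf h R) ![b, c, m] z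
      = τ z * (coordForm o c * ∑ m, Γ m a d z * ricciOf h R ![b, m] z
        - Γ o a d z * ricciOf h R ![b, c] z) := by
    rw [← hs o (fun _ => ricciOf h R ![b, c] z)]
    simp only [Finset.mul_sum, ← Finset.sum_sub_distrib]
    refine Finset.sum_congr rfl fun m _ => ?_
    change Γ m a d z * (τ z * (coordForm o c * ricciOf h R ![b, m] z
      - coordForm o m * ricciOf h R ![b, c] z)) = _
    ring
  rw [covD_three, covD_two, covD_two, e1, e2, e3, e4, hR.conn_time a c z hz,
    hR.conn_time a d z hz]
  ring

/-- Inserting `∂_o` does not commute with `∇_a`; the defect is the curvature evaluated on `∇_a ∂_o`,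
and the soliton equation turns it into a Ricci term and a `τ` term. -/
theorem covD_curvature_time (hz : z ∈ D) (a b c d : ι) : covD D Γ R ![a, o, b, c, d] z
    = covD D Γ (divOf D Γ h R) ![a, b, c, d] z
      + covD D Γ (timeWedge o τ (ricciOf h R)) ![a, b, c, d] z
      + ∑ p, ∑ q, h p q z * (ricciOf h R ![a, q] z * R ![p, b, c, d] z)
      + τ z * coordForm o a * R ![o, b, c, d] z := by
  have h1 := covD_insert (D := D) (Γ := Γ) R a o ![b, c, d] z
  have h2 := hR.sum_conn_field hz a (fun p => R ![p, b, c, d] z)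
  have h3 : covD D Γ (fun s => R (vecCons o s)) (vecCons a ![b, c, d]) z
      = covD D Γ (divOf D Γ h R) ![a, b, c, d] z
      + covD D Γ (timeWedge o τ (ricciOf h R)) ![a, b, c, d] z := by
    rw [← covD_add hR.domain hz hR.divOf_smooth hR.timeWedge_smooth]
    refine covD_congr (fun s y hy => ?_) hz _
    rw [vec_three_eta s]
    exact hR.curvature_time hy _ _ _
  linarith

/-- The heat operator of the curvature tensor. -/
theorem heat_curvature (hz : z ∈ D) (a b c d : ι) :
    covD D Γ R ![o, a, b, c, d] z - lapOf D Γ h R ![a, b, c, d] z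
      = curvQuad (fun m n => h m n z) (fun a b c d => R ![a, b, c, d] z) a b c d
        + covD D Γ (timeWedge o τ (ricciOf h R)) ![a, b, c, d] z
        - covD D Γ (timeWedge o τ (ricciOf h R)) ![b, a, c, d] z
        + τ z * (coordForm o a * R ![o, b, c, d] z - coordForm o b * R ![o, a, c, d] z) := by
  -- After the second Bianchi identity, the divergence and Ricci terms of `h3` and `h4` are exactly
  -- those in the Laplacian `h5`.
  have h1 := hR.bianchi_second o a b c d z hz
  have h2 := hR.covD_antisymm_left hz a o b c d
  have h3 := hR.covD_curvature_time hz a b c d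
  have h4 := hR.covD_curvature_time hz b a c d
  have h5 := hR.lapOf_curvature hz a b c d
  have h6 : ∑ p, ∑ q, h p q z * (ricciOf h R ![b, q] z * R ![a, p, c, d] z)
      = - ∑ p, ∑ q, h p q z * (ricciOf h R ![b, q] z * R ![p, a, c, d] z) := by
    simp only [← Finset.sum_neg_distrib]
    refine Finset.sum_congr rfl fun p _ => Finset.sum_congr rfl fun q _ => ?_
    rw [hR.antisymm_left p a c d z hz]
    ring
  linarith

theorem heat_space (hz : z ∈ D) {i j k l : ι} (hi : i ≠ o) (hj : j ≠ o) (hk : k ≠ o)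
    (hl : l ≠ o) : covD D Γ R ![o, i, j, k, l] z - lapOf D Γ h R ![i, j, k, l] z
      = curvQuad (fun m n => h m n z) (fun a b c d => R ![a, b, c, d] z) i j k l := by
  rw [hR.heat_curvature hz, hR.covD_timeWedge hz, hR.covD_timeWedge hz, coordForm_of_ne hi,
    coordForm_of_ne hj, coordForm_of_ne hk, coordForm_of_ne hl]
  ring

theorem curvature_one_time (hz : z ∈ D) {i j : ι} (hi : i ≠ o) (hj : j ≠ o) (k : ι) :
    R ![i, j, o, k] z = covD D Γ (ricciOf h R) ![i, j, k] z
      - covD D Γ (ricciOf h R) ![j, i, k] z := by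
  rw [hR.curvature_field hz, hR.divOf_eq hz, coordForm_of_ne hi, coordForm_of_ne hj]
  ring

theorem heat_one_time (hz : z ∈ D) {i j k : ι} (hi : i ≠ o) (hj : j ≠ o) (hk : k ≠ o) :
    covD D Γ R ![o, i, j, o, k] z - lapOf D Γ h R ![i, j, o, k] z
      = curvQuad (fun m n => h m n z) (fun a b c d => R ![a, b, c, d] z) i j o k
        + τ z * R ![i, j, o, k] z := by
  rw [hR.heat_curvature hz, hR.covD_timeWedge hz, hR.covD_timeWedge hz,
    hR.curvature_one_time hz hi hj, coordForm_of_ne hi,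
    coordForm_of_ne hj, coordForm_of_ne hk, coordForm_self]
  ring

/-- One copy of `τ R_{iojo}` is the explicit correction in `heat_curvature`. The other comes from
the first-order Ricci terms of the wedge, which by `h1` equal `R_{iojo} - τ Ric_{ij}`. -/
theorem heat_two_time (hz : z ∈ D) {i j : ι} (hi : i ≠ o) (hj : j ≠ o) :
    covD D Γ R ![o, i, o, j, o] z - lapOf D Γ h R ![i, o, j, o] z
      = curvQuad (fun m n => h m n z) (fun a b c d => R ![a, b, c, d] z) i o j o
        - 2 * τ z ^ 2 * ricciOf h R ![i, j] z + 2 * τ z * R ![i, o, j, o] z := by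
  have h1 : R ![i, o, j, o] z = covD D Γ (ricciOf h R) ![o, i, j] z
      - covD D Γ (ricciOf h R) ![i, o, j] z + τ z * ricciOf h R ![i, j] z := by
    rw [hR.antisymm_right i o o j z hz, hR.curvature_field hz, hR.divOf_eq hz,
      hR.ricciOf_symm hz j i, coordForm_of_ne hi, coordForm_self]
    ring
  have h2 := hR.antisymm_left i o j o z hz
  rw [hR.heat_curvature hz, hR.covD_timeWedge hz, hR.covD_timeWedge hz, h2, coordForm_of_ne hi,
    coordForm_of_ne hj, coordForm_self]
  linear_combination (-τ z) * h1

/-- The component `R_{iojo}` of the curvature tensor. -/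
theorem curvature_two_time (hz : z ∈ D) {i j : ι} (hi : i ≠ o) (hj : j ≠ o) :
    R ![i, o, j, o] z = lapOf D Γ h (ricciOf h R) ![i, j] z
      + 2 * contract₂ (fun m n => h m n z)
        (fun m n p q => R ![i, m, j, p] z * ricciOf h R ![n, q] z)
      - ∑ p, ∑ q, h p q z * (ricciOf h R ![i, q] z * ricciOf h R ![p, j] z)
      - (1 / 2) * covD D Γ (covD D Γ (k := 0) (fun _ => traceOf h (ricciOf h R))) ![i, j] z
      + τ z * ricciOf h R ![i, j] z := by
  have hW : SmoothTensor D (covD D Γ (ricciOf h R)) :=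
    SmoothTensor.covD hR.domain hR.conn_smooth hR.ricciOf_smooth
  have hc : R ![i, o, j, o] z = divOf D Γ h R ![i, o, j] z + τ z * ricciOf h R ![i, j] z := by
    rw [← neg_neg (R ![i, o, j, o] z), ← hR.antisymm_left i o j o z hz,
      ← hR.antisymm_right o i j o z hz, hR.curvature_time hz]
    change _ + τ z * (coordForm o o * ricciOf h R ![i, j] z
      - coordForm o j * ricciOf h R ![i, o] z) = _
    rw [coordForm_self, coordForm_of_ne hj]
    ring
  -- For spatial `m, n` the wedge terms vanish. The derivative of the divergence is written by
  -- second derivatives of the Ricci tensor, and `∇_m` is commuted past `∇_i` to prepare the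
  -- contracted Bianchi identity in `hb`.
  have hd : ∀ m n, m ≠ o → n ≠ o → covD D Γ R ![m, n, i, o, j] z
      = covD D Γ (covD D Γ (ricciOf h R)) ![m, n, i, j] z
        - covD D Γ (covD D Γ (ricciOf h R)) ![i, m, n, j] z
        - ∑ p, ∑ q, h p q z * (R ![m, i, n, q] z * ricciOf h R ![p, j] z
          + R ![m, i, j, q] z * ricciOf h R ![n, p] z)
        + ∑ p, ∑ q, h p q z * (ricciOf h R ![m, q] z * R ![p, j, n, i] z) := by
    intro m n hm hn
    rw [← hR.covD_pair_symm hz, hR.covD_curvature_time hz, hR.covD_divOf_eq hz,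
      hR.covD_timeWedge hz, hR.covD_covD_comm_two hz hR.ricciOf_smooth m i n j,
      coordForm_of_ne hm, coordForm_of_ne hn, coordForm_of_ne hi]
    ring
  have hsum : divOf D Γ h R ![i, o, j] z = ∑ m, ∑ n, h m n z *
      (covD D Γ (covD D Γ (ricciOf h R)) ![m, n, i, j] z
        - covD D Γ (covD D Γ (ricciOf h R)) ![i, m, n, j] z
        - ∑ p, ∑ q, h p q z * (R ![m, i, n, q] z * ricciOf h R ![p, j] z
          + R ![m, i, j, q] z * ricciOf h R ![n, p] z)
        + ∑ p, ∑ q, h p q z * (ricciOf h R ![m, q] z * R ![p, j, n, i] z)) := by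
    refine Finset.sum_congr rfl fun m _ => Finset.sum_congr rfl fun n _ => ?_
    by_cases hm : m = o
    · rw [hm, hR.inv_time n z hz, zero_mul, zero_mul]
    by_cases hn : n = o
    · rw [hn, hR.inv_time' hz, zero_mul, zero_mul]
    exact congrArg _ (hd m n hm hn)
  have hb : ∑ m, ∑ n, h m n z * covD D Γ (covD D Γ (ricciOf h R)) ![i, m, n, j] z
      = (1 / 2) * covD D Γ (covD D Γ (k := 0) (fun _ => traceOf h (ricciOf h R))) ![i, j] z := by
    have hS : SmoothTensor D (covD D Γ (k := 0) (fun _ => traceOf h (ricciOf h R))) :=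
      SmoothTensor.covD hR.domain hR.conn_smooth fun _ => SmoothFn.sum fun _ _ =>
        SmoothFn.sum fun _ _ => (hR.inv_smooth _ _).mul (hR.ricciOf_smooth _)
    rw [← covD_const_mul hR.domain hz hS]
    refine Eq.trans (covD_contract hR.domain hz hR.inv_smooth hR.parallel hW i ![j]).symm ?_
    refine covD_congr (fun s y hy => ?_) hz _
    refine Eq.trans (b := ∑ a, ∑ b, h a b y * covD D Γ (ricciOf h R) ![a, b, s 0] y) ?_ ?_
    · refine Finset.sum_congr rfl fun m _ => Finset.sum_congr rfl fun n _ => ?_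
      congr 3
      ext r
      fin_cases r <;> rfl
    · rw [hR.contracted_bianchi hy]
      congr 1
      simp [covD]
  have hq1 : contract₂ (fun m n => h m n z)
        (fun m n p q => R ![m, i, n, q] z * ricciOf h R ![p, j] z)
      = ∑ p, ∑ q, h p q z * (ricciOf h R ![i, q] z * ricciOf h R ![p, j] z) := by
    rw [contract₂_mul_left (fun m n => h m n z) (fun m n p q => R ![m, i, n, q] z)
      (fun p _ => ricciOf h R ![p, j] z)]
    refine Finset.sum_congr rfl fun p _ => Finset.sum_congr rfl fun q _ => ?_
    congr 2
    change _ = ∑ m, ∑ n, h m n z * R ![i, m, q, n] z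
    refine Finset.sum_congr rfl fun m _ => Finset.sum_congr rfl fun n _ => ?_
    rw [hR.antisymm_left i m n q z hz, hR.antisymm_right i m q n z hz, neg_neg]
  have hs : ∀ a b, h a b z = h b a z := fun a b => hR.inv_symm a b z hz
  have hq2 : contract₂ (fun m n => h m n z)
        (fun m n p q => R ![m, i, j, q] z * ricciOf h R ![n, p] z)
      = - contract₂ (fun m n => h m n z)
        (fun m n p q => R ![i, m, j, p] z * ricciOf h R ![n, q] z) := by
    rw [← contract₂_neg, ← contract₂_swap_right hs]
    refine contract₂_congr _ fun m n p q => ?_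
    rw [hR.antisymm_left i m j p z hz]
    ring
  have hq3 : contract₂ (fun m n => h m n z)
        (fun m n p q => ricciOf h R ![m, q] z * R ![p, j, n, i] z)
      = contract₂ (fun m n => h m n z)
        (fun m n p q => R ![i, m, j, p] z * ricciOf h R ![n, q] z) := by
    rw [← contract₂_swap_left hs]
    refine contract₂_congr _ fun m n p q => ?_
    rw [hR.pair_symm hz p j m i, hR.antisymm_left i m p j z hz, hR.antisymm_right i m j p z hz]
    ring
  have hl : lapOf D Γ h (ricciOf h R) ![i, j] z
      = ∑ m, ∑ n, h m n z * covD D Γ (covD D Γ (ricciOf h R)) ![m, n, i, j] z := rfl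
  have hsplit : contract₂ (fun m n => h m n z)
        (fun m n p q => R ![m, i, n, q] z * ricciOf h R ![p, j] z
          + R ![m, i, j, q] z * ricciOf h R ![n, p] z)
      = ∑ m, ∑ n, h m n z * ∑ p, ∑ q, h p q z * (R ![m, i, n, q] z * ricciOf h R ![p, j] z
          + R ![m, i, j, q] z * ricciOf h R ![n, p] z) := by
    simp only [contract₂, Finset.mul_sum, mul_assoc]
  have hsplit' : contract₂ (fun m n => h m n z)
        (fun m n p q => ricciOf h R ![m, q] z * R ![p, j, n, i] z)
      = ∑ m, ∑ n, h m n z * ∑ p, ∑ q, h p q z * (ricciOf h R ![m, q] z * R ![p, j, n, i] z) := by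
    simp only [contract₂, Finset.mul_sum, mul_assoc]
  rw [contract₂_add, hq1, hq2] at hsplit
  rw [hq3] at hsplit'
  simp only [mul_sub, mul_add, Finset.sum_sub_distrib, Finset.sum_add_distrib]
    at hsum hsplit hsplit'
  rw [hc, hsum]
  linarith

end SolitonGeometry

end Heat

/-! ### Identification of the limit tensors with tensors of the time slices. -/

section Restriction

open Matrix (vecCons)

variable {n : ℕ} {U : Set (Coords (Fin n))} {T : ℝ}
  {γ : ℝ → Coords (Fin n) → Matrix (Fin n) (Fin n) ℝ} {z : Coords (Fin (n + 1))}
  {R : CovTensor (Fin (n + 1)) 4}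

@[simp] theorem limInv_zero_left (b : Fin (n + 1)) : limInv γ 0 b z = 0 := by
  refine Fin.cases ?_ (fun j => ?_) b <;> simp [limInv]

@[simp] theorem limInv_zero_right (a : Fin (n + 1)) : limInv γ a 0 z = 0 := by
  refine Fin.cases ?_ (fun j => ?_) a <;> simp [limInv]

@[simp] theorem limInv_succ_succ (i j : Fin n) : limInv γ i.succ j.succ z = stInv γ z i j := by
  simp [limInv]

@[simp] theorem limConn_zero_succ (b : Fin (n + 1)) (i : Fin n) :
    limConn U T γ 0 b i.succ z = 0 := by
  refine Fin.cases ?_ (fun j => ?_) b <;> rfl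

@[simp] theorem limConn_zero_succ_left (b : Fin (n + 1)) (i : Fin n) :
    limConn U T γ 0 i.succ b z = 0 := rfl

@[simp] theorem limConn_succ (k i j : Fin n) :
    limConn U T γ k.succ i.succ j.succ z = stChr U γ k i j z := rfl

theorem sum_limInv (f : Fin (n + 1) → Fin (n + 1) → ℝ) :
    ∑ a, ∑ b, limInv γ a b z * f a b = ∑ i : Fin n, ∑ j : Fin n, stInv γ z i j * f i.succ j.succ := by
  simp [Fin.sum_univ_succ]

theorem contract₂_limInv (f : Fin (n + 1) → Fin (n + 1) → Fin (n + 1) → Fin (n + 1) → ℝ) :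
    contract₂ (fun a b => limInv γ a b z) f = contract₂ (stInv γ z)
      (fun m n p q => f m.succ n.succ p.succ q.succ) := by
  simp [contract₂, Fin.sum_univ_succ]

theorem connCurv_limConn_succ (a b c f : Fin n) :
    connCurv (spacetimeDomain U T) (limConn U T γ) a.succ b.succ c.succ f.succ z
      = pderivOn (spacetimeDomain U T) b.succ (stChr U γ f a c) z
        - pderivOn (spacetimeDomain U T) a.succ (stChr U γ f b c) z
        + ∑ e, (stChr U γ e a c z * stChr U γ f b e z
          - stChr U γ e b c z * stChr U γ f a e z) := by
  rw [connCurv, Fin.sum_univ_succ]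
  simp only [limConn_zero_succ, zero_mul, sub_zero, zero_add, limConn_succ]
  rfl

namespace CoordRicciFlow

variable (hγ : CoordRicciFlow U T γ)
include hγ

/-- Covariant derivatives of spatial components are intrinsic to the time slices. -/
theorem covDeriv_slice {k : ℕ} {t : ℝ} (ht : t ∈ Ioc 0 T) {A : CovTensor (Fin n) k}
    {B : CovTensor (Fin (n + 1)) k} (hB : SmoothTensor (spacetimeDomain U T) B)
    (h : ∀ s, ∀ x ∈ U, A s x = B (Fin.succ ∘ s) (stJoin t x)) (s : Fin (k + 1) → Fin n)
    {x : Coords (Fin n)} (hx : x ∈ U) :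
    covDeriv U (γ t) A s x
      = covD (spacetimeDomain U T) (limConn U T γ) B (Fin.succ ∘ s) (stJoin t x) := by
  unfold covDeriv covD
  rw [pderivOn_congr (h _) hx, pderivOn_slice hγ.isOpen (hB _) ht hx]
  congr 1
  refine Finset.sum_congr rfl fun r _ => ?_
  -- The additional time index in the space-time sum contributes nothing, as `Γ^0_{ij} = 0` in the
  -- limit.
  rw [Fin.sum_univ_succ]
  simp only [Function.comp_apply, limConn_zero_succ, zero_mul, zero_add, limConn_succ, h _ x hx,
    Function.comp_update]
  rfl

variable (hR : ∀ a b c k, ∀ z ∈ spacetimeDomain U T, R ![a, b, c, Fin.succ k] z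
      = ∑ f : Fin n, stG γ k f z * connCurv (spacetimeDomain U T)
        (limConn U T γ) a b c f.succ z)
include hR

theorem limit_riemann_succ (hz : z ∈ spacetimeDomain U T) (i j k l : Fin n) :
    R ![i.succ, j.succ, k.succ, l.succ] z = stRm U γ z i j k l := by
  rw [hR _ _ _ _ z hz, hγ.stRm_eq hz]
  simp only [connCurv_limConn_succ]

theorem limit_ricci_succ (hz : z ∈ spacetimeDomain U T) (i j : Fin n) :
    ricciOf (limInv γ) R ![i.succ, j.succ] z = stRic U γ z i j := by
  change ∑ k, ∑ l, limInv γ k l z * R ![i.succ, k, j.succ, l] z = _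
  rw [sum_limInv, stRic_eq]
  simp only [hγ.limit_riemann_succ hR hz]

theorem limit_scalar (hz : z ∈ spacetimeDomain U T) :
    traceOf (limInv γ) (ricciOf (limInv γ) R) z = stScal U γ z := by
  rw [traceOf, sum_limInv, stScal_eq]
  simp only [hγ.limit_ricci_succ hR hz]

theorem solitonGeometry
    (hC : CurvatureGeometry (spacetimeDomain U T) (limConn U T γ) (limInv γ) R) :
    SolitonGeometry (spacetimeDomain U T) (limConn U T γ) (limInv γ) R 0 (fun z => 1 / 2 / z 0)
      (fun s => limRic U T γ (s 0) (s 1)) where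
  toCurvatureGeometry := hC
  rate_smooth := inv_time_smooth (1 / 2)
  field_smooth s := hγ.limRic_smooth (s 0) (s 1)
  inv_time b y _ := limInv_zero_left b
  conn_time b c y _ := by
    refine Fin.cases ?_ (fun i => ?_) c
    · refine Fin.cases ?_ (fun j => ?_) b
      · change -(1 / 2 / y 0) = _
        simp
      · simp [coordForm_of_ne (Fin.succ_ne_zero j)]
    · simp [coordForm_of_ne (Fin.succ_ne_zero i)]
  conn_field a c y _ := by
    refine Fin.cases ?_ (fun k => ?_) a
    · refine Fin.cases ?_ (fun i => ?_) c
      · simp only [limInv_zero_left, zero_mul, Finset.sum_const_zero, coordForm_self]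
        change -(1 / 2 / y 0) = _
        ring
      · simp [coordForm_of_ne (Fin.succ_ne_zero i)]
    · rw [coordForm_of_ne (Fin.succ_ne_zero k), mul_zero, sub_zero, Fin.sum_univ_succ,
        limInv_zero_right, zero_mul, zero_add]
      simp only [limInv_succ_succ]
      refine Fin.cases ?_ (fun i => ?_) c <;> rfl
  pderivOn_rate c y hy := by
    rw [hγ.pderivOn_inv_time hy]
    have h0 := (time_pos hy).ne'
    simp only [coordForm]
    split_ifs
    · field_simp
    · ring
  field_symm a b y hy := by
    refine Fin.cases ?_ (fun i => ?_) a <;> refine Fin.cases ?_ (fun j => ?_) b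
    · rfl
    · rfl
    · rfl
    · exact hγ.stRic_symm hy i j
  field_space a b ha hb y hy := by
    obtain ⟨i, rfl⟩ := Fin.exists_succ_eq.2 ha
    obtain ⟨j, rfl⟩ := Fin.exists_succ_eq.2 hb
    exact (hγ.limit_ricci_succ hR hy i j).symm
  field_time a y hy := by
    rw [hγ.limit_scalar hR hy, pderivOn_congr (fun x hx => hγ.limit_scalar hR hx) hy]
    refine Fin.cases ?_ (fun i => ?_) a
    · rw [coordForm_self]
      change (1 / 2) * (pderivOn (spacetimeDomain U T) 0 (stScal U γ) y + stScal U γ y / y 0) = _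
      ring
    · rw [coordForm_of_ne (Fin.succ_ne_zero i)]
      change (1 / 2) * pderivOn (spacetimeDomain U T) i.succ (stScal U γ) y = _
      ring
  exists_lower := by
    refine ⟨fun a f y => Fin.cases 0 (fun i => Fin.cases 0 (fun j => stG γ i j y) f) a, ?_⟩
    intro y hy a ha p
    obtain ⟨i, rfl⟩ := Fin.exists_succ_eq.2 ha
    rw [Fin.sum_univ_succ]
    simp only [limInv_zero_left, mul_zero, zero_add, Fin.cases_succ]
    refine Fin.cases ?_ (fun j => ?_) p
    · simp [Fin.succ_ne_zero]
    · simp only [limInv_succ_succ, hγ.stG_mul_stInv hy, Fin.succ_inj]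

variable (hC : CurvatureGeometry (spacetimeDomain U T) (limConn U T γ) (limInv γ) R)
include hC

theorem ricci_slice {t : ℝ} (ht : t ∈ Ioc 0 T) (s : Fin 2 → Fin n) {x : Coords (Fin n)}
    (hx : x ∈ U) : ricci U (γ t) s x = ricciOf (limInv γ) R (Fin.succ ∘ s) (stJoin t x) := by
  rw [vec_two_eta (Fin.succ ∘ s), vec_two_eta s]
  exact (hγ.limit_ricci_succ hR (stJoin_mem ht hx) _ _).symm

theorem covDeriv_ricci_slice {t : ℝ} (ht : t ∈ Ioc 0 T) (s : Fin 3 → Fin n) {x : Coords (Fin n)}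
    (hx : x ∈ U) : covDeriv U (γ t) (ricci U (γ t)) s x
      = covD (spacetimeDomain U T) (limConn U T γ) (ricciOf (limInv γ) R) (Fin.succ ∘ s)
        (stJoin t x) :=
  hγ.covDeriv_slice ht hC.ricciOf_smooth (fun s x hx => hγ.ricci_slice hR hC ht s hx) s hx

theorem stP_eq (hz : z ∈ spacetimeDomain U T) (i j k : Fin n) :
    stP U γ z i j k = R ![i.succ, j.succ, 0, k.succ] z := by
  rw [(hγ.solitonGeometry hR hC).curvature_one_time hz (Fin.succ_ne_zero i) (Fin.succ_ne_zero j),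
    stP, harnackP, hγ.covDeriv_ricci_slice hR hC hz.1 _ hz.2,
    hγ.covDeriv_ricci_slice hR hC hz.1 _ hz.2, stJoin_spacePart, vec_three_eta (Fin.succ ∘ _),
    vec_three_eta (Fin.succ ∘ ![j, i, k])]
  rfl

/-- The formula of `curvature_two_time` is that of `M_{ij}`, with `τ = 1/(2t)`; all derivatives and
contractions in it are spatial and hence computed within the slice. -/
theorem stMdd_eq (hz : z ∈ spacetimeDomain U T) (i j : Fin n) :
    stMdd U γ z i j = R ![i.succ, 0, j.succ, 0] z := by
  have hS := hγ.solitonGeometry hR hC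
  have e1 : tensorLaplacian U (γ (z 0)) (ricci U (γ (z 0))) ![i, j] (spacePart z)
      = lapOf (spacetimeDomain U T) (limConn U T γ) (limInv γ) (ricciOf (limInv γ) R)
        ![i.succ, j.succ] z := by
    unfold tensorLaplacian lapOf
    rw [sum_limInv]
    refine Finset.sum_congr rfl fun a _ => Finset.sum_congr rfl fun b _ => ?_
    rw [hγ.covDeriv_slice hz.1 (SmoothTensor.covD hC.domain hC.conn_smooth hC.ricciOf_smooth)
      (fun s x hx => hγ.covDeriv_ricci_slice hR hC hz.1 s hx) _ hz.2, stJoin_spacePart]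
    congr 2
    ext r
    fin_cases r <;> rfl
  have e2 : covDeriv U (γ (z 0)) (covDeriv U (γ (z 0)) (k := 0)
      (fun _ => scalarCurv U (γ (z 0)))) ![i, j] (spacePart z)
      = covD (spacetimeDomain U T) (limConn U T γ) (covD (spacetimeDomain U T) (limConn U T γ)
        (k := 0) (fun _ => traceOf (limInv γ) (ricciOf (limInv γ) R))) ![i.succ, j.succ] z := by
    have hs : SmoothTensor (k := 0) (spacetimeDomain U T)
        (fun _ => traceOf (limInv γ) (ricciOf (limInv γ) R)) := fun _ =>
      SmoothFn.sum fun _ _ => SmoothFn.sum fun _ _ =>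
        (hC.inv_smooth _ _).mul (hC.ricciOf_smooth _)
    have h0 : ∀ (s : Fin 0 → Fin n), ∀ x ∈ U, scalarCurv U (γ (z 0)) x
        = traceOf (limInv γ) (ricciOf (limInv γ) R) (stJoin (z 0) x) := fun _ x hx =>
      (hγ.limit_scalar hR (stJoin_mem hz.1 hx)).symm
    rw [hγ.covDeriv_slice hz.1 (SmoothTensor.covD hC.domain hC.conn_smooth hs)
      (fun s x hx => hγ.covDeriv_slice (A := fun _ => scalarCurv U (γ (z 0))) hz.1 hs h0 s hx)
      _ hz.2, stJoin_spacePart, vec_two_eta (Fin.succ ∘ _)]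
    rfl
  rw [hS.curvature_two_time hz (Fin.succ_ne_zero i) (Fin.succ_ne_zero j), stMdd, harnackM, e1, e2,
    contract₂_limInv, sum_limInv]
  simp only [hγ.limit_riemann_succ hR hz, hγ.limit_ricci_succ hR hz]
  congr 1
  · congr 1
    congr 1
    · congr 2
      unfold contract₂
      refine Finset.sum_congr rfl fun k _ => ?_
      rw [Finset.sum_comm]
      refine Finset.sum_congr rfl fun p _ => Finset.sum_congr rfl fun l _ =>
        Finset.sum_congr rfl fun q _ => ?_
      simp only [stRm, stRic, stInv]
      ring
    · refine Finset.sum_congr rfl fun p _ => Finset.sum_congr rfl fun q _ => ?_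
      rw [hγ.stInv_symm hz p q]
      simp only [stRic, stInv]
      ring
  · simp only [stRic]
    ring

end CoordRicciFlow

end Restriction

/-! ### The quadratic terms in the three types of components. -/

section Components

variable {n : ℕ} {U : Set (Coords (Fin n))} {T : ℝ}
  {γ : ℝ → Coords (Fin n) → Matrix (Fin n) (Fin n) ℝ} {z : Coords (Fin (n + 1))}
  {R : CovTensor (Fin (n + 1)) 4}

theorem sum_raise (h : Fin n → Fin n → ℝ) (X Y : Fin n → Fin n → ℝ) :
    ∑ p, ∑ q, X p q * ∑ a, ∑ b, h p a * h q b * Y a b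
      = contract₂ h (fun m n p q => X m p * Y n q) := by
  simp only [contract₂, Finset.mul_sum]
  refine Finset.sum_congr rfl fun p _ => ?_
  rw [Finset.sum_comm]
  refine Finset.sum_congr rfl fun a _ => Finset.sum_congr rfl fun q _ =>
    Finset.sum_congr rfl fun b _ => ?_
  ring

theorem sum_raise_swap (h : Fin n → Fin n → ℝ) (X Y : Fin n → Fin n → ℝ) :
    ∑ p, ∑ q, X p q * ∑ a, ∑ b, h q a * h p b * Y a b
      = contract₂ h (fun m n p q => X m p * Y q n) := by
  rw [← sum_raise h X (fun a b => Y b a)]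
  refine Finset.sum_congr rfl fun p _ => Finset.sum_congr rfl fun q _ => ?_
  rw [Finset.sum_comm]
  congr 1
  refine Finset.sum_congr rfl fun b _ => Finset.sum_congr rfl fun a _ => ?_
  ring

namespace CoordRicciFlow

variable (hγ : CoordRicciFlow U T γ)
  (hR : ∀ a b c k, ∀ z ∈ spacetimeDomain U T, R ![a, b, c, Fin.succ k] z
      = ∑ f : Fin n, stG γ k f z * connCurv (spacetimeDomain U T)
        (limConn U T γ) a b c f.succ z)
  (hC : CurvatureGeometry (spacetimeDomain U T) (limConn U T γ) (limInv γ) R)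
include hγ hR hC

theorem heat_ijkl (hz : z ∈ spacetimeDomain U T) (i j k l : Fin n) :
    curvQuad (fun a b => limInv γ a b z) (fun a b c d => R ![a, b, c, d] z)
        i.succ j.succ k.succ l.succ
      = ∑ p, ∑ q, (2 * stRm U γ z i p j q * stRmdudu U γ z k p l q
            - 2 * stRm U γ z i p j q * stRmdudu U γ z l p k q
            + 2 * stRm U γ z i p k q * stRmdudu U γ z j p l q
            - 2 * stRm U γ z i p l q * stRmdudu U γ z j p k q) := by
  simp only [Finset.sum_sub_distrib, Finset.sum_add_distrib, mul_assoc (2 : ℝ), ← Finset.mul_sum]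
  simp only [stRmdudu, sum_raise]
  rw [curvQuad, contract₂_limInv]
  simp only [hγ.limit_riemann_succ hR hz, contract₂_sub, contract₂_add, contract₂_const_mul]

theorem heat_ij0k (hz : z ∈ spacetimeDomain U T) (i j k : Fin n) :
    curvQuad (fun a b => limInv γ a b z) (fun a b c d => R ![a, b, c, d] z)
        i.succ j.succ 0 k.succ
      = ∑ p, ∑ q, (2 * stRm U γ z i p j q * stPuud U γ z p q k
            + 2 * stRm U γ z i p k q * stPudu U γ z p j q
            + 2 * stRm U γ z j p k q * stPduu U γ z i p q) := by
  have hP := fun a b c => hγ.stP_eq hR hC hz a b c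
  have hs : ∀ a b, stInv γ z a b = stInv γ z b a := hγ.stInv_symm hz
  simp only [Finset.sum_add_distrib, mul_assoc (2 : ℝ), ← Finset.mul_sum]
  simp only [stPuud, stPudu, stPduu, sum_raise]
  rw [curvQuad, contract₂_limInv]
  -- The first Bianchi identity merges the first two products, through `R_{0rkq} - R_{kr0q} =
  -- R_{rq0k} = P_{rqk}`.
  have e1 : ∀ m r p q : Fin n, 2 * (R ![i.succ, m.succ, j.succ, p.succ] z
        * R ![0, r.succ, k.succ, q.succ] z)
      - 2 * (R ![i.succ, m.succ, j.succ, p.succ] z * R ![k.succ, r.succ, 0, q.succ] z)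
      + 2 * (R ![i.succ, m.succ, 0, p.succ] z * R ![j.succ, r.succ, k.succ, q.succ] z)
      - 2 * (R ![i.succ, m.succ, k.succ, p.succ] z * R ![j.succ, r.succ, 0, q.succ] z)
      = 2 * (stRm U γ z i m j p * stP U γ z r q k) + 2 * (stRm U γ z i m k p * stP U γ z r j q)
        + 2 * (stRm U γ z j r k q * stP U γ z i m p) := by
    intro m r p q
    have h1 := hC.bianchi_first r.succ q.succ 0 k.succ z hz
    have h2 := hC.antisymm_left j.succ r.succ 0 q.succ z hz
    have h3 := hC.pair_symm hz k.succ r.succ 0 q.succ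
    have h4 := hC.antisymm_left 0 q.succ r.succ k.succ z hz
    have h5 := hC.antisymm_right 0 q.succ r.succ k.succ z hz
    have h6 := hC.antisymm_right 0 r.succ k.succ q.succ z hz
    simp only [hP, ← hγ.limit_riemann_succ hR hz]
    rw [h2]
    linear_combination 2 * R ![i.succ, m.succ, j.succ, p.succ] z * (-h1 + h6 + h4 - h3 - h5)
  simp only [e1, contract₂_add, contract₂_const_mul]
  congr 2
  rw [← contract₂_swap_left hs, ← contract₂_swap_right hs]

theorem heat_i0j0 (hz : z ∈ spacetimeDomain U T) (i j : Fin n) :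
    curvQuad (fun a b => limInv γ a b z) (fun a b c d => R ![a, b, c, d] z)
        i.succ 0 j.succ 0
      = ∑ p, ∑ q, (2 * stRm U γ z i p j q * stMuu U γ z p q
            + 2 * stP U γ z i p q * stPduu U γ z j p q
            - 4 * stP U γ z i p q * stPduu U γ z j q p) := by
  have hP := fun a b c => hγ.stP_eq hR hC hz a b c
  have hM := fun a b => hγ.stMdd_eq hR hC hz a b
  simp only [Finset.sum_add_distrib, Finset.sum_sub_distrib, mul_assoc (2 : ℝ),
    mul_assoc (4 : ℝ), ← Finset.mul_sum]
  simp only [stMuu, stPduu, sum_raise, sum_raise_swap]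
  rw [curvQuad, contract₂_limInv]
  have e1 : ∀ m r p q : Fin n, 2 * (R ![i.succ, m.succ, 0, p.succ] z
        * R ![j.succ, r.succ, 0, q.succ] z)
      - 2 * (R ![i.succ, m.succ, 0, p.succ] z * R ![0, r.succ, j.succ, q.succ] z)
      + 2 * (R ![i.succ, m.succ, j.succ, p.succ] z * R ![0, r.succ, 0, q.succ] z)
      - 2 * (R ![i.succ, m.succ, 0, p.succ] z * R ![0, r.succ, j.succ, q.succ] z)
      = 2 * (stRm U γ z i m j p * stMdd U γ z r q) + 2 * (stP U γ z i m p * stP U γ z j r q)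
        - 4 * (stP U γ z i m p * stP U γ z j q r) := by
    intro m r p q
    have h1 := hC.antisymm_left r.succ 0 q.succ 0 z hz
    have h2 := hC.antisymm_right 0 r.succ q.succ 0 z hz
    have h3 := hC.pair_symm hz 0 r.succ j.succ q.succ
    rw [h3, h2, h1, hP, hP, hP, hM, hγ.limit_riemann_succ hR hz]
    ring
  simp only [e1, contract₂_add, contract₂_sub, contract₂_const_mul]

end CoordRicciFlow

end Components

end

/-! ### The three expansions in a chart. -/

theorem proposition3p4 {n : ℕ} {M : Type*} [TopologicalSpace M]
    [ChartedSpace (EuclideanSpace ℝ (Fin n)) M] [IsManifold (𝓡 n) ∞ M]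
    {T : ℝ} (hT : 0 < T) (g : ℝ → RiemMetric n M) (hg : IsRicciFlow T g)
    (e : OpenPartialHomeomorph M (EuclideanSpace ℝ (Fin n)))
    (he : e ∈ IsManifold.maximalAtlas (𝓡 n) ∞ M)
    (U : Set (Coords (Fin n))) (hU : U = e.target)
    (γ : ℝ → Coords (Fin n) → Matrix (Fin n) (Fin n) ℝ) (hγ : γ = flowInChart e g) :
    (∀ i j k l : Fin n,
      EqUpToInvN (spacetimeDomain U T)
        (fun N => barHeatRm U T γ N ![i.succ, j.succ, k.succ, l.succ])
        (fun z => ∑ p, ∑ q,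
          (2 * stRm U γ z i p j q * stRmdudu U γ z k p l q
            - 2 * stRm U γ z i p j q * stRmdudu U γ z l p k q
            + 2 * stRm U γ z i p k q * stRmdudu U γ z j p l q
            - 2 * stRm U γ z i p l q * stRmdudu U γ z j p k q))) ∧
    (∀ i j k : Fin n,
      EqUpToInvN (spacetimeDomain U T)
        (fun N => barHeatRm U T γ N ![i.succ, j.succ, 0, k.succ])
        (fun z => (∑ p, ∑ q,
          (2 * stRm U γ z i p j q * stPuud U γ z p q k
            + 2 * stRm U γ z i p k q * stPudu U γ z p j q
            + 2 * stRm U γ z j p k q * stPduu U γ z i p q))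
          + 1 / (2 * z 0) * stP U γ z i j k)) ∧
    (∀ i j : Fin n,
      EqUpToInvN (spacetimeDomain U T)
        (fun N => barHeatRm U T γ N ![i.succ, 0, j.succ, 0])
        (fun z => (∑ p, ∑ q,
          (2 * stRm U γ z i p j q * stMuu U γ z p q
            + 2 * stP U γ z i p q * stPduu U γ z j p q
            - 4 * stP U γ z i p q * stPduu U γ z j q p))
          - 1 / (2 * (z 0) ^ 2) * stRic U γ z i j + 1 / z 0 * stMdd U γ z i j)) := by
  subst hU hγ
  have hγ := hg.coordRicciFlow hT he
  obtain ⟨R, hexp, hR, hC⟩ := hγ.exists_limit_riemann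
  have hS := hγ.solitonGeometry hR hC
  refine ⟨fun i j k l => ?_, fun i j k => ?_, fun i j => ?_⟩
  · refine HasExp.eqUpToInvN hγ.regularDomain hγ.expansionScale
      ((hγ.hasExp_barHeatRm hexp _).congr (fun _ _ _ _ => rfl) fun z hz => ?_)
    refine (hγ.heat_ijkl hR hC hz _ _ _ _).symm.trans (Eq.symm ?_)
    exact hS.heat_space hz (Fin.succ_ne_zero i) (Fin.succ_ne_zero j) (Fin.succ_ne_zero k)
      (Fin.succ_ne_zero l)
  · refine HasExp.eqUpToInvN hγ.regularDomain hγ.expansionScale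
      ((hγ.hasExp_barHeatRm hexp _).congr (fun _ _ _ _ => rfl) fun z hz => ?_)
    rw [← hγ.heat_ij0k hR hC hz, hγ.stP_eq hR hC hz, ← div_div]
    exact Eq.symm <| hS.heat_one_time hz (Fin.succ_ne_zero i) (Fin.succ_ne_zero j) (Fin.succ_ne_zero k)
  · refine HasExp.eqUpToInvN hγ.regularDomain hγ.expansionScale
      ((hγ.hasExp_barHeatRm hexp _).congr (fun _ _ _ _ => rfl) fun z hz => ?_)
    rw [← hγ.heat_i0j0 hR hC hz, hγ.stMdd_eq hR hC hz]
    refine Eq.symm ((hS.heat_two_time hz (Fin.succ_ne_zero i) (Fin.succ_ne_zero j)).trans ?_)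
    have h0 := (CoordRicciFlow.time_pos hz).ne'
    -- With `τ = 1/(2t)`, the coefficients `2τ²` and `2τ` become `1/(2t²)` and `1/t`.
    rw [hγ.limit_ricci_succ hR hz]
    field_simp
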